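/- Let $\mathfrak{po}(0|2n)$ be the Poisson Lie superalgebra over $\mathbb{C}$: its superspace is the Grassmann superalgebra on $2n$ generators $\xi_1,\eta_1,\dots,\xi_n,\eta_n$, with bracket $$\{f,g\}=(-1)^{p(f)}\sum_{i=1}^n\left(\frac{\partial f}{\partial \xi_i}\frac{\partial g}{\partial \eta_i}+\frac{\partial f}{\partial \eta_i}\frac{\partial g}{\partial \xi_i}\right).$$ Let $\int f\,\mathrm{vol}$ be the Berezin integral (the coefficient of $\xi_1\eta_1\cdots\xi_n\eta_n$ in $f$), let $B(f,g)=\int fg\,\mathrm{vol}$, and let $I_n$ be the algebra of invariant polynomials on $\mathfrak{po}(0|2n)$, i.e. of the elements of the supersymmetric algebra $S(\mathfrak{po}(0|2n)^*)$ annihilated by the coadjoint action, extended by superderivations. For $k\ge 1$ let $r_k\in S^k(\mathfrak{po}(0|2n)^*)$ be the polynomial $r_k(f)=\int f^k\,\mathrm{vol}$, where $f$ is the generic element of $\mathfrak{po}(0|2n)$. The radial part of a polynomial is its restriction to the Cartan subalgebra spanned by the products $\prod_{j\in J}\xi_j\eta_j$, $J\subseteq\{1,\dots,n\}$; $x_j$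 denotes the coordinate on it along $\xi_j\eta_j$. (1) For every $n\ge 2$, all $r_k$ ($k=1,2,\dots$) lie in $I_n$, but the unital algebra they generate is strictly smaller than $I_n$. (2) For $n=2$ the least degree of an invariant polynomial that is not in the algebra generated by the $r_k$ is $6$: every $P\in I_2$ of degree less than $6$ lies in the algebra generated by the $r_k$, while there is $P\in I_2$, homogeneous of degree $6$, with radial part $$x_1^2x_2^2\,(x_1^2+x_2^2),$$ which does not lie in that algebra. Moreover, $P$ comes from a Casimir element: there is an even element of the center of the universal enveloping superalgebra $U(\mathfrak{po}(0|4))$ whose principal symbol of degree $6$ is $P$, when $S(\mathfrak{po}(0|4))$ is identified with $S(\mathfrak{po}(0|4)^*)$ by means of $B$. -/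

import Mathlib

open scoped TensorProduct

noncomputable section

namespace PoissonSuper

/-! ### The Poisson Lie superalgebra `po(0|2n)` -/

/-- Labels of the odd generators `ξ_1, η_1, …, ξ_n, η_n`, in this order:
`(i, 0)` stands for `ξ_i` and `(i, 1)` for `η_i`. -/
abbrev Gen (n : ℕ) : Type := Fin n ×ₗ Fin 2

/-- The superspace of `po(0|2n)`: the Grassmann superalgebra on the generators `ξ`, `η`. -/
abbrev Po (n : ℕ) : Type := ExteriorAlgebra ℂ (Gen n → ℂ)

/-- The generator `ξ_i`. -/
def xi {n : ℕ} (i : Fin n) : Po n := ExteriorAlgebra.ι ℂ (Pi.single (toLex (i, 0)) 1)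

/-- The generator `η_i`. -/
def eta {n : ℕ} (i : Fin n) : Po n := ExteriorAlgebra.ι ℂ (Pi.single (toLex (i, 1)) 1)

/-- The (left) partial derivative with respect to `ξ_i`. -/
def dXi {n : ℕ} (i : Fin n) : Po n →ₗ[ℂ] Po n :=
  CliffordAlgebra.contractLeft (LinearMap.proj (toLex (i, 0)))

/-- The (left) partial derivative with respect to `η_i`. -/
def dEta {n : ℕ} (i : Fin n) : Po n →ₗ[ℂ] Po n :=
  CliffordAlgebra.contractLeft (LinearMap.proj (toLex (i, 1)))

/-- The parity automorphism `f ↦ (-1)^{p(f)} f` of the Grassmann superalgebra. -/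
def parityAut {n : ℕ} : Po n →ₐ[ℂ] Po n := CliffordAlgebra.involute

/-- The homogeneous component of parity `p` of `po(0|2n)`. -/
def parityPart (n : ℕ) (p : ZMod 2) : Submodule ℂ (Po n) :=
  CliffordAlgebra.evenOdd (0 : QuadraticForm ℂ (Gen n → ℂ)) p

/-- The Poisson bracket
`{f, g} = (-1)^{p(f)} ∑ᵢ (∂f/∂ξᵢ ∂g/∂ηᵢ + ∂f/∂ηᵢ ∂g/∂ξᵢ)`. -/
def bracket {n : ℕ} (f g : Po n) : Po n :=
  ∑ i : Fin n, (dXi i (parityAut f) * dEta i g + dEta i (parityAut f) * dXi i g)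

/-- The basis of monomials `e_I`, the product over `I` of generators in increasing order. -/
def monoBasis (n : ℕ) : Module.Basis (Finset (Gen n)) ℂ (Po n) :=
  (Pi.basisFun ℂ (Gen n)).ExteriorAlgebra

/-- The Berezin integral `∫ f vol(ξ, η)` on `po(0|2n)`: the coefficient of the top monomial
`ξ_1 η_1 ⋯ ξ_n η_n`. -/
def integral (n : ℕ) : Po n →ₗ[ℂ] ℂ := (monoBasis n).coord Finset.univ

/-! ### Polynomials on the superspace `po(0|2n)` -/

/-- Labels of the even coordinates. -/
abbrev EvenIdx (n : ℕ) : Type := {I : Finset (Gen n) // Even I.card}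

/-- Labels of the odd coordinates. -/
abbrev OddIdx (n : ℕ) : Type := {I : Finset (Gen n) // Odd I.card}

/-- The superalgebra of polynomials on the superspace `po(0|2n)`, i.e. the supersymmetric algebra
of its dual: polynomials in the even coordinates tensored with the Grassmann algebra of the
odd coordinates. -/
abbrev SPoly (n : ℕ) : Type :=
  MvPolynomial (EvenIdx n) ℂ ⊗[ℂ] ExteriorAlgebra ℂ (OddIdx n → ℂ)

/-- The coordinate `t_I` dual to the monomial `e_I`; its parity is that of `I.card`. -/
def coordFn {n : ℕ} (I : Finset (Gen n)) : SPoly n :=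
  if h : Even I.card then MvPolynomial.X ⟨I, h⟩ ⊗ₜ 1
  else 1 ⊗ₜ ExteriorAlgebra.ι ℂ (Pi.single ⟨I, Nat.not_even_iff_odd.1 h⟩ 1)

/-- The (left) partial derivative with respect to `t_I`, a superderivation of the parity
of `I.card`. -/
def coordDeriv {n : ℕ} (I : Finset (Gen n)) : SPoly n →ₗ[ℂ] SPoly n :=
  if h : Even I.card then
    LinearMap.rTensor _ (MvPolynomial.pderiv (R := ℂ) (⟨I, h⟩ : EvenIdx n)).toLinearMap
  else
    LinearMap.lTensor _ (CliffordAlgebra.contractLeft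
      (LinearMap.proj (⟨I, Nat.not_even_iff_odd.1 h⟩ : OddIdx n)))

/-- The coadjoint action on the coordinates:
`(X · t_J)(v) = -(-1)^{p(X) p(J)} t_J({X, v})` for homogeneous `X`, extended linearly in `X`
(the sign is the application of the parity automorphism to `X` whenever `J.card` is odd). -/
def coadjoint {n : ℕ} (X : Po n) (J : Finset (Gen n)) : SPoly n :=
  -∑ I : Finset (Gen n),
    (monoBasis n).coord J (bracket (parityAut^[J.card] X) (monoBasis n I)) • coordFn I

/-- The action of `X ∈ po(0|2n)` on polynomials, by the (super)derivation that extends the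
coadjoint action on linear functions. -/
def vectorField {n : ℕ} (X : Po n) : SPoly n →ₗ[ℂ] SPoly n :=
  ∑ J : Finset (Gen n), LinearMap.mulLeft ℂ (coadjoint X J) ∘ₗ coordDeriv J

/-- The invariant polynomials on `po(0|2n)`: those annihilated by all of `po(0|2n)`. -/
def invariants (n : ℕ) : Submodule ℂ (SPoly n) :=
  ⨅ X : Po n, LinearMap.ker (vectorField X)

/-- The linear functions on `po(0|2n)`; its `d`-th power is the space of homogeneous
polynomials of degree `d`. -/
def linearFns (n : ℕ) : Submodule ℂ (SPoly n) :=
  Submodule.span ℂ (Set.range coordFn)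

/-! ### The invariants `r_k` -/

/-- Functions of the odd variables `ξ, η` with coefficients in polynomials on `po(0|2n)`: the
polynomials in the even coordinates, tensored with the Grassmann algebra
generated by the odd coordinates and by `ξ, η` together (so that these anticommute). -/
abbrev BigPoly (n : ℕ) : Type :=
  MvPolynomial (EvenIdx n) ℂ ⊗[ℂ] ExteriorAlgebra ℂ ((OddIdx n → ℂ) × (Gen n → ℂ))

/-- The inclusion of polynomials on `po(0|2n)` as constants with respect to `ξ, η`. -/
def inclCoeff (n : ℕ) : SPoly n →ₐ[ℂ] BigPoly n :=
  Algebra.TensorProduct.map (AlgHom.id ℂ _) (ExteriorAlgebra.map (LinearMap.inl ℂ _ _))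

/-- The inclusion of the functions of `ξ, η`. -/
def inclPo (n : ℕ) : Po n →ₐ[ℂ] BigPoly n :=
  Algebra.TensorProduct.includeRight.comp (ExteriorAlgebra.map (LinearMap.inr ℂ _ _))

/-- The generic element `f = ∑ t_I e_I` of `po(0|2n)`. -/
def genericElt (n : ℕ) : BigPoly n :=
  ∑ I : Finset (Gen n), inclCoeff n (coordFn I) * inclPo n (monoBasis n I)

/-- The derivative with respect to one of the variables `ξ, η`. -/
def dVar {n : ℕ} (a : Gen n) :
    ExteriorAlgebra ℂ ((OddIdx n → ℂ) × (Gen n → ℂ)) →ₗ[ℂ]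
      ExteriorAlgebra ℂ ((OddIdx n → ℂ) × (Gen n → ℂ)) :=
  CliffordAlgebra.contractLeft (LinearMap.proj a ∘ₗ LinearMap.snd ℂ _ _)

/-- The Berezin integral over `ξ, η` with polynomial coefficients: differentiate with respect
to all the variables (`∂/∂η_i ∂/∂ξ_i` for each `i`), then put `ξ = η = 0`. It sends
`ξ_1 η_1 ⋯ ξ_n η_n` to `1`. -/
def berezin (n : ℕ) : BigPoly n →ₗ[ℂ] SPoly n :=
  LinearMap.lTensor _
    ((ExteriorAlgebra.map (LinearMap.fst ℂ (OddIdx n → ℂ) (Gen n → ℂ))).toLinearMap ∘ₗ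
      (List.finRange n).foldr
        (fun i D => D ∘ₗ dVar (toLex (i, 1)) ∘ₗ dVar (toLex (i, 0))) LinearMap.id)

/-- The polynomial `r_k(f) = ∫ f^k vol(ξ, η)`. -/
def rInv (n k : ℕ) : SPoly n := berezin n (genericElt n ^ k)

/-- The algebra generated by the `r_k`, `k = 1, 2, …`. -/
def rAlgebra (n : ℕ) : Subalgebra ℂ (SPoly n) :=
  Algebra.adjoin ℂ {P | ∃ k : ℕ, 1 ≤ k ∧ P = rInv n k}

/-! ### The radial part -/

/-- The monomial `∏_{j ∈ J} ξ_j η_j`. These span the Cartan subalgebra of `po(0|2n)`. -/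
def cartanElt {n : ℕ} (J : Finset (Fin n)) : Po n :=
  ((J.sort (· ≤ ·)).map fun j => xi j * eta j).prod

/-- The radial part of a polynomial on `po(0|2n)`: its restriction to the Cartan subalgebra,
i.e. its value at `∑_J X_J ∏_{j ∈ J} ξ_j η_j`, where the odd coordinates vanish.
The coordinate `x_j` of `ξ_j η_j` is `X_{{j}}`. -/
def radialPart (n : ℕ) : SPoly n →ₐ[ℂ] MvPolynomial (Finset (Fin n)) ℂ :=
  Algebra.TensorProduct.productMap
    (MvPolynomial.aeval fun I : EvenIdx n => ∑ J : Finset (Fin n),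
      MvPolynomial.C ((monoBasis n).coord I.1 (cartanElt J)) * MvPolynomial.X J)
    ((Algebra.ofId ℂ _).comp ExteriorAlgebra.algebraMapInv)

/-! ### The enveloping superalgebra and Casimir elements -/

/-- The relations `x y - (-1)^{p(x) p(y)} y x = {x, y}` for homogeneous `x`, `y`. -/
inductive EnvRel (n : ℕ) : TensorAlgebra ℂ (Po n) → TensorAlgebra ℂ (Po n) → Prop
  | supercomm (p q : ZMod 2) (x y : Po n) (hx : x ∈ parityPart n p) (hy : y ∈ parityPart n q) :
      EnvRel n
        (TensorAlgebra.ι ℂ x * TensorAlgebra.ι ℂ y -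
          ((-1 : ℂ) ^ (p.val * q.val)) • (TensorAlgebra.ι ℂ y * TensorAlgebra.ι ℂ x))
        (TensorAlgebra.ι ℂ (bracket x y))

/-- The universal enveloping superalgebra of `po(0|2n)`. -/
abbrev UEnv (n : ℕ) : Type := RingQuot (EnvRel n)

/-- The projection of the tensor algebra onto the enveloping superalgebra. -/
def toEnv (n : ℕ) : TensorAlgebra ℂ (Po n) →ₐ[ℂ] UEnv n := RingQuot.mkAlgHom ℂ (EnvRel n)

/-- The canonical map from `po(0|2n)` to its enveloping superalgebra. -/
def envIncl (n : ℕ) : Po n →ₗ[ℂ] UEnv n := (toEnv n).toLinearMap ∘ₗ TensorAlgebra.ι ℂ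

/-- The even part of the enveloping superalgebra. -/
def envEven (n : ℕ) : Submodule ℂ (UEnv n) :=
  Submodule.span ℂ {u | ∃ l : List (Finset (Gen n)), Even (l.map Finset.card).sum ∧
    u = (l.map fun I => envIncl n (monoBasis n I)).prod}

/-- `z` is an even element of the center of the enveloping superalgebra. (For even elements,
commuting and supercommuting with everything are the same.) -/
def IsEvenCentral {n : ℕ} (z : UEnv n) : Prop :=
  z ∈ envEven n ∧ ∀ u : UEnv n, z * u = u * z

/-- The isomorphism of `po(0|2n)` with its dual `x ↦ B(x, ·)`, where `B(f, g) = ∫ f g vol`. -/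
def flat (n : ℕ) : Po n →ₗ[ℂ] SPoly n :=
  ∑ I : Finset (Gen n),
    (integral n ∘ₗ LinearMap.mulRight ℂ (monoBasis n I)).smulRight (coordFn I)

/-- `P` is the principal symbol, of degree `d`, of the element `z` of the enveloping superalgebra:
`z` equals, modulo elements of filtration degree `< d`, the image of a tensor of degree `d`
whose image in the supersymmetric algebra, identified with the polynomials on `po(0|2n)`
by means of the form `B`, is `P`. -/
def IsPrincipalSymbol {n : ℕ} (d : ℕ) (z : UEnv n) (P : SPoly n) : Prop :=
  ∃ t ∈ LinearMap.range (TensorAlgebra.ι ℂ (M := Po n)) ^ d,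
    ∃ u ∈ ⨆ j : Fin d, LinearMap.range (envIncl n) ^ (j : ℕ),
      z = toEnv n t + u ∧ TensorAlgebra.lift ℂ (flat n) t = P

end PoissonSuper

end

/-! Invariance. An element X of po(0|2n) acts on the coordinates t_I by the coadjoint field `bvf X`
and on ξ, η by the Hamiltonian field `ham X`. Their sum `tot X` kills the generic element f
(`tot_gf`), since f is the identity map of po(0|2n) written as a tensor. Hamiltonian fields are
divergence-free, so the Berezin integral kills `ham X` (`ber_ham`), and whatever `tot` kills
integrates to an invariant (`ber_mem_invSub`). Applied to f^k this gives r_k ∈ I_n.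

A new invariant. Let a* be the generator conjugate to a. `specInv` is the integral of (∏_a ∂_a f) ·
∑_{a,c} (∂_a ∂_c f)(∂_{a*} ∂_{c*} f). Under `tot` the gradient is transformed by the antisymmetric
matrix of second derivatives of X. The full product of gradient components picks up its trace, which
is zero. The contracted square of the Hessian changes only by terms with a gradient factor, and the
full product annihilates these. On the Cartan subalgebra `specInv` equals −2 ∏ x_i² · ∑ x_i²
(`evS_specInv`). At ∑ x_i ξ_i η_i each r_k is a constant times ∏ x_i, as rescaling the ξ_i shows, so
the algebra of the r_k only sees ∏ x_i there. For n ≥ 2 the factor ∑ x_i² is not a function of that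
product (`specInv_notMem`). For n = 2 the required P is −1/2 times `specInv`.

Casimir elements. Symmetrization written with the basis dual under B intertwines the coadjoint
action with the adjoint action on the enveloping superalgebra (`envIncl_mul_toEnv_symm`). It
therefore sends an even invariant to a central element with that symbol (`exists_casimir`).

Degree below six, n = 2. An invariant with zero radial part is zero (`eq_zero_of_rad_eq_zero`): all
its iterated derivatives vanish on the Cartan subalgebra, by induction on the order, and hence at
the origin. Write c, x_0, x_1, y for the Cartan coordinates along 1, ξ_0η_0, ξ_1η_1 and the top
monomial, indexing from 0 as in `Fin 2`. Differentiating the invariance equation once and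
restricting constrains a radial part φ (`pderiv_rad_conditions`): ∂φ/∂x_1 = x_0 a with ∂φ/∂c = x_0 b
+ y a for the same a, the same with x_0 and x_1 exchanged, and divisibility of ∂φ/∂x_1 ∓ ∂φ/∂x_0 by
x_0 ∓ x_1. In degree below six these leave only polynomials in the radial parts of the r_k
(`eq_normal_form`, `mem_of_normal_form`), and injectivity lifts the equality to invariants. -/

open scoped TensorProduct

noncomputable section

namespace PoissonSuper

/-! ### Superalgebras and superderivations -/

section Super

variable {A : Type*} [Ring A] [Algebra ℂ A]

/-- `x` is homogeneous of parity `q` with respect to the parity automorphism `θ`. -/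
def HasParity (θ : A →ₐ[ℂ] A) (q : ℕ) (x : A) : Prop := θ x = (-1 : ℂ) ^ q • x

/-- `D` is a superderivation of parity `k`. -/
def IsSuperDer (θ : A →ₐ[ℂ] A) (k : ℕ) (D : A →ₗ[ℂ] A) : Prop :=
  ∀ a b, D (a * b) = D a * b + (θ ^ k) a * D b

/-- Homogeneous elements supercommute with everything. -/
def IsSuperComm (θ : A →ₐ[ℂ] A) : Prop :=
  ∀ (r : ℕ) (c x : A), HasParity θ r c → c * x = (θ ^ r) x * c

variable {θ : A →ₐ[ℂ] A}

theorem HasParity.pow_apply {q : ℕ} {x : A} (h : HasParity θ q x) (k : ℕ) :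
    (θ ^ k) x = (-1 : ℂ) ^ (k * q) • x := by
  induction k with
  | zero => simp
  | succ k ih =>
    rw [pow_succ, AlgHom.mul_apply, h, map_smul, ih, smul_smul, ← pow_add]
    ring_nf

theorem HasParity.mul {p q : ℕ} {x y : A} (hx : HasParity θ p x) (hy : HasParity θ q y) :
    HasParity θ (p + q) (x * y) := by
  rw [HasParity, map_mul, hx, hy, smul_mul_smul_comm, ← pow_add]

theorem HasParity.smul {p : ℕ} {x : A} (c : ℂ) (hx : HasParity θ p x) :
    HasParity θ p (c • x) := by
  rw [HasParity, map_smul, hx, smul_comm]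

theorem HasParity.neg {p : ℕ} {x : A} (hx : HasParity θ p x) :
    HasParity θ p (-x) := by
  rw [HasParity, map_neg, hx, smul_neg]

theorem HasParity.zero (p : ℕ) : HasParity θ p (0 : A) := by simp [HasParity]

theorem HasParity.one : HasParity θ 0 (1 : A) := by simp [HasParity]

theorem HasParity.sum {ι : Type*} {p : ℕ} {s : Finset ι} {f : ι → A}
    (h : ∀ i ∈ s, HasParity θ p (f i)) : HasParity θ p (∑ i ∈ s, f i) := by
  rw [HasParity, map_sum, Finset.smul_sum]
  exact Finset.sum_congr rfl h

theorem neg_one_pow_congr {p q : ℕ} (h : Even (p + q)) : (-1 : ℂ) ^ p = (-1) ^ q := by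
  rcases Nat.even_or_odd p with hp | hp
  · rw [hp.neg_one_pow, ((Nat.even_add.1 h).1 hp).neg_one_pow]
  · have : Odd q := by
      rw [← Nat.not_even_iff_odd] at hp ⊢
      exact fun hq => hp ((Nat.even_add.1 h).2 hq)
    rw [hp.neg_one_pow, this.neg_one_pow]

theorem HasParity.congr {p q : ℕ} {x : A} (hx : HasParity θ p x) (h : Even (p + q)) :
    HasParity θ q x := by
  rw [HasParity, hx, neg_one_pow_congr h]

/-- Parities are recorded as natural numbers, so that degrees and cardinalities can be used
directly. This lemma and `neg_one_pow_congr` restore reduction modulo two. -/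
theorem pow_congr_of_sq (h2 : θ ^ 2 = 1) {p q : ℕ} (h : Even (p + q)) : θ ^ p = θ ^ q := by
  have key : ∀ m : ℕ, θ ^ m = if Even m then 1 else θ := by
    intro m
    rcases Nat.even_or_odd' m with ⟨k, rfl | rfl⟩
    · simp [pow_mul, h2]
    · rw [pow_succ, pow_mul, h2, one_pow, one_mul, if_neg]
      simp
  rw [key, key]
  simp only [Nat.even_add.1 h]

theorem IsSuperComm.mul_comm (hc : IsSuperComm θ) {p q : ℕ} {x y : A} (hx : HasParity θ p x)
    (hy : HasParity θ q y) : x * y = (-1 : ℂ) ^ (p * q) • (y * x) := by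
  rw [hc p x y hx, hy.pow_apply, smul_mul_assoc]

theorem IsSuperDer.sum {ι : Type*} {k : ℕ} {s : Finset ι} {D : ι → A →ₗ[ℂ] A}
    (h : ∀ i ∈ s, IsSuperDer θ k (D i)) : IsSuperDer θ k (∑ i ∈ s, D i) := by
  intro a b
  simp only [LinearMap.sum_apply, Finset.sum_mul, Finset.mul_sum, ← Finset.sum_add_distrib]
  exact Finset.sum_congr rfl fun i hi => h i hi a b

theorem IsSuperDer.add {k : ℕ} {D E : A →ₗ[ℂ] A}
    (hD : IsSuperDer θ k D) (hE : IsSuperDer θ k E) : IsSuperDer θ k (D + E) := by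
  intro a b
  simp only [LinearMap.add_apply, hD a b, hE a b]
  noncomm_ring

theorem IsSuperDer.congr (h2 : θ ^ 2 = 1) {k l : ℕ} {D : A →ₗ[ℂ] A}
    (hD : IsSuperDer θ k D) (h : Even (k + l)) : IsSuperDer θ l D := by
  intro a b
  rw [hD a b, pow_congr_of_sq h2 h]

/-- Every vector field below is a sum of such products of a coefficient and a derivative.
Supercommutativity moves the coefficient past the twisted first factor. -/
theorem IsSuperDer.mulLeft (hc : IsSuperComm θ) {k r : ℕ} {c : A} {D : A →ₗ[ℂ] A}
    (hD : IsSuperDer θ k D) (h : HasParity θ r c) :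
    IsSuperDer θ (r + k) (LinearMap.mulLeft ℂ c ∘ₗ D) := by
  intro a b
  simp only [LinearMap.comp_apply, LinearMap.mulLeft_apply, hD a b, mul_add, ← mul_assoc]
  rw [hc r c ((θ ^ k) a) h, pow_add, AlgHom.mul_apply]

theorem IsSuperDer.map_one {k : ℕ} {D : A →ₗ[ℂ] A} (hD : IsSuperDer θ k D) : D 1 = 0 := by
  have := hD 1 1
  simpa using this

theorem IsSuperDer.apply_mul {k q : ℕ} {D : A →ₗ[ℂ] A} (hD : IsSuperDer θ k D) {a : A}
    (ha : HasParity θ q a) (b : A) : D (a * b) = D a * b + (-1 : ℂ) ^ (k * q) • (a * D b) := by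
  rw [hD, ha.pow_apply, smul_mul_assoc]

theorem IsSuperDer.apply_pow {k : ℕ} {D : A →ₗ[ℂ] A} (hD : IsSuperDer θ k D) {a : A}
    (ha : D a = 0) (m : ℕ) : D (a ^ m) = 0 := by
  induction m with
  | zero => simpa using hD.map_one
  | succ m ih => rw [pow_succ, hD, ha, ih, zero_mul, mul_zero, add_zero]

end Super

/-! ### Contractions in an exterior algebra -/

section Ext

variable {V W : Type*} [AddCommGroup V] [Module ℂ V] [AddCommGroup W] [Module ℂ W]

/-- The contraction of an exterior algebra with a linear form. -/
abbrev contr (d : Module.Dual ℂ V) : ExteriorAlgebra ℂ V →ₗ[ℂ] ExteriorAlgebra ℂ V :=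
  CliffordAlgebra.contractLeft d

/-- The parity automorphism of an exterior algebra. -/
abbrev extPar (V : Type*) [AddCommGroup V] [Module ℂ V] :
    ExteriorAlgebra ℂ V →ₐ[ℂ] ExteriorAlgebra ℂ V :=
  CliffordAlgebra.involute

theorem extPar_ι (v : V) : extPar V (ExteriorAlgebra.ι ℂ v) = -ExteriorAlgebra.ι ℂ v :=
  CliffordAlgebra.involute_ι _

theorem extPar_sq : (extPar V) ^ 2 = 1 := by
  rw [pow_two]; exact CliffordAlgebra.involute_comp_involute

theorem contr_ι (d : Module.Dual ℂ V) (v : V) :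
    contr d (ExteriorAlgebra.ι ℂ v) = algebraMap ℂ _ (d v) :=
  CliffordAlgebra.contractLeft_ι (Q := (0 : QuadraticForm ℂ V)) d v

theorem contr_ι_mul (d : Module.Dual ℂ V) (v : V) (x : ExteriorAlgebra ℂ V) :
    contr d (ExteriorAlgebra.ι ℂ v * x) = d v • x - ExteriorAlgebra.ι ℂ v * contr d x :=
  CliffordAlgebra.contractLeft_ι_mul (Q := (0 : QuadraticForm ℂ V)) d v x

theorem ext_left_induction {P : ExteriorAlgebra ℂ V → Prop} (h1 : P 1)
    (hs : ∀ (c : ℂ) x, P x → P (c • x))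
    (ha : ∀ x y, P x → P y → P (x + y))
    (hm : ∀ v x, P x → P (ExteriorAlgebra.ι ℂ v * x)) (x) : P x := by
  refine CliffordAlgebra.left_induction (Q := (0 : QuadraticForm ℂ V)) ?_ ?_ ?_ x
  · intro r
    rw [Algebra.algebraMap_eq_smul_one]
    exact hs _ _ h1
  · exact ha
  · intro x m hx
    exact hm m x hx

theorem contr_isSuperDer (d : Module.Dual ℂ V) : IsSuperDer (extPar V) 1 (contr d) := by
  intro a b
  rw [pow_one]
  induction a using ext_left_induction with
  | h1 => simp [contr]
  | hs c x hx => simp only [smul_mul_assoc, map_smul, hx, smul_add]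
  | ha x y hx hy =>
    simp only [add_mul, map_add, hx, hy]; abel
  | hm v x hx =>
    rw [mul_assoc, contr_ι_mul, hx, contr_ι_mul, map_mul, extPar_ι]
    simp only [mul_add, sub_mul, smul_mul_assoc, mul_assoc, neg_mul]
    abel

theorem extPar_contr (d : Module.Dual ℂ V) (x : ExteriorAlgebra ℂ V) :
    extPar V (contr d x) = -contr d (extPar V x) := by
  induction x using ext_left_induction with
  | h1 => simp [contr]
  | hs c x hx => simp only [map_smul, hx, smul_neg]
  | ha x y hx hy => simp only [map_add, hx, hy, neg_add]
  | hm v x hx =>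
    rw [contr_ι_mul, map_mul, extPar_ι, neg_mul, map_neg, contr_ι_mul, map_sub, map_smul,
      map_mul, hx, extPar_ι]
    simp only [neg_mul_neg]
    abel

theorem contr_map (g : V →ₗ[ℂ] W) (d : Module.Dual ℂ W) (x : ExteriorAlgebra ℂ V) :
    contr d (ExteriorAlgebra.map g x) = ExteriorAlgebra.map g (contr (d ∘ₗ g) x) := by
  induction x using ext_left_induction with
  | h1 => simp [contr]
  | hs c x hx => simp only [map_smul, hx]
  | ha x y hx hy => simp only [map_add, hx, hy]
  | hm v x hx =>
    rw [contr_ι_mul, map_mul, ExteriorAlgebra.map_apply_ι, contr_ι_mul, hx, map_sub, map_smul,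
      map_mul, ExteriorAlgebra.map_apply_ι, LinearMap.comp_apply]

theorem extPar_map (g : V →ₗ[ℂ] W) (x : ExteriorAlgebra ℂ V) :
    extPar W (ExteriorAlgebra.map g x) = ExteriorAlgebra.map g (extPar V x) := by
  induction x using ext_left_induction with
  | h1 => simp
  | hs c x hx => simp only [map_smul, hx]
  | ha x y hx hy => simp only [map_add, hx, hy]
  | hm v x hx =>
    rw [map_mul, map_mul, hx, map_mul, map_mul, ExteriorAlgebra.map_apply_ι, extPar_ι, extPar_ι,
      map_neg, ExteriorAlgebra.map_apply_ι]

theorem ι_mul_eq (v : V) (x : ExteriorAlgebra ℂ V) :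
    ExteriorAlgebra.ι ℂ v * x = extPar V x * ExteriorAlgebra.ι ℂ v := by
  induction x using ext_left_induction with
  | h1 => simp
  | hs c x hx => simp only [map_smul, smul_mul_assoc, mul_smul_comm, hx]
  | ha x y hx hy => simp only [map_add, mul_add, add_mul, hx, hy]
  | hm w x hx =>
    rw [map_mul, mul_assoc, ← hx, ← mul_assoc, ← mul_assoc, extPar_ι, neg_mul,
      eq_neg_of_add_eq_zero_left (ExteriorAlgebra.ι_add_mul_swap v w)]

theorem contr_contr_swap (d e : Module.Dual ℂ V) (x : ExteriorAlgebra ℂ V) :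
    contr d (contr e x) = -contr e (contr d x) :=
  CliffordAlgebra.contractLeft_comm (Q := (0 : QuadraticForm ℂ V)) d e x

/-- Both sides are compatible with products in `x`, so the sign rule for `c` against a single
generator suffices. -/
theorem ext_isSuperComm : IsSuperComm (extPar V) := by
  intro r c x hc
  have hι : ∀ v : V, c * ExteriorAlgebra.ι ℂ v =
      (extPar V ^ r) (ExteriorAlgebra.ι ℂ v) * c := by
    intro v
    have h1 : HasParity (extPar V) 1 (ExteriorAlgebra.ι ℂ v) := by
      rw [HasParity, extPar_ι]; simp
    rw [h1.pow_apply, smul_mul_assoc, ι_mul_eq, hc, smul_mul_assoc, smul_smul, mul_one,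
      ← pow_add, (Even.add_self r).neg_one_pow, one_smul]
  induction x using ext_left_induction with
  | h1 => simp
  | hs c x hx => simp only [map_smul, smul_mul_assoc, mul_smul_comm, hx]
  | ha x y hx hy => simp only [mul_add, map_add, add_mul, hx, hy]
  | hm v x hx => rw [← mul_assoc, hι, mul_assoc, hx, map_mul, mul_assoc]

end Ext

/-! ### Polynomial superalgebras -/

section SuperPoly

variable {σ V W : Type*} [AddCommGroup V] [Module ℂ V] [AddCommGroup W] [Module ℂ W]

/-- Polynomials in even variables `σ` tensored with the Grassmann algebra of `V`. -/
def SuperPoly (σ V : Type*) [AddCommGroup V] [Module ℂ V] : Type _ :=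
  MvPolynomial σ ℂ ⊗[ℂ] ExteriorAlgebra ℂ V

instance : Ring (SuperPoly σ V) :=
  inferInstanceAs (Ring (MvPolynomial σ ℂ ⊗[ℂ] ExteriorAlgebra ℂ V))

instance : Algebra ℂ (SuperPoly σ V) :=
  inferInstanceAs (Algebra ℂ (MvPolynomial σ ℂ ⊗[ℂ] ExteriorAlgebra ℂ V))

/-- The product of a polynomial in the even variables and an element of the Grassmann algebra. -/
def sTmul (p : MvPolynomial σ ℂ) (x : ExteriorAlgebra ℂ V) : SuperPoly σ V := p ⊗ₜ[ℂ] x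

theorem sTmul_mul_sTmul (p q : MvPolynomial σ ℂ) (x y : ExteriorAlgebra ℂ V) :
    sTmul p x * sTmul q y = sTmul (p * q) (x * y) :=
  Algebra.TensorProduct.tmul_mul_tmul p q x y

theorem sTmul_add (p : MvPolynomial σ ℂ) (x y : ExteriorAlgebra ℂ V) :
    sTmul p (x + y) = sTmul p x + sTmul p y := TensorProduct.tmul_add p x y

theorem add_sTmul (p q : MvPolynomial σ ℂ) (x : ExteriorAlgebra ℂ V) :
    sTmul (p + q) x = sTmul p x + sTmul q x := TensorProduct.add_tmul p q x

theorem sTmul_neg (p : MvPolynomial σ ℂ) (x : ExteriorAlgebra ℂ V) :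
    sTmul p (-x) = -sTmul p x := TensorProduct.tmul_neg p x

theorem sTmul_zero (p : MvPolynomial σ ℂ) : sTmul p (0 : ExteriorAlgebra ℂ V) = 0 :=
  TensorProduct.tmul_zero _ p

theorem zero_sTmul (x : ExteriorAlgebra ℂ V) : sTmul (0 : MvPolynomial σ ℂ) x = 0 :=
  TensorProduct.zero_tmul _ x

theorem sTmul_smul (c : ℂ) (p : MvPolynomial σ ℂ) (x : ExteriorAlgebra ℂ V) :
    sTmul p (c • x) = c • sTmul p x := TensorProduct.tmul_smul c p x

theorem smul_sTmul (c : ℂ) (p : MvPolynomial σ ℂ) (x : ExteriorAlgebra ℂ V) :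
    sTmul (c • p) x = c • sTmul p x := TensorProduct.smul_tmul' c p x

theorem sTmul_one_one : sTmul (1 : MvPolynomial σ ℂ) (1 : ExteriorAlgebra ℂ V) = 1 := rfl

theorem sTmul_induction {P : SuperPoly σ V → Prop} (h0 : P 0)
    (h1 : ∀ p x, P (sTmul p x)) (ha : ∀ x y, P x → P y → P (x + y)) (a) : P a :=
  TensorProduct.induction_on (motive := P) a h0 h1 ha

theorem linearMap_ext_sTmul {M : Type*} [AddCommGroup M] [Module ℂ M]
    {f g : SuperPoly σ V →ₗ[ℂ] M}
    (h : ∀ p x, f (sTmul p x) = g (sTmul p x)) (a) : f a = g a := by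
  induction a using sTmul_induction with
  | h0 => simp
  | h1 p x => exact h p x
  | ha x y hx hy => simp only [map_add, hx, hy]

variable (σ V) in
/-- The parity automorphism of a polynomial superalgebra. -/
def polyPar : SuperPoly σ V →ₐ[ℂ] SuperPoly σ V :=
  Algebra.TensorProduct.map (AlgHom.id ℂ (MvPolynomial σ ℂ)) (extPar V)

theorem polyPar_sTmul (p : MvPolynomial σ ℂ) (x : ExteriorAlgebra ℂ V) :
    polyPar σ V (sTmul p x) = sTmul p (extPar V x) := rfl

theorem polyPar_sq : (polyPar σ V) ^ 2 = 1 := by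
  rw [pow_two]
  refine AlgHom.ext fun a => linearMap_ext_sTmul
    (f := (polyPar σ V * polyPar σ V).toLinearMap) (g := LinearMap.id) (fun p x => ?_) a
  change polyPar σ V (polyPar σ V (sTmul p x)) = sTmul p x
  rw [polyPar_sTmul, polyPar_sTmul, CliffordAlgebra.involute_involute]

/-- The even partial derivative. -/
def evenDer (s : σ) : SuperPoly σ V →ₗ[ℂ] SuperPoly σ V :=
  LinearMap.rTensor (ExteriorAlgebra ℂ V) (MvPolynomial.pderiv (R := ℂ) s).toLinearMap

/-- The odd partial derivative along a linear form. -/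
def oddDer (d : Module.Dual ℂ V) : SuperPoly σ V →ₗ[ℂ] SuperPoly σ V :=
  LinearMap.lTensor (MvPolynomial σ ℂ) (contr d)

theorem evenDer_sTmul (s : σ) (p : MvPolynomial σ ℂ) (x : ExteriorAlgebra ℂ V) :
    evenDer s (sTmul p x) = sTmul (MvPolynomial.pderiv s p) x := rfl

theorem oddDer_sTmul (d : Module.Dual ℂ V) (p : MvPolynomial σ ℂ) (x : ExteriorAlgebra ℂ V) :
    oddDer d (sTmul p x) = sTmul p (contr d x) := rfl

theorem evenDer_isSuperDer (s : σ) : IsSuperDer (polyPar σ V) 0 (evenDer s) := by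
  intro a b
  rw [pow_zero, AlgHom.one_apply]
  induction a using sTmul_induction with
  | h0 => simp
  | ha x y hx hy => simp only [add_mul, map_add, hx, hy]; abel
  | h1 p x =>
    induction b using sTmul_induction with
    | h0 => simp
    | ha x y hx hy => simp only [mul_add, map_add, hx, hy]; abel
    | h1 q y =>
      simp only [evenDer_sTmul, sTmul_mul_sTmul, Derivation.leibniz, ← add_sTmul, smul_eq_mul]
      congr 1; ring

theorem oddDer_isSuperDer (d : Module.Dual ℂ V) : IsSuperDer (polyPar σ V) 1 (oddDer d) := by
  intro a b
  rw [pow_one]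
  induction a using sTmul_induction with
  | h0 => simp
  | ha x y hx hy => simp only [add_mul, map_add, hx, hy]; abel
  | h1 p x =>
    induction b using sTmul_induction with
    | h0 => simp
    | ha x y hx hy => simp only [mul_add, map_add, hx, hy]; abel
    | h1 q y =>
      simp only [oddDer_sTmul, sTmul_mul_sTmul, polyPar_sTmul, ← sTmul_add]
      rw [contr_isSuperDer d x y, pow_one]

theorem polyPar_evenDer (s : σ) (a : SuperPoly σ V) :
    polyPar σ V (evenDer s a) = evenDer s (polyPar σ V a) := by
  induction a using sTmul_induction with
  | h0 => simp
  | ha x y hx hy => simp only [map_add, hx, hy]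
  | h1 p x => rfl

theorem polyPar_oddDer (d : Module.Dual ℂ V) (a : SuperPoly σ V) :
    polyPar σ V (oddDer d a) = -oddDer d (polyPar σ V a) := by
  induction a using sTmul_induction with
  | h0 => simp
  | ha x y hx hy => simp only [map_add, hx, hy, neg_add]
  | h1 p x => rw [polyPar_sTmul, oddDer_sTmul, oddDer_sTmul, polyPar_sTmul, extPar_contr, sTmul_neg]

theorem pderiv_pderiv_comm (s t : σ) (p : MvPolynomial σ ℂ) :
    MvPolynomial.pderiv s (MvPolynomial.pderiv t p) =
      MvPolynomial.pderiv t (MvPolynomial.pderiv s p) := by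
  have h : ⁅(MvPolynomial.pderiv s : Derivation ℂ (MvPolynomial σ ℂ) (MvPolynomial σ ℂ)),
      (MvPolynomial.pderiv t : Derivation ℂ (MvPolynomial σ ℂ) (MvPolynomial σ ℂ))⁆ = 0 := by
    refine MvPolynomial.derivation_ext fun i => ?_
    classical
    rw [Derivation.commutator_apply, MvPolynomial.pderiv_X, MvPolynomial.pderiv_X]
    simp only [Pi.single_apply]
    split_ifs <;> simp
  have := congrArg (fun D : Derivation ℂ (MvPolynomial σ ℂ) (MvPolynomial σ ℂ) => D p) h
  simpa [Derivation.commutator_apply, sub_eq_zero] using this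

theorem evenDer_evenDer (s t : σ) (a : SuperPoly σ V) :
    evenDer s (evenDer t a) = evenDer t (evenDer s a) := by
  induction a using sTmul_induction with
  | h0 => simp
  | ha x y hx hy => simp only [map_add, hx, hy]
  | h1 p x => simp only [evenDer_sTmul]; rw [pderiv_pderiv_comm]

theorem evenDer_oddDer (s : σ) (d : Module.Dual ℂ V) (a : SuperPoly σ V) :
    evenDer s (oddDer d a) = oddDer d (evenDer s a) := by
  induction a using sTmul_induction with
  | h0 => simp
  | ha x y hx hy => simp only [map_add, hx, hy]
  | h1 p x => rfl

theorem oddDer_oddDer (d e : Module.Dual ℂ V) (a : SuperPoly σ V) :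
    oddDer d (oddDer e a) = -oddDer e (oddDer d a) := by
  induction a using sTmul_induction with
  | h0 => simp
  | ha x y hx hy => simp only [map_add, hx, hy, neg_add]
  | h1 p x => simp only [oddDer_sTmul]; rw [contr_contr_swap, sTmul_neg]

theorem sTmul_ι_mul_eq (v : V) (a : SuperPoly σ V) :
    sTmul 1 (ExteriorAlgebra.ι ℂ v) * a =
      polyPar σ V a * sTmul 1 (ExteriorAlgebra.ι ℂ v) := by
  induction a using sTmul_induction with
  | h0 => simp
  | ha x y hx hy => simp only [map_add, mul_add, add_mul, hx, hy]
  | h1 p x => simp only [polyPar_sTmul, sTmul_mul_sTmul, ι_mul_eq, one_mul, mul_one]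

theorem sTmul_one_mul_comm (p : MvPolynomial σ ℂ) (a : SuperPoly σ V) :
    sTmul p 1 * a = a * sTmul p 1 := by
  induction a using sTmul_induction with
  | h0 => simp
  | ha x y hx hy => simp only [mul_add, add_mul, hx, hy]
  | h1 q x => simp only [sTmul_mul_sTmul, mul_comm p q, one_mul, mul_one]

/-- Induction principle for polynomial superalgebras. -/
theorem superPoly_induction {P : SuperPoly σ V → Prop} (h1 : ∀ p, P (sTmul p 1))
    (ha : ∀ x y, P x → P y → P (x + y))
    (hm : ∀ v x, P x → P (sTmul 1 (ExteriorAlgebra.ι ℂ v) * x)) (a) : P a := by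
  induction a using sTmul_induction with
  | h0 => simpa [zero_sTmul] using h1 0
  | ha x y hx hy => exact ha x y hx hy
  | h1 p x =>
    induction x using ext_left_induction generalizing p with
    | h1 => exact h1 p
    | hs c x hx =>
      rw [sTmul_smul, ← smul_sTmul]
      exact hx _
    | ha x y hx hy =>
      rw [sTmul_add]
      exact ha _ _ (hx p) (hy p)
    | hm v x hx =>
      have := hm v _ (hx p)
      rwa [sTmul_mul_sTmul, one_mul] at this

theorem sTmul_ι_parity (v : V) :
    HasParity (polyPar σ V) 1 (sTmul 1 (ExteriorAlgebra.ι ℂ v)) := by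
  rw [HasParity, polyPar_sTmul, extPar_ι, sTmul_neg, pow_one, neg_one_smul]

theorem sTmul_one_parity (p : MvPolynomial σ ℂ) :
    HasParity (polyPar σ V) 0 (sTmul p 1) := by
  rw [HasParity, polyPar_sTmul, map_one, pow_zero, one_smul]

theorem superPoly_isSuperComm : IsSuperComm (polyPar σ V) := by
  intro r c x hc
  have hι : ∀ v : V, c * sTmul 1 (ExteriorAlgebra.ι ℂ v) =
      (polyPar σ V ^ r) (sTmul 1 (ExteriorAlgebra.ι ℂ v)) * c := by
    intro v
    rw [(sTmul_ι_parity v).pow_apply, smul_mul_assoc, sTmul_ι_mul_eq, hc, smul_mul_assoc,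
      smul_smul, mul_one, ← pow_add, (Even.add_self r).neg_one_pow, one_smul]
  induction x using superPoly_induction with
  | h1 p =>
    rw [(sTmul_one_parity p).pow_apply, mul_zero, pow_zero, one_smul, sTmul_one_mul_comm]
  | ha x y hx hy => simp only [mul_add, map_add, add_mul, hx, hy]
  | hm v x hx => rw [← mul_assoc, hι, mul_assoc, hx, map_mul, mul_assoc]

end SuperPoly

variable {n : ℕ}

/-! ### Monomials in the Grassmann algebra -/

/-- The generator of the Grassmann algebra with a given label. -/
def gen (a : Gen n) : Po n := ExteriorAlgebra.ι ℂ (Pi.single a 1)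

/-- The partial derivative with respect to a generator. -/
def pdiff (a : Gen n) : Po n →ₗ[ℂ] Po n := contr (LinearMap.proj a)

/-- The label of the generator conjugate to a given one. -/
def conj (a : Gen n) : Gen n := toLex ((ofLex a).1, 1 - (ofLex a).2)

theorem conj_xi (i : Fin n) : conj (toLex (i, 0)) = toLex (i, 1) := by simp [conj]

theorem conj_eta (i : Fin n) : conj (toLex (i, 1)) = toLex (i, 0) := by simp [conj]

theorem conj_conj (a : Gen n) : conj (conj a) = a := by
  simp [conj]

/-- Conjugation of labels as a permutation. -/
def conjEquiv : Equiv.Perm (Gen n) := ⟨conj, conj, conj_conj, conj_conj⟩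

theorem sum_conj {M : Type*} [AddCommMonoid M] (f : Gen n → M) : ∑ a, f (conj a) = ∑ a, f a :=
  Equiv.sum_comp conjEquiv f

theorem sum_gen {M : Type*} [AddCommMonoid M] (f : Gen n → M) :
    ∑ a, f a = ∑ i : Fin n, (f (toLex (i, 0)) + f (toLex (i, 1))) := by
  rw [← Equiv.sum_comp toLex f, Fintype.sum_prod_type]
  simp [Fin.sum_univ_two]

/-- Merging the two terms for each i into one sum over all generators turns the symmetry ξ ↔ η into
the reindexing `sum_conj`, on which the cancellations below rest. -/
theorem bracket_eq (f g : Po n) :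
    bracket f g = ∑ a, pdiff a (parityAut f) * pdiff (conj a) g := by
  rw [sum_gen, bracket]
  simp only [conj_xi, conj_eta]
  rfl

theorem pdiff_isSuperDer (a : Gen n) : IsSuperDer (parityAut (n := n)) 1 (pdiff a) :=
  contr_isSuperDer _

theorem parityAut_pdiff (a : Gen n) (x : Po n) : parityAut (pdiff a x) = -pdiff a (parityAut x) :=
  extPar_contr _ _

theorem parityAut_gen (a : Gen n) : parityAut (gen a) = -gen a := extPar_ι _

theorem gen_parity (a : Gen n) : HasParity parityAut 1 (gen a) := by
  rw [HasParity, parityAut_gen]; simp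

theorem pdiff_gen (a b : Gen n) : pdiff a (gen b) = if a = b then 1 else 0 := by
  rw [pdiff, gen, contr_ι]
  by_cases h : a = b
  · subst h; simp
  · simp [h]

theorem pdiff_gen_mul (a b : Gen n) (x : Po n) :
    pdiff a (gen b * x) = (if a = b then x else 0) - gen b * pdiff a x := by
  rw [pdiff, gen, contr_ι_mul]
  by_cases h : a = b
  · subst h; simp
  · simp [h]

theorem pdiff_one (a : Gen n) : pdiff a 1 = 0 := (pdiff_isSuperDer a).map_one

theorem pdiff_pdiff (a b : Gen n) (x : Po n) : pdiff a (pdiff b x) = -pdiff b (pdiff a x) :=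
  contr_contr_swap _ _ _

theorem HasParity.pdiff {q : ℕ} {x : Po n} (hx : HasParity parityAut q x) (a : Gen n) :
    HasParity parityAut (q + 1) (pdiff a x) := by
  rw [HasParity, parityAut_pdiff, hx, map_smul, pow_succ]; simp

theorem HasParity.bracket {p q : ℕ} {x y : Po n} (hx : HasParity parityAut p x)
    (hy : HasParity parityAut q y) : HasParity parityAut (p + q) (bracket x y) := by
  rw [bracket_eq]
  refine HasParity.sum fun a _ => ?_
  rw [hx, map_smul, smul_mul_assoc]
  refine HasParity.smul _ (((hx.pdiff a).mul (hy.pdiff (conj a))).congr ?_)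
  exact ⟨p + q + 1, by ring⟩

/-! ### The monomial basis: products, parities, derivatives. -/

theorem mono_empty : monoBasis n ∅ = 1 := by
  rw [monoBasis, ExteriorAlgebra.basis_apply_ofCard (n := 0) _ Finset.card_empty]
  simp

theorem mono_singleton (a : Gen n) : monoBasis n {a} = gen a := by
  rw [monoBasis, ExteriorAlgebra.basis_apply_ofCard (n := 1) _ (Finset.card_singleton a)]
  have h : ∀ i, Set.powersetCard.ofFinEmbEquiv.symm
      (Set.powersetCard.ofCard (Finset.card_singleton a)) i = a := by
    intro i
    have := (Set.powersetCard.mem_range_ofFinEmbEquiv_symm_iff_mem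
      (Set.powersetCard.ofCard (Finset.card_singleton a)) _).1 ⟨i, rfl⟩
    exact Finset.mem_singleton.1 this
  rw [ExteriorAlgebra.ιMulti_family, ExteriorAlgebra.ιMulti_apply]
  simp [h, gen]

theorem mono_mul_of_not_disjoint {s t : Finset (Gen n)} (h : ¬Disjoint s t) :
    monoBasis n s * monoBasis n t = 0 :=
  ExteriorAlgebra.basis_mul_of_not_disjoint (Pi.basisFun ℂ (Gen n))
    (Set.powersetCard.ofCard (rfl : s.card = s.card))
    (Set.powersetCard.ofCard (rfl : t.card = t.card)) h

/-- The shuffle sign is never needed explicitly. That its square is 1 is enough to invert it. -/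
theorem mono_mul_of_disjoint {s t : Finset (Gen n)} (h : Disjoint s t) :
    ∃ u : ℂ, u * u = 1 ∧ monoBasis n s * monoBasis n t = u • monoBasis n (s ∪ t) := by
  have := ExteriorAlgebra.basis_mul_of_disjoint (Pi.basisFun ℂ (Gen n))
    (Set.powersetCard.ofCard (rfl : s.card = s.card))
    (Set.powersetCard.ofCard (rfl : t.card = t.card)) h
  refine ⟨((Equiv.Perm.sign (Set.powersetCard.permOfDisjoint
    (s := Set.powersetCard.ofCard (rfl : s.card = s.card))
    (t := Set.powersetCard.ofCard (rfl : t.card = t.card)) h) : ℤˣ) : ℤ), ?_, ?_⟩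
  · rw [← Int.cast_mul, ← Units.val_mul, Int.units_mul_self]; simp
  · refine this.trans ?_
    have h2 : ((Set.powersetCard.disjUnion (s := Set.powersetCard.ofCard (rfl : s.card = s.card))
        (t := Set.powersetCard.ofCard (rfl : t.card = t.card)) h : Set.powersetCard _ _) :
        Finset (Gen n)) = s ∪ t := Finset.disjUnion_eq_union s t h
    rw [h2, Units.smul_def, Int.cast_smul_eq_zsmul]
    rfl

theorem mono_insert {a : Gen n} {s : Finset (Gen n)} (h : a ∉ s) :
    ∃ u : ℂ, u * u = 1 ∧ monoBasis n (insert a s) = u • (gen a * monoBasis n s) := by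
  obtain ⟨u, hu, h2⟩ := mono_mul_of_disjoint (Finset.disjoint_singleton_left.2 h)
  refine ⟨u, hu, ?_⟩
  rw [← mono_singleton, h2, smul_smul, hu, one_smul, Finset.insert_eq]

theorem mono_parity (s : Finset (Gen n)) : HasParity parityAut s.card (monoBasis n s) := by
  induction s using Finset.induction_on with
  | empty => rw [mono_empty]; exact HasParity.one
  | insert a s ha ih =>
    obtain ⟨u, -, h⟩ := mono_insert ha
    rw [h, Finset.card_insert_of_notMem ha, add_comm]
    exact ((gen_parity a).mul ih).smul _

/-- The relations of the enveloping superalgebra refer to `parityPart`, whereas the computations use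
`HasParity`. This supplies the relations for monomials. -/
theorem mono_mem_parityPart (s : Finset (Gen n)) :
    monoBasis n s ∈ parityPart n (s.card : ZMod 2) := by
  induction s using Finset.induction_on with
  | empty =>
    rw [mono_empty, Finset.card_empty, Nat.cast_zero]
    exact CliffordAlgebra.one_le_evenOdd_zero _ (Submodule.one_le.1 le_rfl)
  | insert a s ha ih =>
    obtain ⟨u, -, h⟩ := mono_insert ha
    rw [h, Finset.card_insert_of_notMem ha, add_comm, Nat.cast_add, Nat.cast_one]
    exact Submodule.smul_mem _ _ (CliffordAlgebra.evenOdd_mul_le _ _ _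
      (Submodule.mul_mem_mul (CliffordAlgebra.ι_mem_evenOdd_one _ _) ih))

theorem pdiff_mono_of_notMem {a : Gen n} {s : Finset (Gen n)} (h : a ∉ s) :
    pdiff a (monoBasis n s) = 0 := by
  induction s using Finset.induction_on with
  | empty => rw [mono_empty, pdiff_one]
  | insert b s hb ih =>
    obtain ⟨u, -, h2⟩ := mono_insert hb
    rw [Finset.mem_insert, not_or] at h
    rw [h2, map_smul, pdiff_gen_mul, if_neg h.1, ih h.2, mul_zero, sub_zero, smul_zero]

theorem pdiff_mono_of_mem {a : Gen n} {s : Finset (Gen n)} (h : a ∈ s) :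
    ∃ u : ℂ, u * u = 1 ∧ pdiff a (monoBasis n s) = u • monoBasis n (s.erase a) := by
  obtain ⟨u, hu, h2⟩ := mono_insert (Finset.notMem_erase a s)
  rw [Finset.insert_erase h] at h2
  refine ⟨u, hu, ?_⟩
  rw [h2, map_smul, pdiff_gen_mul, if_pos rfl, pdiff_mono_of_notMem (Finset.notMem_erase a s),
    mul_zero, sub_zero]

theorem coord_mono (s t : Finset (Gen n)) :
    (monoBasis n).coord s (monoBasis n t) = if t = s then 1 else 0 := by
  rw [Module.Basis.coord_apply, Module.Basis.repr_self, Finsupp.single_apply]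

theorem coord_parityAut (s : Finset (Gen n)) (x : Po n) :
    (monoBasis n).coord s (parityAut x) = (-1 : ℂ) ^ s.card * (monoBasis n).coord s x := by
  have : (monoBasis n).coord s ∘ₗ (parityAut (n := n)).toLinearMap =
      (-1 : ℂ) ^ s.card • (monoBasis n).coord s := by
    refine (monoBasis n).ext fun t => ?_
    simp only [LinearMap.comp_apply, AlgHom.toLinearMap_apply, LinearMap.smul_apply]
    rw [mono_parity t, map_smul, coord_mono]
    split_ifs with h
    · rw [h]
    · simp
  exact congrArg (fun f => f x) this

theorem coord_eq_zero_of_parity {q : ℕ} {x : Po n} (hx : HasParity parityAut q x)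
    {s : Finset (Gen n)} (h : ¬Even (q + s.card)) : (monoBasis n).coord s x = 0 := by
  have h1 := coord_parityAut s x
  rw [hx, map_smul, smul_eq_mul] at h1
  have h2 : (-1 : ℂ) ^ q = -(-1) ^ s.card := by
    have : Even (q + (s.card + 1)) := by
      rw [← add_assoc, Nat.even_add_one]; exact h
    rw [neg_one_pow_congr this, pow_succ]; ring
  have h3 : (2 * (-1 : ℂ) ^ s.card) * (monoBasis n).coord s x = 0 := by
    rw [h2] at h1; linear_combination -h1
  rcases mul_eq_zero.1 h3 with h4 | h4
  · rcases mul_eq_zero.1 h4 with h5 | h5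
    · norm_num at h5
    · exact absurd h5 (pow_ne_zero _ (by norm_num))
  · exact h4

theorem sum_coord_smul_mono (x : Po n) :
    ∑ s, (monoBasis n).coord s x • monoBasis n s = x :=
  (monoBasis n).sum_repr x

theorem bracket_add_left (x y z : Po n) : bracket (x + y) z = bracket x z + bracket y z := by
  simp only [bracket_eq, map_add, add_mul, Finset.sum_add_distrib]

theorem bracket_smul_left (c : ℂ) (x z : Po n) : bracket (c • x) z = c • bracket x z := by
  simp only [bracket_eq, map_smul, smul_mul_assoc, Finset.smul_sum]

theorem bracket_add_right (x y z : Po n) : bracket x (y + z) = bracket x y + bracket x z := by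
  simp only [bracket_eq, map_add, mul_add, Finset.sum_add_distrib]

theorem bracket_smul_right (c : ℂ) (x z : Po n) : bracket x (c • z) = c • bracket x z := by
  simp only [bracket_eq, map_smul, mul_smul_comm, Finset.smul_sum]

/-- The bracket as a bilinear map. -/
def bracketL : Po n →ₗ[ℂ] Po n →ₗ[ℂ] Po n :=
  LinearMap.mk₂ ℂ bracket bracket_add_left bracket_smul_left bracket_add_right bracket_smul_right

theorem bracketL_apply (x y : Po n) : bracketL x y = bracket x y := rfl

theorem bracket_sum_right {ι : Type*} (s : Finset ι) (x : Po n) (f : ι → Po n) :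
    bracket x (∑ i ∈ s, f i) = ∑ i ∈ s, bracket x (f i) := by
  simp only [← bracketL_apply, map_sum]

/-! ### Coordinates and partial derivatives on the superspace -/

/-- The superalgebra of polynomials on `po(0|2n)`. -/
abbrev SP (n : ℕ) : Type := SuperPoly (EvenIdx n) (OddIdx n → ℂ)

/-- The identification of the two forms of the superalgebra of polynomials. -/
def toSP : SPoly n ≃ₐ[ℂ] SP n := AlgEquiv.refl

/-- The superalgebra of functions of `ξ, η` with polynomial coefficients. -/
abbrev BP (n : ℕ) : Type := SuperPoly (EvenIdx n) ((OddIdx n → ℂ) × (Gen n → ℂ))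

/-- The parity automorphism of the superalgebra of polynomials. -/
abbrev sPar (n : ℕ) : SP n →ₐ[ℂ] SP n := polyPar (EvenIdx n) (OddIdx n → ℂ)

/-- The parity automorphism of `BP`. -/
abbrev bPar (n : ℕ) : BP n →ₐ[ℂ] BP n :=
  polyPar (EvenIdx n) ((OddIdx n → ℂ) × (Gen n → ℂ))

/-- The derivative with respect to the coordinate `t_I`, in a polynomial superalgebra whose
odd generators project to the odd coordinates. -/
def coordDer {V : Type*} [AddCommGroup V] [Module ℂ V] (π : V →ₗ[ℂ] (OddIdx n → ℂ))
    (I : Finset (Gen n)) : SuperPoly (EvenIdx n) V →ₗ[ℂ] SuperPoly (EvenIdx n) V :=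
  if h : Even I.card then evenDer ⟨I, h⟩
  else oddDer (LinearMap.proj ⟨I, Nat.not_even_iff_odd.1 h⟩ ∘ₗ π)

section CoordDer

variable {V : Type*} [AddCommGroup V] [Module ℂ V] (π : V →ₗ[ℂ] (OddIdx n → ℂ))

theorem coordDer_isSuperDer (I : Finset (Gen n)) :
    IsSuperDer (polyPar (EvenIdx n) V) I.card (coordDer π I) := by
  rw [coordDer]
  split_ifs with h
  · exact (evenDer_isSuperDer _).congr polyPar_sq (by simpa using h)
  · exact (oddDer_isSuperDer _).congr polyPar_sq (by
      rw [Nat.not_even_iff_odd] at h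
      exact odd_one.add_odd h)

theorem polyPar_coordDer (I : Finset (Gen n)) (a : SuperPoly (EvenIdx n) V) :
    polyPar _ V (coordDer π I a) = (-1 : ℂ) ^ I.card • coordDer π I (polyPar _ V a) := by
  rw [coordDer]
  split_ifs with h
  · rw [polyPar_evenDer, h.neg_one_pow, one_smul]
  · rw [polyPar_oddDer, (Nat.not_even_iff_odd.1 h).neg_one_pow, neg_one_smul]

theorem coordDer_comm (I J : Finset (Gen n)) (a : SuperPoly (EvenIdx n) V) :
    coordDer π I (coordDer π J a) =
      (-1 : ℂ) ^ (I.card * J.card) • coordDer π J (coordDer π I a) := by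
  rw [coordDer, coordDer]
  split_ifs with h h' h'
  · rw [evenDer_evenDer, (h.mul_right _).neg_one_pow, one_smul]
  · rw [evenDer_oddDer, (h.mul_right _).neg_one_pow, one_smul]
  · rw [evenDer_oddDer, (h'.mul_left _).neg_one_pow, one_smul]
  · rw [oddDer_oddDer, ((Nat.not_even_iff_odd.1 h).mul (Nat.not_even_iff_odd.1 h')).neg_one_pow,
      neg_one_smul]

end CoordDer

/-- The coordinate `t_I`. -/
def tc (I : Finset (Gen n)) : SP n := toSP (coordFn I)

theorem tc_of_even {I : Finset (Gen n)} (h : Even I.card) :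
    tc I = sTmul (MvPolynomial.X ⟨I, h⟩) 1 := dif_pos h

theorem tc_of_not_even {I : Finset (Gen n)} (h : ¬Even I.card) :
    tc I = sTmul 1 (ExteriorAlgebra.ι ℂ (Pi.single ⟨I, Nat.not_even_iff_odd.1 h⟩ 1)) := dif_neg h

/-- The derivative with respect to `t_I`. -/
abbrev sDer (I : Finset (Gen n)) : SP n →ₗ[ℂ] SP n := coordDer LinearMap.id I

theorem toSP_coordDeriv (I : Finset (Gen n)) (a : SPoly n) :
    toSP (coordDeriv I a) = sDer I (toSP a) := by
  rw [sDer, coordDer, coordDeriv]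
  split_ifs <;> rfl

theorem tc_parity (I : Finset (Gen n)) : HasParity (sPar n) I.card (tc I) := by
  by_cases h : Even I.card
  · rw [tc_of_even h]
    exact (sTmul_one_parity _).congr (by simpa using h)
  · rw [tc_of_not_even h]
    exact (sTmul_ι_parity _).congr (odd_one.add_odd (Nat.not_even_iff_odd.1 h))

theorem sDer_tc (I J : Finset (Gen n)) :
    sDer I (tc J) = if I = J then 1 else 0 := by
  rw [sDer, coordDer]
  split_ifs with h h2 h2
  · subst h2
    rw [tc_of_even h, evenDer_sTmul, MvPolynomial.pderiv_X_self]; rfl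
  · by_cases h' : Even J.card
    · rw [tc_of_even h', evenDer_sTmul, MvPolynomial.pderiv_X_of_ne, zero_sTmul]
      exact fun h3 => h2 (congrArg Subtype.val h3).symm
    · rw [tc_of_not_even h', evenDer_sTmul, ← map_one MvPolynomial.C, MvPolynomial.pderiv_C,
        zero_sTmul]
  · subst h2
    rw [tc_of_not_even h, oddDer_sTmul, contr_ι]
    simp [sTmul_one_one]
  · by_cases h' : Even J.card
    · rw [tc_of_even h', oddDer_sTmul, (contr_isSuperDer _).map_one, sTmul_zero]
    · rw [tc_of_not_even h', oddDer_sTmul, contr_ι]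
      have : (⟨I, Nat.not_even_iff_odd.1 h⟩ : OddIdx n) ≠ ⟨J, Nat.not_even_iff_odd.1 h'⟩ :=
        fun h3 => h2 (congrArg Subtype.val h3)
      simp [this, sTmul_zero]

/-! ### The coadjoint vector fields -/

/-- The structure constants of the bracket. -/
def strConst (X I J : Finset (Gen n)) : ℂ :=
  (monoBasis n).coord J (bracket (monoBasis n X) (monoBasis n I))

theorem strConst_eq_zero {X I J : Finset (Gen n)} (h : ¬Even (X.card + I.card + J.card)) :
    strConst X I J = 0 :=
  coord_eq_zero_of_parity ((mono_parity X).bracket (mono_parity I)) h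

theorem iterate_eq_pow {A : Type*} [Ring A] [Algebra ℂ A] (θ : A →ₐ[ℂ] A) (k : ℕ) (x : A) :
    θ^[k] x = (θ ^ k) x := by
  induction k with
  | zero => rfl
  | succ k ih => rw [Function.iterate_succ_apply', ih, pow_succ', AlgHom.mul_apply]

/-- The cad action on the coordinates. -/
def cad (X : Po n) (J : Finset (Gen n)) : SP n :=
  -∑ I, (monoBasis n).coord J (bracket (parityAut^[J.card] X) (monoBasis n I)) • tc I

/-- The cad vector field. -/
def vf (X : Po n) : SP n →ₗ[ℂ] SP n := ∑ J, LinearMap.mulLeft ℂ (cad X J) ∘ₗ sDer J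

theorem vf_apply (X : Po n) (P : SP n) : vf X P = ∑ J, cad X J * sDer J P := by
  simp [vf, LinearMap.sum_apply]

theorem toSP_vectorField (X : Po n) (P : SPoly n) : toSP (vectorField X P) = vf X (toSP P) := by
  rw [vf_apply, vectorField, LinearMap.sum_apply, map_sum]
  refine Finset.sum_congr rfl fun J _ => ?_
  rw [← toSP_coordDeriv]
  rfl

theorem cad_mono (X J : Finset (Gen n)) :
    cad (monoBasis n X) J =
      -∑ I, ((-1 : ℂ) ^ (J.card * X.card) * strConst X I J) • tc I := by
  rw [cad]
  congr 1
  refine Finset.sum_congr rfl fun I _ => ?_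
  rw [iterate_eq_pow, (mono_parity X).pow_apply, bracket_smul_left, map_smul, smul_eq_mul]
  rfl

theorem cad_mono_parity (X J : Finset (Gen n)) :
    HasParity (sPar n) (X.card + J.card) (cad (monoBasis n X) J) := by
  rw [cad_mono]
  refine HasParity.neg (HasParity.sum fun I _ => ?_)
  by_cases h : Even (X.card + I.card + J.card)
  · refine HasParity.smul _ ((tc_parity I).congr ?_)
    convert h using 1; ring
  · rw [strConst_eq_zero h, mul_zero, zero_smul]
    exact HasParity.zero _

theorem vf_mono_isSuperDer (X : Finset (Gen n)) :
    IsSuperDer (sPar n) X.card (vf (monoBasis n X)) := by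
  rw [vf]
  refine IsSuperDer.sum fun J _ => ?_
  refine ((coordDer_isSuperDer LinearMap.id J).mulLeft superPoly_isSuperComm
    (cad_mono_parity X J)).congr polyPar_sq ?_
  exact ⟨X.card + J.card, by ring⟩

theorem cad_add (X Y : Po n) (J : Finset (Gen n)) :
    cad (X + Y) J = cad X J + cad Y J := by
  simp only [cad, iterate_eq_pow, map_add, bracket_add_left, add_smul,
    Finset.sum_add_distrib, neg_add]

theorem cad_smul (c : ℂ) (X : Po n) (J : Finset (Gen n)) :
    cad (c • X) J = c • cad X J := by
  simp only [cad, iterate_eq_pow, map_smul, bracket_smul_left, Finset.smul_sum,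
    smul_neg, smul_eq_mul, mul_smul]

theorem vf_add (X Y : Po n) : vf (X + Y) = vf X + vf Y := by
  ext1 a
  simp only [vf, cad_add, LinearMap.add_apply, LinearMap.sum_apply,
    LinearMap.comp_apply, LinearMap.mulLeft_apply, add_mul, Finset.sum_add_distrib]

theorem vf_smul (c : ℂ) (X : Po n) : vf (c • X) = c • vf X := by
  ext1 a
  simp only [vf, cad_smul, LinearMap.smul_apply, LinearMap.sum_apply,
    LinearMap.comp_apply, LinearMap.mulLeft_apply, smul_mul_assoc, Finset.smul_sum]

/-- The field is linear in X, so the monomials suffice; for them the field is a superderivation of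
definite parity. -/
theorem mem_invariants_iff (P : SPoly n) :
    P ∈ invariants n ↔ ∀ X, vf (monoBasis n X) (toSP P) = 0 := by
  simp only [invariants, Submodule.mem_iInf, LinearMap.mem_ker]
  have key : ∀ X, vectorField X P = 0 ↔ vf X (toSP P) = 0 := fun X => by
    rw [← toSP_vectorField]; exact (EmbeddingLike.map_eq_zero_iff (f := toSP)).symm
  simp only [key]
  refine ⟨fun h X => h _, fun h X => ?_⟩
  let L : Po n →ₗ[ℂ] SP n :=
    { toFun := fun X => vf X (toSP P)
      map_add' := fun X Y => by rw [vf_add, LinearMap.add_apply]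
      map_smul' := fun c X => by rw [vf_smul, LinearMap.smul_apply, RingHom.id_apply] }
  have : L = 0 := (monoBasis n).ext fun I => h I
  exact congrArg (fun f => f X) this

/-- The subalgebra of invariant polynomials. -/
def invSub (n : ℕ) : Subalgebra ℂ (SP n) where
  carrier := {P | ∀ X, vf (monoBasis n X) P = 0}
  mul_mem' := fun {P Q} hP hQ X => by
    rw [vf_mono_isSuperDer X, hP, hQ, zero_mul, mul_zero, add_zero]
  add_mem' := fun {P Q} hP hQ X => by rw [map_add, hP, hQ, add_zero]
  algebraMap_mem' r X := by
    rw [Algebra.algebraMap_eq_smul_one, map_smul, (vf_mono_isSuperDer X).map_one, smul_zero]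

theorem mem_invSub {P : SP n} : P ∈ invSub n ↔ ∀ X, vf (monoBasis n X) P = 0 := Iff.rfl

/-! ### Functions of `ξ, η` with polynomial coefficients -/

/-- The inclusion of the coefficients. -/
def incl : SP n →ₐ[ℂ] BP n := inclCoeff n

/-- The inclusion of the functions of `ξ, η`. -/
def inclP : Po n →ₐ[ℂ] BP n := inclPo n

/-- The derivative with respect to `t_I`. -/
abbrev bDer (I : Finset (Gen n)) : BP n →ₗ[ℂ] BP n := coordDer (LinearMap.fst ℂ _ _) I

/-- The derivative with respect to a generator. -/
def vDer (a : Gen n) : BP n →ₗ[ℂ] BP n := oddDer (LinearMap.proj a ∘ₗ LinearMap.snd ℂ _ _)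

theorem incl_sTmul (p : MvPolynomial (EvenIdx n) ℂ) (x : ExteriorAlgebra ℂ (OddIdx n → ℂ)) :
    incl (sTmul p x) = sTmul p (ExteriorAlgebra.map (LinearMap.inl ℂ _ _) x) := rfl

theorem inclP_eq (g : Po n) : inclP g = sTmul 1 (ExteriorAlgebra.map (LinearMap.inr ℂ _ _) g) := rfl

theorem contr_zero {V : Type*} [AddCommGroup V] [Module ℂ V] (x : ExteriorAlgebra ℂ V) :
    contr 0 x = 0 := by
  rw [contr, map_zero, LinearMap.zero_apply]

theorem bDer_incl (I : Finset (Gen n)) (q : SP n) : bDer I (incl q) = incl (sDer I q) := by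
  induction q using sTmul_induction with
  | h0 => simp
  | ha x y hx hy => simp only [map_add, hx, hy]
  | h1 p x =>
    rw [bDer, sDer, coordDer, coordDer]
    split_ifs
    · rfl
    · rw [incl_sTmul, oddDer_sTmul, oddDer_sTmul, incl_sTmul, contr_map]
      rfl

theorem vDer_incl (a : Gen n) (q : SP n) : vDer a (incl q) = 0 := by
  induction q using sTmul_induction with
  | h0 => simp
  | ha x y hx hy => simp only [map_add, hx, hy, add_zero]
  | h1 p x =>
    rw [vDer, incl_sTmul, oddDer_sTmul, contr_map]
    have : (LinearMap.proj a ∘ₗ LinearMap.snd ℂ (OddIdx n → ℂ) (Gen n → ℂ)) ∘ₗ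
        LinearMap.inl ℂ _ _ = 0 := by
      ext; simp
    rw [this, contr_zero, map_zero, sTmul_zero]

theorem bDer_inclP (I : Finset (Gen n)) (g : Po n) : bDer I (inclP g) = 0 := by
  rw [bDer, coordDer, inclP_eq]
  split_ifs
  · rw [evenDer_sTmul, ← map_one MvPolynomial.C, MvPolynomial.pderiv_C, zero_sTmul]
  · rw [oddDer_sTmul, contr_map]
    have : ∀ i : OddIdx n, (LinearMap.proj i ∘ₗ LinearMap.fst ℂ (OddIdx n → ℂ) (Gen n → ℂ)) ∘ₗ
        LinearMap.inr ℂ _ _ = 0 := by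
      intro i; ext; simp
    rw [this, contr_zero, map_zero, sTmul_zero]

theorem vDer_inclP (a : Gen n) (g : Po n) : vDer a (inclP g) = inclP (pdiff a g) := by
  rw [vDer, inclP_eq, inclP_eq, oddDer_sTmul, contr_map]
  rfl

theorem bPar_incl (q : SP n) : bPar n (incl q) = incl (sPar n q) := by
  induction q using sTmul_induction with
  | h0 => simp
  | ha x y hx hy => simp only [map_add, hx, hy]
  | h1 p x => rw [incl_sTmul, polyPar_sTmul, polyPar_sTmul, incl_sTmul, extPar_map]

theorem bPar_inclP (g : Po n) : bPar n (inclP g) = inclP (parityAut g) := by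
  rw [inclP_eq, inclP_eq, polyPar_sTmul, extPar_map]
  rfl

theorem HasParity.incl {q : ℕ} {x : SP n} (h : HasParity (sPar n) q x) :
    HasParity (bPar n) q (incl x) := by
  rw [HasParity, bPar_incl, h, map_smul]

theorem HasParity.inclP {q : ℕ} {x : Po n} (h : HasParity parityAut q x) :
    HasParity (bPar n) q (inclP x) := by
  rw [HasParity, bPar_inclP, h, map_smul]

theorem vDer_isSuperDer (a : Gen n) : IsSuperDer (bPar n) 1 (vDer a) := oddDer_isSuperDer _

theorem bPar_vDer (a : Gen n) (G : BP n) : bPar n (vDer a G) = -vDer a (bPar n G) :=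
  polyPar_oddDer _ _

theorem HasParity.vDer {q : ℕ} {x : BP n} (h : HasParity (bPar n) q x) (a : Gen n) :
    HasParity (bPar n) (q + 1) (vDer a x) := by
  rw [HasParity, bPar_vDer, h, map_smul, pow_succ]; simp

theorem vDer_vDer (a b : Gen n) (G : BP n) : vDer a (vDer b G) = -vDer b (vDer a G) :=
  oddDer_oddDer _ _ _

theorem vDer_vDer_self (a : Gen n) (G : BP n) : vDer a (vDer a G) = 0 := by
  have h := vDer_vDer a a G
  have h2 : (2 : ℂ) • vDer a (vDer a G) = 0 := by
    rw [two_smul]; nth_rewrite 1 [h]; exact neg_add_cancel _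
  exact (smul_eq_zero.1 h2).resolve_left two_ne_zero

theorem bDer_vDer (I : Finset (Gen n)) (a : Gen n) (G : BP n) :
    bDer I (vDer a G) = (-1 : ℂ) ^ I.card • vDer a (bDer I G) := by
  rw [bDer, coordDer]
  split_ifs with h
  · rw [h.neg_one_pow, one_smul]
    exact evenDer_oddDer _ _ _
  · rw [(Nat.not_even_iff_odd.1 h).neg_one_pow, neg_one_smul]
    exact oddDer_oddDer _ _ _

/-- The generic element of `po(0|2n)`. -/
def gf (n : ℕ) : BP n := ∑ I, incl (tc I) * inclP (monoBasis n I)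

theorem gf_parity : HasParity (bPar n) 0 (gf n) := by
  refine HasParity.sum fun I _ => ?_
  exact ((tc_parity I).incl.mul (mono_parity I).inclP).congr ⟨I.card, by ring⟩

/-- The coadjoint vector field, extended to functions of `ξ, η`. -/
def bvf (X : Po n) : BP n →ₗ[ℂ] BP n :=
  ∑ J, LinearMap.mulLeft ℂ (incl (cad X J)) ∘ₗ bDer J

/-- The Hamiltonian vector field in `ξ, η`, up to parity of the Hamiltonian. -/
def ham (X : Po n) : BP n →ₗ[ℂ] BP n :=
  ∑ a, LinearMap.mulLeft ℂ (inclP (pdiff a X)) ∘ₗ vDer (conj a)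

theorem bvf_apply (X : Po n) (G : BP n) : bvf X G = ∑ J, incl (cad X J) * bDer J G := by
  simp [bvf, LinearMap.sum_apply]

theorem ham_apply (X : Po n) (G : BP n) :
    ham X G = ∑ a, inclP (pdiff a X) * vDer (conj a) G := by
  simp [ham, LinearMap.sum_apply]

theorem bvf_isSuperDer (X : Finset (Gen n)) :
    IsSuperDer (bPar n) X.card (bvf (monoBasis n X)) := by
  refine IsSuperDer.sum fun J _ => ?_
  refine ((coordDer_isSuperDer _ J).mulLeft superPoly_isSuperComm
    (cad_mono_parity X J).incl).congr polyPar_sq ?_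
  exact ⟨X.card + J.card, by ring⟩

theorem ham_isSuperDer (X : Finset (Gen n)) :
    IsSuperDer (bPar n) X.card (ham (monoBasis n X)) := by
  refine IsSuperDer.sum fun a _ => ?_
  refine ((vDer_isSuperDer _).mulLeft superPoly_isSuperComm
    ((mono_parity X).pdiff a).inclP).congr polyPar_sq ?_
  exact ⟨X.card + 1, by ring⟩

/-- The simultaneous action of an element of `po(0|2n)` on the coefficients and on `ξ, η`. -/
def tot (X : Po n) : BP n →ₗ[ℂ] BP n := bvf X + ham X

theorem tot_isSuperDer (X : Finset (Gen n)) :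
    IsSuperDer (bPar n) X.card (tot (monoBasis n X)) :=
  (bvf_isSuperDer X).add (ham_isSuperDer X)

theorem ham_inclP (X g : Po n) : ham X (inclP g) = inclP (bracket (parityAut X) g) := by
  rw [ham_apply, bracket_eq, map_sum]
  refine Finset.sum_congr rfl fun a _ => ?_
  rw [vDer_inclP, map_mul]
  have : parityAut (parityAut X) = X := CliffordAlgebra.involute_involute _
  rw [this]

theorem vf_tc (X : Po n) (I : Finset (Gen n)) : vf X (tc I) = cad X I := by
  rw [vf_apply]
  simp [sDer_tc]

theorem bvf_incl (X : Po n) (q : SP n) : bvf X (incl q) = incl (vf X q) := by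
  rw [bvf_apply, vf_apply, map_sum]
  simp only [bDer_incl, map_mul]

theorem bvf_inclP (X g : Po n) : bvf X (inclP g) = 0 := by
  rw [bvf_apply]
  simp only [bDer_inclP, mul_zero, Finset.sum_const_zero]

theorem ham_incl (X : Po n) (q : SP n) : ham X (incl q) = 0 := by
  rw [ham_apply]
  simp only [vDer_incl, mul_zero, Finset.sum_const_zero]

theorem bracket_mono (X I : Finset (Gen n)) :
    bracket (monoBasis n X) (monoBasis n I) = ∑ J, strConst X I J • monoBasis n J :=
  (sum_coord_smul_mono _).symm

/-- The element ∑ t_I e_I represents the identity map, which is equivariant: the coadjoint action on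
the t_I cancels the action on the e_I. -/
theorem tot_gf (X : Finset (Gen n)) : tot (monoBasis n X) (gf n) = 0 := by
  rw [gf, map_sum]
  have h : ∀ I, tot (monoBasis n X) (incl (tc I) * inclP (monoBasis n I)) =
      incl (cad (monoBasis n X) I) * inclP (monoBasis n I) +
      ∑ J, ((-1 : ℂ) ^ (J.card * X.card) * strConst X I J) •
        (incl (tc I) * inclP (monoBasis n J)) := by
    intro I
    rw [(tot_isSuperDer X).apply_mul (tc_parity I).incl, tot, LinearMap.add_apply, ham_incl,
      add_zero, bvf_incl, vf_tc, LinearMap.add_apply, bvf_inclP, zero_add, ham_inclP,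
      mono_parity X, bracket_smul_left, map_smul, bracket_mono, map_sum, mul_smul_comm, smul_smul,
      Finset.mul_sum, Finset.smul_sum]
    congr 1
    refine Finset.sum_congr rfl fun J _ => ?_
    rw [map_smul, mul_smul_comm, smul_smul]
    -- A nonzero structure constant forces the three parities to add up to an even number, and
    -- exactly then the two sign exponents agree.
    by_cases h : Even (X.card + I.card + J.card)
    · congr 2
      rw [← pow_add]
      refine neg_one_pow_congr ?_
      rw [Nat.even_add, Nat.even_add, Nat.even_mul, Nat.even_mul]
      rw [Nat.even_add, Nat.even_add] at h
      tauto
    · rw [strConst_eq_zero h, mul_zero, mul_zero]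
  simp only [h, Finset.sum_add_distrib]
  rw [Finset.sum_comm (f := fun I J => ((-1 : ℂ) ^ (J.card * X.card) * strConst X I J) •
        (incl (tc I) * inclP (monoBasis n J))), ← Finset.sum_add_distrib]
  refine Finset.sum_eq_zero fun J _ => ?_
  rw [cad_mono, map_neg, map_sum, neg_mul, Finset.sum_mul, neg_add_eq_zero]
  refine Finset.sum_congr rfl fun I _ => ?_
  rw [map_smul, smul_mul_assoc]

/-! ### The Berezin integral -/

/-- The iterated derivative with respect to all `ξ_i, η_i` for `i` in a list. -/
def topDer : List (Fin n) → BP n →ₗ[ℂ] BP n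
  | [] => LinearMap.id
  | i :: L => topDer L ∘ₗ vDer (toLex (i, 1)) ∘ₗ vDer (toLex (i, 0))

/-- The specialization `ξ = η = 0`. -/
def redu : BP n →ₐ[ℂ] SP n :=
  Algebra.TensorProduct.map (AlgHom.id ℂ (MvPolynomial (EvenIdx n) ℂ))
    (ExteriorAlgebra.map (LinearMap.fst ℂ (OddIdx n → ℂ) (Gen n → ℂ)))

theorem redu_sTmul (p : MvPolynomial (EvenIdx n) ℂ) (x) :
    redu (sTmul p x) = sTmul p (ExteriorAlgebra.map (LinearMap.fst ℂ _ _) x) := rfl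

/-- The Berezin integral with polynomial coefficients. -/
def ber : BP n →ₗ[ℂ] SP n := redu.toLinearMap ∘ₗ topDer (List.finRange n)

theorem ber_apply (G : BP n) : ber G = redu (topDer (List.finRange n) G) := rfl

theorem topDer_sTmul (L : List (Fin n)) (p : MvPolynomial (EvenIdx n) ℂ) (x) :
    topDer L (sTmul p x) = sTmul p (L.foldr
        (fun i D => D ∘ₗ dVar (toLex (i, 1)) ∘ₗ dVar (toLex (i, 0))) LinearMap.id x) := by
  induction L generalizing x with
  | nil => rfl
  | cons i L ih => exact ih _

theorem ber_eq (G : BigPoly n) : toSP (berezin n G) = ber (n := n) G := by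
  induction G using TensorProduct.induction_on with
  | zero => rw [map_zero, map_zero]; exact (map_zero ber).symm
  | add x y hx hy => rw [map_add, map_add, hx, hy]; exact (map_add ber _ _).symm
  | tmul p x =>
    refine Eq.symm ((congrArg redu (topDer_sTmul _ p x)).trans ?_)
    rw [redu_sTmul]
    rfl

theorem redu_incl (q : SP n) : redu (incl q) = q := by
  induction q using sTmul_induction with
  | h0 => simp
  | ha x y hx hy => simp only [map_add, hx, hy]
  | h1 p x =>
    rw [incl_sTmul, redu_sTmul, ← AlgHom.comp_apply, ExteriorAlgebra.map_comp_map,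
      LinearMap.fst_comp_inl, ExteriorAlgebra.map_id]
    rfl

theorem redu_bDer (I : Finset (Gen n)) (G : BP n) : redu (bDer I G) = sDer I (redu G) := by
  induction G using sTmul_induction with
  | h0 => simp
  | ha x y hx hy => simp only [map_add, hx, hy]
  | h1 p x =>
    rw [bDer, sDer, coordDer, coordDer]
    split_ifs
    · rfl
    · rw [redu_sTmul, oddDer_sTmul, oddDer_sTmul, redu_sTmul, contr_map]
      rfl

/-- The odd derivatives come in pairs, so the two parity twists of the coefficient cancel. -/
theorem topDer_incl_mul (L : List (Fin n)) (q : SP n) (G : BP n) :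
    topDer L (incl q * G) = incl q * topDer L G := by
  induction L generalizing G with
  | nil => rfl
  | cons i L ih =>
    have h : ∀ (a : Gen n) (q : SP n) G, vDer a (incl q * G) = incl (sPar n q) * vDer a G := by
      intro a q G
      rw [vDer_isSuperDer, vDer_incl, zero_mul, zero_add, pow_one, bPar_incl]
    have h2 : sPar n (sPar n q) = q := by
      rw [← AlgHom.mul_apply, ← pow_two, polyPar_sq, AlgHom.one_apply]
    simp only [topDer, LinearMap.comp_apply, h, h2, ih]

theorem ber_incl_mul (q : SP n) (G : BP n) : ber (incl q * G) = q * ber G := by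
  rw [ber_apply, topDer_incl_mul, map_mul, redu_incl, ber_apply]

theorem topDer_bDer (L : List (Fin n)) (I : Finset (Gen n)) (G : BP n) :
    topDer L (bDer I G) = bDer I (topDer L G) := by
  induction L generalizing G with
  | nil => rfl
  | cons i L ih =>
    simp only [topDer, LinearMap.comp_apply, ← ih]
    rw [bDer_vDer, bDer_vDer]
    simp only [map_smul]
    rw [smul_smul, ← pow_add, (Even.add_self _).neg_one_pow,
      one_smul]

theorem ber_bDer (I : Finset (Gen n)) (G : BP n) : ber (bDer I G) = sDer I (ber G) := by
  rw [ber_apply, topDer_bDer, redu_bDer, ber_apply]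

/-- Up to sign the extra derivative can be moved next to the derivative in the same odd variable,
and the square of an odd derivative is zero. -/
theorem topDer_vDer (L : List (Fin n)) (a : Gen n) (h : (ofLex a).1 ∈ L) (G : BP n) :
    topDer L (vDer a G) = 0 := by
  induction L generalizing G with
  | nil => simp at h
  | cons i L ih =>
    simp only [topDer, LinearMap.comp_apply]
    by_cases hi : (ofLex a).1 = i
    · obtain ⟨j, b⟩ := a
      have hj : j = i := hi
      subst hj
      have hz : vDer (toLex (j, 1)) (vDer (toLex (j, 0)) (vDer (toLex (j, b)) G)) = 0 := by
        fin_cases b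
        · change vDer _ (vDer (toLex (j, 0)) (vDer (toLex (j, 0)) G)) = 0
          rw [vDer_vDer_self, map_zero]
        · change vDer _ (vDer (toLex (j, 0)) (vDer (toLex (j, 1)) G)) = 0
          rw [vDer_vDer (toLex (j, 0)), map_neg, vDer_vDer_self, neg_zero]
      exact (congrArg (topDer L) hz).trans (map_zero _)
    · rw [vDer_vDer _ a, map_neg, vDer_vDer _ a, neg_neg]
      exact ih ((List.mem_cons.1 h).resolve_left hi) _

theorem ber_vDer (a : Gen n) (G : BP n) : ber (vDer a G) = 0 := by
  rw [ber_apply, topDer_vDer _ _ (List.mem_finRange _), map_zero]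

theorem ber_bvf (X : Po n) (G : BP n) : ber (bvf X G) = vf X (ber G) := by
  rw [bvf_apply, vf_apply, map_sum]
  simp only [ber_incl_mul, ber_bDer]

/-- Conjugating the index exchanges two anticommuting derivatives, so the sum equals its own
negative. This says that Hamiltonian fields are divergence-free. -/
theorem sum_pdiff_conj_pdiff (X : Po n) : ∑ a, pdiff (conj a) (pdiff a X) = 0 := by
  have h : ∑ a, pdiff (conj a) (pdiff a X) = -∑ a, pdiff (conj a) (pdiff a X) := by
    conv_lhs => rw [← sum_conj]
    simp only [conj_conj]
    rw [← Finset.sum_neg_distrib]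
    exact Finset.sum_congr rfl fun a _ => pdiff_pdiff _ _ _
  have h2 : (2 : ℂ) • ∑ a, pdiff (conj a) (pdiff a X) = 0 := by
    rw [two_smul]; nth_rewrite 1 [h]; exact neg_add_cancel _
  exact (smul_eq_zero.1 h2).resolve_left two_ne_zero

/-- Integration by parts: each term is a total derivative plus a second derivative of X times G, and
the latter add up to the divergence. -/
theorem ber_ham (X : Po n) (G : BP n) : ber (ham X G) = 0 := by
  have h : ham X G = ∑ a, (inclP (pdiff (conj a) (pdiff a (parityAut X))) * G -
      vDer (conj a) (inclP (pdiff a (parityAut X)) * G)) := by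
    rw [ham_apply]
    refine Finset.sum_congr rfl fun a _ => ?_
    have : parityAut (parityAut X) = X := CliffordAlgebra.involute_involute _
    rw [vDer_isSuperDer, pow_one, bPar_inclP, parityAut_pdiff, this, vDer_inclP, map_neg]
    noncomm_ring
  rw [h, Finset.sum_sub_distrib, ← Finset.sum_mul, ← map_sum, sum_pdiff_conj_pdiff, map_zero,
    zero_mul, zero_sub, map_neg, map_sum]
  simp only [ber_vDer, Finset.sum_const_zero, neg_zero]

/-- The source of all invariants used here: both r_k and `specInv` are obtained through it. -/
theorem ber_mem_invSub {G : BP n} (h : ∀ X, tot (monoBasis n X) G = 0) : ber G ∈ invSub n := by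
  intro X
  rw [← ber_bvf]
  have := congrArg ber (h X)
  rwa [tot, LinearMap.add_apply, map_add, ber_ham, add_zero, map_zero] at this

theorem toSP_rInv (k : ℕ) : toSP (rInv n k) = ber (gf n ^ k) := ber_eq _

theorem rInv_mem (k : ℕ) : ber (gf n ^ k) ∈ invSub n :=
  ber_mem_invSub fun X => (tot_isSuperDer X).apply_pow (tot_gf X) k

/-! ### The invariant built from the gradient and the Hessian of the generic element -/

/-- The gradient of the generic element. -/
def grad (a : Gen n) : BP n := vDer a (gf n)

/-- The Hessian of the generic element. -/
def hess (a b : Gen n) : BP n := vDer a (vDer b (gf n))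

theorem grad_parity (a : Gen n) : HasParity (bPar n) 1 (grad a) := gf_parity.vDer a

theorem hess_parity (a b : Gen n) : HasParity (bPar n) 0 (hess a b) :=
  ((gf_parity.vDer b).vDer a).congr ⟨1, rfl⟩

theorem hess_comm (a b : Gen n) (G : BP n) : hess a b * G = G * hess a b := by
  rw [superPoly_isSuperComm 0 _ _ (hess_parity a b), pow_zero, AlgHom.one_apply]

theorem hess_swap (a b : Gen n) : hess a b = -hess b a := vDer_vDer _ _ _

theorem grad_mul_grad (a b : Gen n) : grad a * grad b = -(grad b * grad a) := by
  rw [superPoly_isSuperComm.mul_comm (grad_parity a) (grad_parity b)]; simp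

theorem grad_mul_self (a : Gen n) : grad a * grad a = 0 := by
  have h := grad_mul_grad a a
  have h2 : (2 : ℂ) • (grad a * grad a) = 0 := by
    rw [two_smul]; nth_rewrite 1 [h]; exact neg_add_cancel _
  exact (smul_eq_zero.1 h2).resolve_left two_ne_zero

/-- The product of gradient components along a list. -/
def gradProd (L : List (Gen n)) : BP n := (L.map grad).prod

theorem gradProd_nil : gradProd ([] : List (Gen n)) = 1 := rfl

theorem gradProd_cons (a : Gen n) (L : List (Gen n)) :
    gradProd (a :: L) = grad a * gradProd L := by
  simp [gradProd]

theorem gradProd_append (L L' : List (Gen n)) :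
    gradProd (L ++ L') = gradProd L * gradProd L' := by
  simp [gradProd]

theorem gradProd_parity (L : List (Gen n)) : HasParity (bPar n) L.length (gradProd L) := by
  induction L with
  | nil => exact HasParity.one
  | cons a L ih =>
    rw [gradProd_cons, List.length_cons, add_comm]
    exact (grad_parity a).mul ih

theorem grad_mul_gradProd {a : Gen n} {L : List (Gen n)} (h : a ∈ L) :
    grad a * gradProd L = 0 := by
  induction L with
  | nil => simp at h
  | cons b L ih =>
    rw [gradProd_cons, ← mul_assoc]
    rcases List.mem_cons.1 h with rfl | h
    · rw [grad_mul_self, zero_mul]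
    · rw [grad_mul_grad, neg_mul, mul_assoc, ih h, mul_zero, neg_zero]

theorem gradProd_mul_grad {a : Gen n} {L : List (Gen n)} (h : a ∈ L) :
    gradProd L * grad a = 0 := by
  rw [superPoly_isSuperComm.mul_comm (gradProd_parity L) (grad_parity a), grad_mul_gradProd h,
    smul_zero]

theorem gradProd_mul_mul_grad {a : Gen n} {L : List (Gen n)} (h : a ∈ L) (G : BP n) :
    gradProd L * (G * grad a) = 0 := by
  have h1 : grad a * bPar n G = G * grad a := by
    rw [superPoly_isSuperComm 1 _ _ (grad_parity a), pow_one, ← AlgHom.mul_apply, ← pow_two,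
      polyPar_sq, AlgHom.one_apply]
  rw [← h1, ← mul_assoc, gradProd_mul_grad h, zero_mul]

theorem bvf_vDer (X : Finset (Gen n)) (a : Gen n) (G : BP n) :
    bvf (monoBasis n X) (vDer a G) = (-1 : ℂ) ^ X.card • vDer a (bvf (monoBasis n X) G) := by
  rw [bvf_apply, bvf_apply, map_sum, Finset.smul_sum]
  refine Finset.sum_congr rfl fun J _ => ?_
  rw [(vDer_isSuperDer a).apply_mul (cad_mono_parity X J).incl, vDer_incl, zero_mul, zero_add,
    smul_smul, bDer_vDer, mul_smul_comm, one_mul, ← pow_add]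
  congr 1
  exact neg_one_pow_congr ⟨X.card + J.card, by ring⟩

/-- The second derivatives of the Hamiltonian, up to sign. -/
def hamHess (X : Finset (Gen n)) (a b : Gen n) : BP n :=
  (-1 : ℂ) ^ X.card • inclP (pdiff a (pdiff b (monoBasis n X)))

theorem hamHess_parity (X : Finset (Gen n)) (a b : Gen n) :
    HasParity (bPar n) X.card (hamHess X a b) :=
  ((((mono_parity X).pdiff b).pdiff a).congr ⟨X.card + 1, by ring⟩).inclP.smul _

theorem hamHess_swap (X : Finset (Gen n)) (a b : Gen n) : hamHess X a b = -hamHess X b a := by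
  rw [hamHess, pdiff_pdiff, map_neg, smul_neg, hamHess]

theorem ham_vDer (X : Finset (Gen n)) (a : Gen n) (G : BP n) :
    ham (monoBasis n X) (vDer a G) = (-1 : ℂ) ^ X.card • vDer a (ham (monoBasis n X) G) -
      ∑ b, hamHess X a b * vDer (conj b) G := by
  rw [ham_apply, ham_apply, map_sum, Finset.smul_sum, ← Finset.sum_sub_distrib]
  refine Finset.sum_congr rfl fun b _ => ?_
  rw [(vDer_isSuperDer a).apply_mul ((mono_parity X).pdiff b).inclP, vDer_inclP, hamHess,
    smul_add, smul_mul_assoc, add_sub_cancel_left, smul_smul, vDer_vDer a, one_mul, ← pow_add,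
    mul_neg, smul_neg, ← add_assoc, pow_succ, (Even.add_self X.card).neg_one_pow, one_mul,
    neg_one_smul, neg_neg]

/-- The field `ham X` has nonconstant coefficients, so it does not supercommute with ∂_a. The defect
is the matrix of second derivatives of X applied to the gradient. -/
theorem tot_vDer (X : Finset (Gen n)) (a : Gen n) (G : BP n) :
    tot (monoBasis n X) (vDer a G) = (-1 : ℂ) ^ X.card • vDer a (tot (monoBasis n X) G) -
      ∑ b, hamHess X a b * vDer (conj b) G := by
  rw [tot, LinearMap.add_apply, LinearMap.add_apply, bvf_vDer, ham_vDer, map_add, smul_add]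
  abel

theorem tot_grad (X : Finset (Gen n)) (a : Gen n) :
    tot (monoBasis n X) (grad a) = -∑ b, hamHess X a b * grad (conj b) := by
  rw [grad, tot_vDer, tot_gf, map_zero, smul_zero, zero_sub]
  rfl

/-- The last two sums rotate the two indices by the same matrix that rotates the gradient. The first
sum carries third derivatives of X and is the obstruction to tensoriality; each of its terms
contains a gradient component. -/
theorem tot_hess (X : Finset (Gen n)) (a c : Gen n) :
    tot (monoBasis n X) (hess a c) =
      -((-1 : ℂ) ^ X.card • ∑ b, vDer a (hamHess X c b) * grad (conj b))
      - ∑ b, hamHess X c b * hess a (conj b) - ∑ b, hamHess X a b * hess (conj b) c := by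
  have h : ∀ b, vDer a (hamHess X c b * grad (conj b)) =
      vDer a (hamHess X c b) * grad (conj b) +
        (-1 : ℂ) ^ X.card • (hamHess X c b * hess a (conj b)) := fun b => by
    rw [(vDer_isSuperDer a).apply_mul (hamHess_parity X c b), one_mul]
    rfl
  have h1 : tot (monoBasis n X) (hess a c) = (-1 : ℂ) ^ X.card •
      vDer a (tot (monoBasis n X) (grad c)) - ∑ b, hamHess X a b * hess (conj b) c :=
    tot_vDer X a _
  rw [h1, tot_grad, map_neg, map_sum]
  simp only [h, Finset.sum_add_distrib]
  rw [smul_neg, smul_add, ← Finset.smul_sum, smul_smul, ← pow_add,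
    (Even.add_self X.card).neg_one_pow, one_smul, neg_add, ← sub_eq_add_neg]

/-- A product of all the odd gradient components behaves like a determinant, so a linear change of
the gradient acts through its trace. The prefix `L'` makes the induction work: together with the
remaining factors it still contains every generator. -/
theorem gradProd_mul_tot_gradProd (X : Finset (Gen n)) (L' L : List (Gen n))
    (hn : (L' ++ L).Nodup) (hc : ∀ a, a ∈ L' ++ L) :
    gradProd L' * tot (monoBasis n X) (gradProd L) = -((-1 : ℂ) ^ (L'.length * X.card) •
      ((L.map fun a => hamHess X a (conj a)).sum * gradProd (L' ++ L))) := by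
  induction L generalizing L' with
  | nil => rw [gradProd_nil, (tot_isSuperDer X).map_one]; simp
  | cons a L ih =>
    have hn' : ((L' ++ [a]) ++ L).Nodup := by simpa using hn
    have hc' : ∀ b, b ∈ (L' ++ [a]) ++ L := by simpa using hc
    have h1 := ih (L' ++ [a]) hn' hc'
    rw [gradProd_append, gradProd_cons, gradProd_nil, mul_one] at h1
    have h2 : gradProd L' * (tot (monoBasis n X) (grad a) * gradProd L) =
        -((-1 : ℂ) ^ (L'.length * X.card) • (hamHess X a (conj a) * gradProd (L' ++ a :: L))) := by
      -- Only `b = conj a` puts `grad a` back in its place; any other `grad (conj b)` repeats a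
      -- factor already present.
      rw [tot_grad, neg_mul, mul_neg, Finset.sum_mul, Finset.mul_sum,
        Finset.sum_eq_single (conj a)]
      · rw [conj_conj, mul_assoc, ← mul_assoc,
          superPoly_isSuperComm.mul_comm (gradProd_parity L') (hamHess_parity X a _),
          smul_mul_assoc, mul_assoc, gradProd_append, gradProd_cons]
      · intro b _ hb
        have hba : conj b ≠ a := fun h => hb (by rw [← h, conj_conj])
        have hz : gradProd L' * (grad (conj b) * gradProd L) = 0 := by
          rcases List.mem_append.1 (hc (conj b)) with h | h
          · rw [← mul_assoc, gradProd_mul_grad h, zero_mul]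
          · rw [grad_mul_gradProd ((List.mem_cons.1 h).resolve_left hba), mul_zero]
        rw [mul_assoc, ← mul_assoc,
          superPoly_isSuperComm.mul_comm (gradProd_parity L') (hamHess_parity X a _),
          smul_mul_assoc, mul_assoc, hz, mul_zero, smul_zero]
      · simp
    rw [gradProd_cons, (tot_isSuperDer X).apply_mul (grad_parity a), mul_add, h2, mul_smul_comm,
      ← mul_assoc, h1, List.map_cons, List.sum_cons, add_mul, smul_add, neg_add, smul_neg,
      smul_smul, ← pow_add, List.append_assoc, List.singleton_append]
    congr 3
    refine neg_one_pow_congr ⟨X.card + L'.length * X.card, ?_⟩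
    simp
    ring

/-- The list of all labels `ξ_1, η_1, …, ξ_n, η_n`. -/
def pairList (L : List (Fin n)) : List (Gen n) := L.flatMap fun i => [toLex (i, 0), toLex (i, 1)]

theorem pairList_cons (i : Fin n) (L : List (Fin n)) :
    pairList (i :: L) = toLex (i, 0) :: toLex (i, 1) :: pairList L := rfl

theorem mem_pairList (L : List (Fin n)) (a : Gen n) : a ∈ pairList L ↔ (ofLex a).1 ∈ L := by
  induction L with
  | nil => simp [pairList]
  | cons i L ih =>
    rw [pairList_cons, List.mem_cons, List.mem_cons, ih, List.mem_cons, ← or_assoc]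
    refine or_congr_left ?_
    obtain ⟨j, b⟩ := a
    constructor
    · rintro (h | h)
      · exact congrArg (fun x => (ofLex x).1) h
      · exact congrArg (fun x => (ofLex x).1) h
    · intro h
      have h' : j = i := h
      subst h'
      fin_cases b
      · exact Or.inl rfl
      · exact Or.inr rfl

theorem pairList_nodup {L : List (Fin n)} (h : L.Nodup) : (pairList L).Nodup := by
  induction L with
  | nil => exact List.nodup_nil
  | cons i L ih =>
    rw [List.nodup_cons] at h
    rw [pairList_cons, List.nodup_cons, List.nodup_cons, List.mem_cons, mem_pairList, mem_pairList]
    refine ⟨?_, h.1, ih h.2⟩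
    rintro (h2 | h2)
    · have : (0 : Fin 2) = 1 := congrArg (fun x => (ofLex x).2) h2
      exact absurd this (by decide)
    · exact h.1 h2

/-- The list of all labels. -/
def allList (n : ℕ) : List (Gen n) := pairList (List.finRange n)

theorem mem_allList (a : Gen n) : a ∈ allList n := by
  rw [allList, mem_pairList]; exact List.mem_finRange _

theorem allList_nodup : (allList n).Nodup := pairList_nodup (List.nodup_finRange n)

/-- The trace of the matrix of second derivatives is again the divergence of `ham X`. -/
theorem tot_gradProd (X : Finset (Gen n)) : tot (monoBasis n X) (gradProd (allList n)) = 0 := by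
  have h := gradProd_mul_tot_gradProd X [] (allList n) allList_nodup mem_allList
  have h2 : ((allList n).map fun a => hamHess X a (conj a)).sum = 0 := by
    rw [← List.sum_toFinset _ allList_nodup]
    have : (allList n).toFinset = Finset.univ := by
      ext a; simp [mem_allList]
    rw [this]
    simp only [hamHess]
    rw [← Finset.smul_sum, ← map_sum, ← sum_conj]
    simp only [conj_conj]
    rw [sum_pdiff_conj_pdiff, map_zero, smul_zero]
  rwa [gradProd_nil, one_mul, h2, zero_mul, smul_zero, neg_zero] at h

/-- The square of the Hessian, contracted with the symplectic form. -/
def hessSq (n : ℕ) : BP n := ∑ a, ∑ c, hess a c * hess (conj a) (conj c)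

/-- Exchange `b` with `c` and conjugate `a`: the Hessian factors swap and commute, while `hamHess`
changes sign, so the sum equals its negative. The contraction is thus invariant under the rotations
involved. -/
theorem sum_hamHess_hess (X : Finset (Gen n)) :
    ∑ a, ∑ c, (∑ b, hamHess X c b * hess a (conj b)) * hess (conj a) (conj c) = 0 := by
  set T := ∑ a, ∑ c, (∑ b, hamHess X c b * hess a (conj b)) * hess (conj a) (conj c) with hT
  have h : T = -T := by
    conv_lhs => rw [hT]
    rw [← sum_conj, hT, ← Finset.sum_neg_distrib]
    refine Finset.sum_congr rfl fun a _ => ?_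
    simp only [Finset.sum_mul, conj_conj]
    rw [Finset.sum_comm, ← Finset.sum_neg_distrib]
    refine Finset.sum_congr rfl fun b _ => ?_
    rw [← Finset.sum_neg_distrib]
    refine Finset.sum_congr rfl fun c _ => ?_
    rw [hamHess_swap, mul_assoc, mul_assoc, hess_comm a, neg_mul]
  have h2 : (2 : ℂ) • T = 0 := by
    rw [two_smul]; nth_rewrite 1 [h]; exact neg_add_cancel _
  exact (smul_eq_zero.1 h2).resolve_left two_ne_zero

theorem sum_hamHess_hess' (X : Finset (Gen n)) :
    ∑ a, ∑ c, (∑ b, hamHess X a b * hess (conj b) c) * hess (conj a) (conj c) = 0 := by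
  rw [Finset.sum_comm, ← sum_hamHess_hess X]
  refine Finset.sum_congr rfl fun a _ => Finset.sum_congr rfl fun c _ => ?_
  rw [hess_swap (conj c), mul_neg, ← neg_mul, ← Finset.sum_neg_distrib]
  congr 1
  refine Finset.sum_congr rfl fun b _ => ?_
  rw [hess_swap (conj b), mul_neg, neg_neg]

/-- The factor `gradProd` annihilates the third-derivative terms, since it contains every gradient
component; the rotation terms cancel by antisymmetry. -/
theorem gradProd_mul_tot_hessSq (X : Finset (Gen n)) :
    gradProd (allList n) * tot (monoBasis n X) (hessSq n) = 0 := by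
  have h1 : tot (monoBasis n X) (hessSq n) =
      (2 : ℂ) • ∑ a, ∑ c, tot (monoBasis n X) (hess a c) * hess (conj a) (conj c) := by
    have h0 : ∑ a, ∑ c, tot (monoBasis n X) (hess a c) * hess (conj a) (conj c) =
        ∑ a, ∑ c, tot (monoBasis n X) (hess (conj a) (conj c)) * hess a c := by
      rw [← sum_conj]
      refine Finset.sum_congr rfl fun a _ => ?_
      rw [← sum_conj]
      simp only [conj_conj]
    rw [two_smul]
    nth_rewrite 2 [h0]
    rw [hessSq, map_sum, ← Finset.sum_add_distrib]
    refine Finset.sum_congr rfl fun a _ => ?_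
    rw [map_sum, ← Finset.sum_add_distrib]
    refine Finset.sum_congr rfl fun c _ => ?_
    rw [(tot_isSuperDer X).apply_mul (hess_parity a c), mul_zero, pow_zero, one_smul,
      hess_comm a c]
  have h2 : ∀ a c, gradProd (allList n) * (tot (monoBasis n X) (hess a c) *
      hess (conj a) (conj c)) = -(gradProd (allList n) *
        ((∑ b, hamHess X c b * hess a (conj b)) * hess (conj a) (conj c))) -
        (gradProd (allList n) *
          ((∑ b, hamHess X a b * hess (conj b) c) * hess (conj a) (conj c))) := by
    intro a c
    have h3 : gradProd (allList n) * ∑ b, vDer a (hamHess X c b) * grad (conj b) = 0 := by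
      rw [Finset.mul_sum]
      exact Finset.sum_eq_zero fun b _ => gradProd_mul_mul_grad (mem_allList _) _
    simp only [← mul_assoc]
    rw [tot_hess, mul_sub, mul_sub, mul_neg, mul_smul_comm, h3, smul_zero, neg_zero, zero_sub,
      sub_mul, neg_mul]
  rw [h1, mul_smul_comm, Finset.mul_sum]
  simp only [Finset.mul_sum, h2, Finset.sum_sub_distrib, Finset.sum_neg_distrib]
  simp only [← Finset.mul_sum, sum_hamHess_hess, sum_hamHess_hess', mul_zero, neg_zero, sub_zero,
    smul_zero]

/-- The invariant obtained from the gradient and the Hessian of the generic element. -/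
def specInv (n : ℕ) : SP n := ber (gradProd (allList n) * hessSq n)

theorem specInv_mem : specInv n ∈ invSub n := by
  refine ber_mem_invSub fun X => ?_
  rw [(tot_isSuperDer X).apply_mul (gradProd_parity _), tot_gradProd, gradProd_mul_tot_hessSq,
    zero_mul, smul_zero, add_zero]

theorem hessSq_parity : HasParity (bPar n) 0 (hessSq n) :=
  HasParity.sum fun a _ => HasParity.sum fun c _ =>
    ((hess_parity a c).mul (hess_parity (conj a) (conj c))).congr ⟨0, rfl⟩

theorem pairList_length (L : List (Fin n)) : Even (pairList L).length := by
  induction L with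
  | nil => exact ⟨0, rfl⟩
  | cons i L ih =>
    rw [pairList_cons, List.length_cons, List.length_cons]
    exact (ih.add_one).add_one

theorem redu_bPar (G : BP n) : redu (bPar n G) = sPar n (redu G) := by
  induction G using sTmul_induction with
  | h0 => simp
  | ha x y hx hy => simp only [map_add, hx, hy]
  | h1 p x => rw [polyPar_sTmul, redu_sTmul, redu_sTmul, polyPar_sTmul, extPar_map]

theorem topDer_bPar (L : List (Fin n)) (G : BP n) :
    topDer L (bPar n G) = bPar n (topDer L G) := by
  induction L generalizing G with
  | nil => rfl
  | cons i L ih =>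
    simp only [topDer, LinearMap.comp_apply, ← ih, bPar_vDer, map_neg, neg_neg]

theorem ber_parity {q : ℕ} {G : BP n} (h : HasParity (bPar n) q G) :
    HasParity (sPar n) q (ber G) := by
  rw [HasParity, ber_apply, ← redu_bPar, ← topDer_bPar, h, map_smul, map_smul]

theorem specInv_parity : HasParity (sPar n) 0 (specInv n) :=
  ber_parity (((gradProd_parity (allList n)).mul hessSq_parity).congr
    (by simpa [allList] using pairList_length (List.finRange n)))

/-! ### Evaluation at points of the Cartan subalgebra -/

/-- The constant term of an element of an exterior algebra. -/
abbrev aug (V : Type*) [AddCommGroup V] [Module ℂ V] : ExteriorAlgebra ℂ V →ₐ[ℂ] ℂ :=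
  ExteriorAlgebra.algebraMapInv

theorem aug_ι {V : Type*} [AddCommGroup V] [Module ℂ V] (v : V) :
    aug V (ExteriorAlgebra.ι ℂ v) = 0 := by
  simp [ExteriorAlgebra.algebraMapInv]

theorem aug_map {V W : Type*} [AddCommGroup V] [Module ℂ V] [AddCommGroup W] [Module ℂ W]
    (g : V →ₗ[ℂ] W) (x : ExteriorAlgebra ℂ V) : aug W (ExteriorAlgebra.map g x) = aug V x := by
  have : (aug W).comp (ExteriorAlgebra.map g) = aug V := by
    refine ExteriorAlgebra.hom_ext ?_
    ext v
    simp [ExteriorAlgebra.algebraMapInv]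
  rw [← this]; rfl

/-- Evaluation of a polynomial at an even point. -/
def evS (v : EvenIdx n → ℂ) : SP n →ₐ[ℂ] ℂ :=
  Algebra.TensorProduct.lift (MvPolynomial.aeval v) (aug (OddIdx n → ℂ))
    (fun _ _ => Commute.all _ _)

theorem evS_sTmul (v : EvenIdx n → ℂ) (p x) :
    evS v (sTmul p x) = MvPolynomial.aeval v p * aug _ x :=
  Algebra.TensorProduct.lift_tmul _ _ _ _ _

/-- Evaluation of the coefficients at an even point. -/
def evP (v : EvenIdx n → ℂ) : BP n →ₐ[ℂ] Po n :=
  Algebra.TensorProduct.lift ((Algebra.ofId ℂ (Po n)).comp (MvPolynomial.aeval v))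
    (ExteriorAlgebra.map (LinearMap.snd ℂ (OddIdx n → ℂ) (Gen n → ℂ)))
    (fun p _ => (Algebra.commutes (A := Po n) (MvPolynomial.aeval v p : ℂ) _ :))

theorem evP_sTmul (v : EvenIdx n → ℂ) (p x) :
    evP v (sTmul p x) = MvPolynomial.aeval v p • ExteriorAlgebra.map (LinearMap.snd ℂ _ _) x :=
  (Algebra.TensorProduct.lift_tmul _ _ _ _ _).trans
    (Algebra.smul_def (A := Po n) (MvPolynomial.aeval v p : ℂ) _).symm

theorem evP_inclP (v : EvenIdx n → ℂ) (g : Po n) : evP v (inclP g) = g := by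
  rw [inclP_eq, evP_sTmul, map_one, one_smul, ← AlgHom.comp_apply, ExteriorAlgebra.map_comp_map,
    LinearMap.snd_comp_inr, ExteriorAlgebra.map_id]
  rfl

theorem evP_incl_tc (v : EvenIdx n → ℂ) (I : Finset (Gen n)) :
    evP v (incl (tc I)) = if h : Even I.card then algebraMap ℂ _ (v ⟨I, h⟩) else 0 := by
  split_ifs with h
  · rw [tc_of_even h, incl_sTmul, evP_sTmul, map_one, map_one, MvPolynomial.aeval_X,
      Algebra.algebraMap_eq_smul_one]
  · rw [tc_of_not_even h, incl_sTmul, evP_sTmul, ExteriorAlgebra.map_apply_ι,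
      ExteriorAlgebra.map_apply_ι]
    simp

theorem evP_vDer (v : EvenIdx n → ℂ) (a : Gen n) (G : BP n) :
    evP v (vDer a G) = pdiff a (evP v G) := by
  induction G using sTmul_induction with
  | h0 => simp
  | ha x y hx hy => simp only [map_add, hx, hy]
  | h1 p x => rw [vDer, oddDer_sTmul, evP_sTmul, evP_sTmul, map_smul, pdiff, contr_map]

theorem evS_redu (v : EvenIdx n → ℂ) (G : BP n) :
    evS v (redu G) = aug _ (evP v G) := by
  induction G using sTmul_induction with
  | h0 => simp
  | ha x y hx hy => simp only [map_add, hx, hy]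
  | h1 p x => rw [redu_sTmul, evP_sTmul, evS_sTmul, map_smul, aug_map, aug_map, smul_eq_mul]

/-- The iterated derivative with respect to all `ξ_i, η_i` for `i` in a list. -/
def topDerP : List (Fin n) → Po n →ₗ[ℂ] Po n
  | [] => LinearMap.id
  | i :: L => topDerP L ∘ₗ pdiff (toLex (i, 1)) ∘ₗ pdiff (toLex (i, 0))

theorem evP_topDer (v : EvenIdx n → ℂ) (L : List (Fin n)) (G : BP n) :
    evP v (topDer L G) = topDerP L (evP v G) := by
  induction L generalizing G with
  | nil => rfl
  | cons i L ih => simp only [topDer, topDerP, LinearMap.comp_apply, ih, evP_vDer]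

/-- The Berezin integral by iterated derivatives. -/
def berP : Po n →ₗ[ℂ] ℂ := (aug (Gen n → ℂ)).toLinearMap ∘ₗ topDerP (List.finRange n)

theorem berP_apply (g : Po n) : berP g = aug _ (topDerP (List.finRange n) g) := rfl

/-- Radial parts of Berezin integrals are thereby computed in the Grassmann algebra over ℂ. -/
theorem evS_ber (v : EvenIdx n → ℂ) (G : BP n) : evS v (ber G) = berP (evP v G) := by
  rw [ber_apply, evS_redu, evP_topDer, berP_apply]

/-- The product `ξ_j η_j`. -/
def uu (j : Fin n) : Po n := gen (toLex (j, 0)) * gen (toLex (j, 1))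

theorem cartanElt_eq (A : Finset (Fin n)) :
    cartanElt A = ((A.sort (· ≤ ·)).map uu).prod := rfl

theorem uu_parity (j : Fin n) : HasParity parityAut 0 (uu j) :=
  ((gen_parity _).mul (gen_parity _)).congr ⟨1, rfl⟩

theorem uprod_parity (L : List (Fin n)) : HasParity parityAut 0 ((L.map uu).prod : Po n) := by
  induction L with
  | nil => exact HasParity.one
  | cons i L ih => exact (uu_parity i).mul ih

theorem even_comm {x : Po n} (hx : HasParity parityAut 0 x) (y : Po n) : x * y = y * x := by
  have := ext_isSuperComm 0 x y hx
  rwa [pow_zero, AlgHom.one_apply] at this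

theorem cartanElt_parity (A : Finset (Fin n)) : HasParity parityAut 0 (cartanElt A) :=
  uprod_parity _

/-- The even coordinates of the Cartan element with given coefficients. -/
def cartanPt (x : Finset (Fin n) → ℂ) (I : EvenIdx n) : ℂ :=
  ∑ A, (monoBasis n).coord I.1 (cartanElt A) * x A

/-- The Cartan element with given coefficients. -/
def cartanVec (x : Finset (Fin n) → ℂ) : Po n := ∑ A, x A • cartanElt A

theorem evP_gf (x : Finset (Fin n) → ℂ) : evP (cartanPt x) (gf n) = cartanVec x := by
  rw [gf, map_sum]
  have h : ∀ I, evP (cartanPt x) (incl (tc I) * inclP (monoBasis n I)) =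
      ∑ A, x A • (monoBasis n).coord I (cartanElt A) • monoBasis n I := by
    intro I
    rw [map_mul, evP_inclP, evP_incl_tc]
    split_ifs with h
    · rw [← Algebra.smul_def, cartanPt, Finset.sum_smul]
      refine Finset.sum_congr rfl fun A _ => ?_
      rw [smul_smul, mul_comm]
    · rw [zero_mul]
      refine (Finset.sum_eq_zero fun A _ => ?_).symm
      rw [coord_eq_zero_of_parity (cartanElt_parity A) (by simpa using h), zero_smul,
        smul_zero]
  simp only [h]
  rw [Finset.sum_comm, cartanVec]
  refine Finset.sum_congr rfl fun A _ => ?_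
  rw [← Finset.smul_sum, sum_coord_smul_mono]

theorem eval_radialPart (x : Finset (Fin n) → ℂ) (P : SPoly n) :
    MvPolynomial.eval x (radialPart n P) = evS (cartanPt x) (toSP P) := by
  induction P using TensorProduct.induction_on with
  | zero => rw [map_zero, map_zero, map_zero, map_zero]
  | add p q hp hq => rw [map_add, map_add, map_add, map_add, hp, hq]
  | tmul p y =>
    refine Eq.trans ?_ (evS_sTmul _ p y).symm
    rw [radialPart, Algebra.TensorProduct.productMap_apply_tmul, map_mul]
    congr 1
    · have : ((MvPolynomial.aeval x : MvPolynomial (Finset (Fin n)) ℂ →ₐ[ℂ] ℂ).comp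
        (MvPolynomial.aeval fun I : EvenIdx n => ∑ J : Finset (Fin n),
          MvPolynomial.C ((monoBasis n).coord I.1 (cartanElt J)) * MvPolynomial.X J)) =
          MvPolynomial.aeval (cartanPt x) := by
        refine MvPolynomial.algHom_ext fun I => ?_
        simp [cartanPt]
      rw [← this]
      rfl
    · exact MvPolynomial.eval_C _

/-! ### Derivatives of Cartan elements -/

theorem pdiff_xi_uu (i j : Fin n) :
    pdiff (toLex (i, 0)) (uu j) = if i = j then gen (toLex (i, 1)) else 0 := by
  rw [uu, pdiff_gen_mul, pdiff_gen]
  by_cases h : i = j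
  · subst h; simp
  · simp [h]

theorem pdiff_eta_uu (i j : Fin n) :
    pdiff (toLex (i, 1)) (uu j) = if i = j then -gen (toLex (i, 0)) else 0 := by
  rw [uu, pdiff_gen_mul, pdiff_gen]
  by_cases h : i = j
  · subst h; simp
  · simp [h]

theorem pdiff_uu_mul (a : Gen n) (j : Fin n) (z : Po n) :
    pdiff a (uu j * z) = pdiff a (uu j) * z + uu j * pdiff a z := by
  rw [(pdiff_isSuperDer a).apply_mul (uu_parity j)]; simp

theorem pdiff_uprod_of_notMem (a : Gen n) {L : List (Fin n)} (h : (ofLex a).1 ∉ L) :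
    pdiff a ((L.map uu).prod) = 0 := by
  induction L with
  | nil => exact pdiff_one a
  | cons j L ih =>
    rw [List.mem_cons, not_or] at h
    rw [List.map_cons, List.prod_cons, pdiff_uu_mul, ih h.2, mul_zero, add_zero]
    obtain ⟨i, b⟩ := a
    have hi : i ≠ j := h.1
    fin_cases b
    · exact (congrArg (· * _) ((pdiff_xi_uu i j).trans (if_neg hi))).trans (zero_mul _)
    · exact (congrArg (· * _) ((pdiff_eta_uu i j).trans (if_neg hi))).trans (zero_mul _)

theorem uprod_erase {L : List (Fin n)} {i : Fin n} (hi : i ∈ L) :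
    ((L.map uu).prod : Po n) = uu i * ((L.erase i).map uu).prod := by
  induction L with
  | nil => simp at hi
  | cons j L ih =>
    by_cases h : j = i
    · subst h; simp
    · have hm := (List.mem_cons.1 hi).resolve_left (fun h' => h h'.symm)
      rw [List.erase_cons_tail (by simpa using h), List.map_cons, List.prod_cons, ih hm,
        List.map_cons, List.prod_cons, ← mul_assoc, ← mul_assoc, even_comm (uu_parity j)]

/-- The cofactor of `ξ_i η_i` in a Cartan element. -/
def cofac (x : Finset (Fin n) → ℂ) (i : Fin n) : Po n :=
  ∑ A with i ∈ A, x A • (((A.sort (· ≤ ·)).erase i).map uu).prod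

theorem cofac_parity (x : Finset (Fin n) → ℂ) (i : Fin n) :
    HasParity parityAut 0 (cofac x i) :=
  HasParity.sum fun _ _ => (uprod_parity _).smul _

theorem aug_gen_mul (a : Gen n) (z : Po n) : aug _ (gen a * z) = 0 := by
  rw [map_mul, gen, aug_ι, zero_mul]

theorem aug_cofac (x : Finset (Fin n) → ℂ) (i : Fin n) : aug _ (cofac x i) = x {i} := by
  rw [cofac, map_sum, Finset.sum_eq_single {i}]
  · simp
  · intro A hA hne
    rw [Finset.mem_filter] at hA
    rw [map_smul]
    have : ((A.sort (· ≤ ·)).erase i) ≠ [] := by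
      intro h
      apply hne
      have hn : (A.sort (· ≤ ·)).Nodup := A.sort_nodup _
      ext j
      rw [Finset.mem_singleton]
      constructor
      · intro hj
        by_contra hji
        have : j ∈ (A.sort (· ≤ ·)).erase i :=
          (List.mem_erase_of_ne hji).2 ((Finset.mem_sort _).2 hj)
        rw [h] at this
        simp at this
      · rintro rfl; exact hA.2
    obtain ⟨j, L, hL⟩ := List.exists_cons_of_ne_nil this
    rw [hL, List.map_cons, List.prod_cons, uu, mul_assoc, aug_gen_mul, smul_zero]
  · simp

/-- A Cartan element has the form c_i ξ_i η_i + (terms free of ξ_i, η_i), with `cofac` as c_i. -/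
theorem pdiff_xi_cartanVec (x : Finset (Fin n) → ℂ) (i : Fin n) :
    pdiff (toLex (i, 0)) (cartanVec x) = cofac x i * gen (toLex (i, 1)) := by
  rw [cartanVec, cofac, map_sum, Finset.sum_filter, Finset.sum_mul]
  refine Finset.sum_congr rfl fun A _ => ?_
  rw [map_smul, cartanElt_eq]
  split_ifs with h
  · rw [uprod_erase ((Finset.mem_sort (· ≤ ·)).2 h), pdiff_uu_mul, pdiff_xi_uu, if_pos rfl,
      pdiff_uprod_of_notMem, mul_zero, add_zero, smul_mul_assoc, even_comm (uprod_parity _)]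
    exact fun h2 => (List.Nodup.mem_erase_iff (A.sort_nodup _)).1 h2 |>.1 rfl
  · rw [pdiff_uprod_of_notMem, smul_zero, zero_mul]
    exact fun h2 => h ((Finset.mem_sort _).1 h2)

theorem pdiff_eta_cartanVec (x : Finset (Fin n) → ℂ) (i : Fin n) :
    pdiff (toLex (i, 1)) (cartanVec x) = -(cofac x i * gen (toLex (i, 0))) := by
  rw [cartanVec, cofac, map_sum, Finset.sum_filter, Finset.sum_mul, ← Finset.sum_neg_distrib]
  refine Finset.sum_congr rfl fun A _ => ?_
  rw [map_smul, cartanElt_eq]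
  split_ifs with h
  · rw [uprod_erase ((Finset.mem_sort (· ≤ ·)).2 h), pdiff_uu_mul, pdiff_eta_uu, if_pos rfl,
      pdiff_uprod_of_notMem, mul_zero, add_zero, smul_mul_assoc, even_comm (uprod_parity _),
      neg_mul, smul_neg]
    exact fun h2 => (List.Nodup.mem_erase_iff (A.sort_nodup _)).1 h2 |>.1 rfl
  · rw [pdiff_uprod_of_notMem, smul_zero, zero_mul, neg_zero]
    exact fun h2 => h ((Finset.mem_sort _).1 h2)

/-! ### The top monomial and the value of `specInv` on Cartan elements. -/

theorem gen_mul_gen (a b : Gen n) : (gen a * gen b : Po n) = -(gen b * gen a) :=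
  eq_neg_of_add_eq_zero_left (ExteriorAlgebra.ι_add_mul_swap _ _)

theorem gen_mul_self (a : Gen n) : (gen a * gen a : Po n) = 0 := ExteriorAlgebra.ι_sq_zero _

theorem gen_mul_uprod {a : Gen n} {L : List (Fin n)} (h : (ofLex a).1 ∈ L) :
    gen a * ((L.map uu).prod : Po n) = 0 := by
  rw [uprod_erase h, uu, ← mul_assoc, ← mul_assoc]
  obtain ⟨i, b⟩ := a
  have : gen (toLex (i, b)) * gen (toLex (i, 0)) * gen (toLex (i, 1)) = 0 := by
    fin_cases b
    · change gen (toLex (i, 0)) * gen (toLex (i, 0)) * gen (toLex (i, 1)) = 0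
      rw [gen_mul_self, zero_mul]
    · change gen (toLex (i, 1)) * gen (toLex (i, 0)) * gen (toLex (i, 1)) = 0
      rw [gen_mul_gen, neg_mul, mul_assoc, gen_mul_self, mul_zero, neg_zero]
  exact (congrArg (· * _) this).trans (zero_mul _)

theorem po_induction {P : Po n → Prop} (h1 : P 1)
    (hs : ∀ (c : ℂ) x, P x → P (c • x)) (ha : ∀ x y, P x → P y → P (x + y))
    (hm : ∀ a x, P x → P (gen a * x)) (x) : P x := by
  refine ext_left_induction h1 hs ha (fun v x hx => ?_) x
  have h0 : P 0 := by simpa using hs 0 1 h1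
  have : ExteriorAlgebra.ι ℂ v * x = ∑ a, v a • (gen a * x) := by
    have hv : v = ∑ a, v a • (Pi.single a 1 : Gen n → ℂ) := by
      ext b; simp [Finset.sum_apply, Pi.single_apply]
    conv_lhs => rw [hv]
    simp only [map_sum, map_smul, Finset.sum_mul, smul_mul_assoc]
    rfl
  rw [this]
  exact Finset.sum_induction _ P ha h0 fun a _ => hs _ _ (hm a x hx)

/-- The top monomial. -/
def vol (n : ℕ) : Po n := ((List.finRange n).map uu).prod

/-- Every generator already occurs in the top monomial, so only the constant term of `z` survives.
-/
theorem mul_vol (z : Po n) : z * vol n = aug _ z • vol n := by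
  induction z using po_induction with
  | h1 => simp
  | hs c x hx => rw [smul_mul_assoc, hx, map_smul, smul_assoc]
  | ha x y hx hy => rw [add_mul, hx, hy, map_add, add_smul]
  | hm a x hx =>
    rw [mul_assoc, hx, mul_smul_comm, aug_gen_mul, zero_smul, vol,
      gen_mul_uprod (List.mem_finRange _), smul_zero]

theorem topDerP_uprod {L : List (Fin n)} (h : L.Nodup) :
    topDerP L ((L.map uu).prod) = 1 := by
  induction L with
  | nil => rfl
  | cons i L ih =>
    rw [List.nodup_cons] at h
    rw [topDerP, LinearMap.comp_apply, LinearMap.comp_apply, List.map_cons, List.prod_cons,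
      pdiff_uu_mul, pdiff_xi_uu, if_pos rfl, pdiff_uprod_of_notMem _ h.1, mul_zero, add_zero,
      pdiff_gen_mul, if_pos rfl, pdiff_uprod_of_notMem _ h.1, mul_zero, sub_zero, ih h.2]

theorem berP_vol : berP (vol n) = 1 := by
  rw [berP_apply, vol, topDerP_uprod (List.nodup_finRange n), map_one]

/-- Each conjugate pair contributes (c_i η_i)(−c_i ξ_i) = c_i² ξ_i η_i, where c_i is the even
cofactor. -/
theorem gradient_prod (x : Finset (Fin n) → ℂ) (L : List (Fin n)) :
    (((pairList L).map fun a => pdiff a (cartanVec x)).prod : Po n) =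
      (L.map fun i => cofac x i ^ 2).prod * (L.map uu).prod := by
  induction L with
  | nil => simp [pairList]
  | cons i L ih =>
    rw [pairList_cons, List.map_cons, List.map_cons, List.prod_cons, List.prod_cons, ih,
      pdiff_xi_cartanVec, pdiff_eta_cartanVec, ← mul_assoc, List.map_cons, List.map_cons,
      List.prod_cons, List.prod_cons]
    have h1 : cofac x i * gen (toLex (i, 1)) * -(cofac x i * gen (toLex (i, 0))) =
        cofac x i ^ 2 * uu i := by
      have h2 : gen (toLex (i, 1)) * (cofac x i * gen (toLex (i, 0))) =
          cofac x i * (gen (toLex (i, 1)) * gen (toLex (i, 0))) := by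
        rw [← mul_assoc, ← even_comm (cofac_parity x i), mul_assoc]
      rw [mul_neg, mul_assoc, h2, gen_mul_gen, uu, mul_neg, mul_neg, neg_neg, pow_two, mul_assoc]
    rw [h1, mul_assoc, mul_assoc]
    congr 1
    rw [← mul_assoc, even_comm (uu_parity i), mul_assoc]

theorem aug_pdiff_mul_gen {z : Po n} (hz : HasParity parityAut 0 z) (a b : Gen n) :
    aug _ (pdiff a (z * gen b)) = if a = b then aug _ z else 0 := by
  rw [even_comm hz, pdiff_gen_mul, map_sub, aug_gen_mul, sub_zero]
  split_ifs
  · rfl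
  · exact map_zero _

/-- Only ∂_η ∂_ξ and ∂_ξ ∂_η for the same i have a constant term, namely x_i and −x_i; each i thus
contributes −x_i² twice. -/
theorem aug_hessian (x : Finset (Fin n) → ℂ) :
    aug _ (∑ a, ∑ c, pdiff a (pdiff c (cartanVec x)) *
      pdiff (conj a) (pdiff (conj c) (cartanVec x))) = -2 * ∑ i, x {i} ^ 2 := by
  have h0 : ∀ (a : Gen n) (i : Fin n), aug _ (pdiff a (pdiff (toLex (i, 0)) (cartanVec x))) =
      if a = toLex (i, 1) then x {i} else 0 := fun a i => by
    rw [pdiff_xi_cartanVec, aug_pdiff_mul_gen (cofac_parity x i), aug_cofac]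
  have h1 : ∀ (a : Gen n) (i : Fin n), aug _ (pdiff a (pdiff (toLex (i, 1)) (cartanVec x))) =
      if a = toLex (i, 0) then -x {i} else 0 := fun a i => by
    rw [pdiff_eta_cartanVec, map_neg, map_neg, aug_pdiff_mul_gen (cofac_parity x i), aug_cofac]
    split_ifs <;> simp
  rw [map_sum]
  simp only [map_sum, map_mul]
  rw [Finset.sum_comm, sum_gen, Finset.mul_sum]
  refine Finset.sum_congr rfl fun i _ => ?_
  simp only [conj_xi, conj_eta, h0, h1]
  have e0 : ∀ a : Gen n, conj a = toLex (i, 0) ↔ a = toLex (i, 1) := fun a =>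
    ⟨fun h => by rw [← conj_conj a, h, conj_xi], fun h => by rw [h, conj_eta]⟩
  have e1 : ∀ a : Gen n, conj a = toLex (i, 1) ↔ a = toLex (i, 0) := fun a =>
    ⟨fun h => by rw [← conj_conj a, h, conj_eta], fun h => by rw [h, conj_xi]⟩
  simp only [e0, e1, ite_mul, zero_mul, Finset.sum_ite_eq', Finset.mem_univ, if_true]
  ring

/-- The gradient product already contains the top monomial, so the cofactors and the Hessian enter
only through their constant terms. -/
theorem evS_specInv (x : Finset (Fin n) → ℂ) :
    evS (cartanPt x) (specInv n) = (∏ i, x {i} ^ 2) * (-2 * ∑ i, x {i} ^ 2) := by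
  have hg : evP (cartanPt x) (gradProd (allList n)) =
      ((List.finRange n).map fun i => cofac x i ^ 2).prod * vol n := by
    rw [vol, ← gradient_prod, gradProd, map_list_prod, List.map_map]
    congr 1
    refine List.map_congr_left fun a _ => ?_
    rw [Function.comp_apply, grad, evP_vDer, evP_gf]
  have hh : evP (cartanPt x) (hessSq n) = ∑ a, ∑ c, pdiff a (pdiff c (cartanVec x)) *
      pdiff (conj a) (pdiff (conj c) (cartanVec x)) := by
    rw [hessSq, map_sum]
    simp only [map_sum, map_mul, hess, evP_vDer, evP_gf]
  rw [specInv, evS_ber, map_mul, hg, hh, even_comm, ← mul_assoc, mul_vol, map_smul, berP_vol,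
    map_mul, aug_hessian, map_list_prod, List.map_map, smul_eq_mul, mul_one, mul_comm]
  · congr 1
    rw [← List.ofFn_eq_map, List.prod_ofFn]
    refine Finset.prod_congr rfl fun i _ => ?_
    rw [Function.comp_apply, map_pow, aug_cofac]
  · have h1 : ∀ L : List (Fin n), HasParity parityAut 0
        ((L.map fun i => cofac x i ^ 2).prod : Po n) := by
      intro L
      induction L with
      | nil => exact HasParity.one
      | cons i L ih =>
        rw [List.map_cons, List.prod_cons, pow_two]
        exact ((cofac_parity x i).mul (cofac_parity x i)).mul ih
    exact (h1 _).mul (uprod_parity _)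

/-! ### The separation of the special invariant from the algebra of the `r_k` -/

/-- The Cartan coefficients supported on singletons. -/
def singles (c : Fin n → ℂ) (A : Finset (Fin n)) : ℂ := ∑ i, if A = {i} then c i else 0

theorem singles_singleton (c : Fin n → ℂ) (i : Fin n) : singles c {i} = c i := by
  simp [singles, Finset.singleton_inj]

theorem cartanVec_singles (c : Fin n → ℂ) : cartanVec (singles c) = ∑ i, c i • uu i := by
  simp only [cartanVec, singles, Finset.sum_smul, ite_smul, zero_smul]
  rw [Finset.sum_comm]
  refine Finset.sum_congr rfl fun i _ => ?_
  rw [Finset.sum_ite_eq' Finset.univ ({i} : Finset (Fin n)), if_pos (Finset.mem_univ _),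
    cartanElt_eq]
  simp

/-- The scaling of the generators `ξ_i`. -/
def scaleXi (c : Fin n → ℂ) : (Gen n → ℂ) →ₗ[ℂ] (Gen n → ℂ) :=
  LinearMap.pi fun a => (if (ofLex a).2 = 0 then c (ofLex a).1 else 1) • LinearMap.proj a

theorem map_scaleXi_gen (c : Fin n → ℂ) (a : Gen n) :
    ExteriorAlgebra.map (scaleXi c) (gen a) =
      (if (ofLex a).2 = 0 then c (ofLex a).1 else 1) • gen a := by
  rw [gen, ExteriorAlgebra.map_apply_ι, ← map_smul]
  congr 1
  ext b
  by_cases h : b = a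
  · subst h
    simp only [scaleXi, LinearMap.pi_apply, LinearMap.smul_apply, LinearMap.proj_apply,
      Pi.smul_apply]
  · simp only [scaleXi, LinearMap.pi_apply, LinearMap.smul_apply, LinearMap.proj_apply,
      Pi.smul_apply, Pi.single_eq_of_ne h, smul_zero]

theorem map_scaleXi_uu (c : Fin n → ℂ) (i : Fin n) :
    ExteriorAlgebra.map (scaleXi c) (uu i) = c i • uu i := by
  rw [uu, map_mul, map_scaleXi_gen, map_scaleXi_gen]
  simp

theorem pdiff_map_scaleXi (c : Fin n → ℂ) (a : Gen n) (x : Po n) :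
    pdiff a (ExteriorAlgebra.map (scaleXi c) x) =
      (if (ofLex a).2 = 0 then c (ofLex a).1 else 1) •
        ExteriorAlgebra.map (scaleXi c) (pdiff a x) := by
  rw [pdiff, contr_map]
  have : LinearMap.proj a ∘ₗ scaleXi c =
      (if (ofLex a).2 = 0 then c (ofLex a).1 else 1) • LinearMap.proj a := by
    ext; simp [scaleXi]
  rw [this, contr, map_smul, LinearMap.smul_apply, map_smul]

theorem topDerP_map_scaleXi (c : Fin n → ℂ) (L : List (Fin n)) (x : Po n) :
    topDerP L (ExteriorAlgebra.map (scaleXi c) x) =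
      (L.map c).prod • ExteriorAlgebra.map (scaleXi c) (topDerP L x) := by
  induction L generalizing x with
  | nil => simp [topDerP]
  | cons i L ih =>
    simp only [topDerP, LinearMap.comp_apply, pdiff_map_scaleXi, map_smul, ih, smul_smul]
    simp

theorem berP_map_scaleXi (c : Fin n → ℂ) (x : Po n) :
    berP (ExteriorAlgebra.map (scaleXi c) x) = (∏ i, c i) * berP x := by
  rw [berP_apply, topDerP_map_scaleXi, map_smul, aug_map, berP_apply, smul_eq_mul,
    ← List.ofFn_eq_map, List.prod_ofFn]

/-- The substitution ξ_i ↦ c_i ξ_i is an algebra map taking ∑ ξ_i η_i to ∑ c_i ξ_i η_i, and it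
multiplies the Berezin integral by ∏ c_i. -/
theorem evS_rInv_singles (c : Fin n → ℂ) (k : ℕ) :
    evS (cartanPt (singles c)) (ber (gf n ^ k)) =
      (∏ i, c i) * evS (cartanPt (singles 1)) (ber (gf n ^ k)) := by
  rw [evS_ber, evS_ber, map_pow (evP _), map_pow (evP _), evP_gf, evP_gf, cartanVec_singles,
    cartanVec_singles, ← berP_map_scaleXi, map_pow (ExteriorAlgebra.map _)]
  congr 2
  simp only [map_sum, map_scaleXi_uu, Pi.one_apply, one_smul]

/-- Two points ∑ c_i ξ_i η_i with equal ∏ c_i are indistinguishable for the r_k, while ∑ c_i²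
separates them. -/
theorem specInv_notMem (hn : 2 ≤ n) (P : SPoly n) (s : ℂ) (hs : s ≠ 0)
    (hP : toSP P = s • specInv n) : P ∉ rAlgebra n := by
  obtain ⟨m, rfl⟩ := Nat.exists_eq_add_of_le' hn
  -- The point (2, 1/2, 1, …, 1) has product 1, like (1, …, 1), but its sum of squares is larger by
  -- 9/4.
  set c : Fin (m + 2) → ℂ := Fin.cons 2 (Fin.cons (1 / 2) 1) with hc
  have hprod : ∏ i, c i = 1 := by
    rw [Fin.prod_univ_succ, Fin.prod_univ_succ]; simp [hc]
  intro hmem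
  have key : ∀ Q ∈ rAlgebra (m + 2),
      evS (cartanPt (singles c)) (toSP Q) = evS (cartanPt (singles 1)) (toSP Q) := by
    intro Q hQ
    let f := (evS (cartanPt (singles c))).comp (toSP (n := m + 2)).toAlgHom
    let g := (evS (cartanPt (singles (1 : Fin (m + 2) → ℂ)))).comp (toSP (n := m + 2)).toAlgHom
    have hle : rAlgebra (m + 2) ≤ AlgHom.equalizer f g := by
      refine Algebra.adjoin_le ?_
      rintro _ ⟨k, -, rfl⟩
      change evS _ (toSP (rInv (m + 2) k)) = evS _ (toSP (rInv (m + 2) k))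
      rw [toSP_rInv, evS_rInv_singles, hprod, one_mul]
    exact hle hQ
  have h := key P hmem
  rw [hP, map_smul, map_smul, evS_specInv, evS_specInv] at h
  simp only [singles_singleton, Finset.prod_pow, hprod] at h
  have h2 := mul_left_cancel₀ hs h
  rw [Fin.sum_univ_succ, Fin.sum_univ_succ] at h2
  simp [hc] at h2
  have h3 : (2 : ℂ) ^ 2 + ((2 ^ 2)⁻¹ + m) = m + 2 := by linear_combination h2
  have h4 : (9 / 4 : ℂ) = 0 := by linear_combination h3
  norm_num at h4

theorem rAlgebra_le (n : ℕ) : Subalgebra.toSubmodule (rAlgebra n) ≤ invariants n := by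
  intro P hP
  have hle : rAlgebra n ≤ (invSub n).comap (toSP (n := n)).toAlgHom := by
    refine Algebra.adjoin_le ?_
    rintro _ ⟨k, -, rfl⟩
    change toSP (rInv n k) ∈ invSub n
    rw [toSP_rInv]
    exact rInv_mem k
  exact (mem_invariants_iff P).2 (hle hP)

theorem rAlgebra_lt (hn : 2 ≤ n) : Subalgebra.toSubmodule (rAlgebra n) < invariants n := by
  refine lt_of_le_not_ge (rAlgebra_le n) fun h => ?_
  refine specInv_notMem hn (toSP.symm (specInv n)) 1 one_ne_zero (by simp) (h ?_)
  rw [mem_invariants_iff, AlgEquiv.apply_symm_apply]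
  exact specInv_mem

/-! ### Homogeneous polynomials -/

/-- The space of linear functions. -/
def lin (n : ℕ) : Submodule ℂ (SP n) := Submodule.span ℂ (Set.range tc)

theorem tc_mem_lin (I : Finset (Gen n)) : tc I ∈ lin n := Submodule.subset_span ⟨I, rfl⟩

theorem map_linearFns_pow (d : ℕ) :
    (linearFns n ^ d).map (toSP (n := n)).toAlgHom.toLinearMap = lin n ^ d := by
  rw [Submodule.map_pow, linearFns, Submodule.map_span, lin, ← Set.range_comp]
  rfl

theorem mem_linearFns_pow {d : ℕ} {P : SPoly n} : P ∈ linearFns n ^ d ↔ toSP P ∈ lin n ^ d := by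
  rw [← map_linearFns_pow, Submodule.mem_map]
  constructor
  · exact fun h => ⟨P, h, rfl⟩
  · rintro ⟨Q, hQ, h⟩
    have : Q = P := toSP.injective h
    rwa [← this]

theorem lin_pow_induction {d : ℕ} {p : SP n → Prop} (h0 : p 0)
    (ha : ∀ x y, p x → p y → p (x + y)) (hs : ∀ (c : ℂ) x, p x → p (c • x))
    (hm : ∀ I, ∀ Q ∈ lin n ^ d, p (tc I * Q)) {P : SP n} (hP : P ∈ lin n ^ (d + 1)) : p P := by
  rw [pow_succ', lin] at hP
  refine Submodule.mul_induction_on hP (fun t ht Q hQ => ?_) ha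
  induction ht using Submodule.span_induction with
  | mem t ht => obtain ⟨I, rfl⟩ := ht; exact hm I Q hQ
  | zero => rwa [zero_mul]
  | add x y _ _ hx hy => rw [add_mul]; exact ha _ _ hx hy
  | smul c x _ hx => rw [smul_mul_assoc]; exact hs _ _ hx

theorem mem_lin_pow_zero {P : SP n} (h : P ∈ lin n ^ 0) : ∃ c : ℂ, P = algebraMap ℂ _ c := by
  rw [pow_zero, Submodule.mem_one] at h
  obtain ⟨c, rfl⟩ := h
  exact ⟨c, rfl⟩

theorem sDer_tc_mul (I J : Finset (Gen n)) (Q : SP n) :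
    sDer J (tc I * Q) = (if J = I then Q else 0) +
      (-1 : ℂ) ^ (J.card * I.card) • (tc I * sDer J Q) := by
  rw [(coordDer_isSuperDer _ J).apply_mul (tc_parity I), sDer_tc]
  split_ifs <;> simp

theorem sDer_algebraMap (J : Finset (Gen n)) (c : ℂ) : sDer J (algebraMap ℂ (SP n) c) = 0 := by
  rw [Algebra.algebraMap_eq_smul_one, map_smul, (coordDer_isSuperDer _ J).map_one, smul_zero]

theorem sDer_mem {d : ℕ} {P : SP n} (h : P ∈ lin n ^ (d + 1)) (J : Finset (Gen n)) :
    sDer J P ∈ lin n ^ d := by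
  induction d generalizing P with
  | zero =>
    refine lin_pow_induction (p := fun P => sDer J P ∈ lin n ^ 0) ?_ ?_ ?_ ?_ h
    · rw [map_zero]; exact zero_mem _
    · intro x y hx hy; rw [map_add]; exact add_mem hx hy
    · intro c x hx; rw [map_smul]; exact Submodule.smul_mem _ _ hx
    · intro I Q hQ
      obtain ⟨c, rfl⟩ := mem_lin_pow_zero hQ
      rw [sDer_tc_mul, sDer_algebraMap, mul_zero, smul_zero, add_zero]
      split_ifs
      · exact hQ
      · exact zero_mem _
  | succ d ih =>
    refine lin_pow_induction (p := fun P => sDer J P ∈ lin n ^ (d + 1)) ?_ ?_ ?_ ?_ h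
    · rw [map_zero]; exact zero_mem _
    · intro x y hx hy; rw [map_add]; exact add_mem hx hy
    · intro c x hx; rw [map_smul]; exact Submodule.smul_mem _ _ hx
    · intro I Q hQ
      rw [sDer_tc_mul]
      refine add_mem ?_ (Submodule.smul_mem _ _ ?_)
      · split_ifs
        · exact hQ
        · exact zero_mem _
      · rw [pow_succ']
        exact Submodule.mul_mem_mul (tc_mem_lin I) (ih hQ)

/-- The sign from moving ∂_J past t_I is cancelled by the sign from moving t_J past t_I, so the
super version has the same form as the classical one. -/
theorem euler {d : ℕ} {P : SP n} (h : P ∈ lin n ^ d) :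
    ∑ J, tc J * sDer J P = (d : ℂ) • P := by
  induction d generalizing P with
  | zero =>
    obtain ⟨c, rfl⟩ := mem_lin_pow_zero h
    simp [sDer_algebraMap]
  | succ d ih =>
    refine lin_pow_induction
      (p := fun P => ∑ J, tc J * sDer J P = ((d + 1 : ℕ) : ℂ) • P) ?_ ?_ ?_ ?_ h
    · simp
    · intro x y hx hy
      simp only [map_add, mul_add, Finset.sum_add_distrib, hx, hy, smul_add]
    · intro c x hx
      simp only [map_smul, mul_smul_comm, ← Finset.smul_sum, hx]
      rw [smul_comm]
    · intro I Q hQ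
      have h1 : ∀ J, tc J * sDer J (tc I * Q) =
          (if J = I then tc I * Q else 0) + tc I * (tc J * sDer J Q) := by
        intro J
        rw [sDer_tc_mul, mul_add, mul_smul_comm, ← mul_assoc (tc J) (tc I),
          superPoly_isSuperComm.mul_comm (tc_parity J) (tc_parity I), smul_mul_assoc, smul_smul,
          ← pow_add, (Even.add_self _).neg_one_pow, one_smul, mul_assoc]
        congr 1
        split_ifs with h2
        · rw [h2]
        · rw [mul_zero]
      simp only [h1, Finset.sum_add_distrib, ← Finset.mul_sum, ih hQ]
      rw [Finset.sum_ite_eq' Finset.univ I, if_pos (Finset.mem_univ I), mul_smul_comm,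
        Nat.cast_succ, add_smul, one_smul, add_comm]

/-! ### Degrees of Berezin integrals. -/

theorem sPar_mem {d : ℕ} {P : SP n} (h : P ∈ lin n ^ d) : sPar n P ∈ lin n ^ d := by
  have : (lin n).map (sPar n).toLinearMap ≤ lin n := by
    rw [lin, Submodule.map_span, Submodule.span_le]
    rintro _ ⟨_, ⟨I, rfl⟩, rfl⟩
    rw [AlgHom.toLinearMap_apply, tc_parity I]
    exact Submodule.smul_mem _ _ (tc_mem_lin I)
  have h2 : (lin n ^ d).map (sPar n).toLinearMap ≤ lin n ^ d := by
    rw [Submodule.map_pow]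
    exact pow_le_pow_left' this d
  exact h2 ⟨P, h, rfl⟩

theorem sPar_pow_mem {d : ℕ} {P : SP n} (h : P ∈ lin n ^ d) (k : ℕ) :
    (sPar n ^ k) P ∈ lin n ^ d := by
  induction k with
  | zero => exact h
  | succ k ih => rw [pow_succ', AlgHom.mul_apply]; exact sPar_mem ih

/-- The functions of `ξ, η` whose coefficients are homogeneous of degree `d`. -/
def coeffDeg (n d : ℕ) : Submodule ℂ (BP n) :=
  Submodule.span ℂ {G | ∃ q ∈ lin n ^ d, ∃ I, G = incl q * inclP (monoBasis n I)}

theorem incl_mul_inclP_mem {d : ℕ} {q : SP n} (hq : q ∈ lin n ^ d) (g : Po n) :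
    incl q * inclP g ∈ coeffDeg n d := by
  rw [← sum_coord_smul_mono g, map_sum, Finset.mul_sum]
  refine sum_mem fun I _ => ?_
  rw [map_smul, mul_smul_comm]
  exact Submodule.smul_mem _ _ (Submodule.subset_span ⟨q, hq, I, rfl⟩)

/-- Bringing a coefficient to the left past monomials in ξ, η costs only parity automorphisms, which
preserve its degree. -/
theorem coeffDeg_mul {d e : ℕ} {G H : BP n} (hG : G ∈ coeffDeg n d) (hH : H ∈ coeffDeg n e) :
    G * H ∈ coeffDeg n (d + e) := by
  have : coeffDeg n d * coeffDeg n e ≤ coeffDeg n (d + e) := by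
    rw [coeffDeg, coeffDeg, Submodule.span_mul_span, Submodule.span_le]
    rintro _ ⟨_, ⟨q, hq, I, rfl⟩, _, ⟨r, hr, J, rfl⟩, rfl⟩
    have h1 : incl q * inclP (monoBasis n I) * (incl r * inclP (monoBasis n J)) =
        incl (q * (sPar n ^ I.card) r) * inclP (monoBasis n I * monoBasis n J) := by
      have h2 : ∀ k, (bPar n ^ k) (incl r) = incl ((sPar n ^ k) r) := by
        intro k
        induction k with
        | zero => rfl
        | succ k ih => rw [pow_succ', pow_succ', AlgHom.mul_apply, AlgHom.mul_apply, ih, bPar_incl]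
      rw [mul_assoc, ← mul_assoc (inclP _), superPoly_isSuperComm _ _ _ (mono_parity I).inclP, h2,
        map_mul, map_mul, mul_assoc, mul_assoc]
    change _ * _ ∈ _
    rw [h1]
    refine incl_mul_inclP_mem ?_ _
    rw [pow_add]
    exact Submodule.mul_mem_mul hq (sPar_pow_mem hr _)
  exact this (Submodule.mul_mem_mul hG hH)

theorem vDer_mem_coeffDeg {d : ℕ} {G : BP n} (hG : G ∈ coeffDeg n d) (a : Gen n) :
    vDer a G ∈ coeffDeg n d := by
  rw [coeffDeg] at hG
  induction hG using Submodule.span_induction with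
  | mem G hG =>
    obtain ⟨q, hq, I, rfl⟩ := hG
    rw [vDer_isSuperDer, vDer_incl, zero_mul, zero_add, pow_one, bPar_incl, vDer_inclP]
    exact incl_mul_inclP_mem (sPar_mem hq) _
  | zero => rw [map_zero]; exact zero_mem _
  | add x y _ _ hx hy => rw [map_add]; exact add_mem hx hy
  | smul c x _ hx => rw [map_smul]; exact Submodule.smul_mem _ _ hx

theorem gf_mem : gf n ∈ coeffDeg n 1 :=
  sum_mem fun I _ => Submodule.subset_span ⟨tc I, by rw [pow_one]; exact tc_mem_lin I, I, rfl⟩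

theorem redu_inclP (g : Po n) : redu (inclP g) = algebraMap ℂ _ (aug _ g) := by
  rw [inclP_eq, redu_sTmul, ← AlgHom.comp_apply, ExteriorAlgebra.map_comp_map,
    LinearMap.fst_comp_inr]
  have : (ExteriorAlgebra.map (0 : (Gen n → ℂ) →ₗ[ℂ] (OddIdx n → ℂ))) =
      (Algebra.ofId ℂ _).comp (aug (Gen n → ℂ)) := by
    refine ExteriorAlgebra.hom_ext ?_
    ext v
    simp [ExteriorAlgebra.algebraMapInv]
  rw [this]
  change sTmul 1 (algebraMap ℂ _ (aug _ g)) = _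
  rw [Algebra.algebraMap_eq_smul_one, sTmul_smul, sTmul_one_one, Algebra.algebraMap_eq_smul_one]

theorem topDer_inclP (L : List (Fin n)) (g : Po n) :
    topDer L (inclP g) = inclP (topDerP L g) := by
  induction L generalizing g with
  | nil => rfl
  | cons i L ih => simp only [topDer, topDerP, LinearMap.comp_apply, vDer_inclP, ih]

theorem ber_mem_lin_pow {d : ℕ} {G : BP n} (hG : G ∈ coeffDeg n d) : ber G ∈ lin n ^ d := by
  rw [coeffDeg] at hG
  induction hG using Submodule.span_induction with
  | mem G hG =>
    obtain ⟨q, hq, I, rfl⟩ := hG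
    rw [ber_incl_mul, ber_apply, topDer_inclP, redu_inclP, ← Algebra.commutes, ← Algebra.smul_def]
    exact Submodule.smul_mem _ _ hq
  | zero => rw [map_zero]; exact zero_mem _
  | add x y _ _ hx hy => rw [map_add]; exact add_mem hx hy
  | smul c x _ hx => rw [map_smul]; exact Submodule.smul_mem _ _ hx

theorem one_mem_coeffDeg : (1 : BP n) ∈ coeffDeg n 0 := by
  have := incl_mul_inclP_mem (n := n) (d := 0) (q := 1)
    (by rw [pow_zero]; exact Submodule.one_le.1 le_rfl) 1
  simpa using this

theorem gradProd_mem (L : List (Gen n)) : gradProd L ∈ coeffDeg n L.length := by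
  induction L with
  | nil => exact one_mem_coeffDeg
  | cons a L ih =>
    rw [gradProd_cons, List.length_cons, add_comm]
    exact coeffDeg_mul (vDer_mem_coeffDeg gf_mem a) ih

theorem allList_length : (allList n).length = 2 * n := by
  have : ∀ L : List (Fin n), (pairList L).length = 2 * L.length := by
    intro L
    induction L with
    | nil => rfl
    | cons i L ih => rw [pairList_cons]; simp only [List.length_cons, ih]; ring
  rw [allList, this, List.length_finRange]

/-- There are 2n gradient factors and two Hessian factors, each linear in the t_I; derivatives and
integration in ξ, η do not change this degree. -/
theorem specInv_mem_lin_pow : specInv n ∈ lin n ^ (2 * n + 2) := by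
  refine ber_mem_lin_pow (coeffDeg_mul ?_ ?_)
  · rw [← allList_length]; exact gradProd_mem _
  · refine sum_mem fun a _ => sum_mem fun c _ => ?_
    exact coeffDeg_mul (d := 1) (e := 1)
      (vDer_mem_coeffDeg (vDer_mem_coeffDeg gf_mem _) _)
      (vDer_mem_coeffDeg (vDer_mem_coeffDeg gf_mem _) _)

/-! ### The invariant form and the dual basis -/

theorem integral_mono (I : Finset (Gen n)) :
    integral n (monoBasis n I) = if I = Finset.univ then 1 else 0 := coord_mono _ _

theorem integral_pdiff (a : Gen n) (x : Po n) : integral n (pdiff a x) = 0 := by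
  have : integral n ∘ₗ pdiff a = 0 := by
    refine (monoBasis n).ext fun I => ?_
    rw [LinearMap.comp_apply, LinearMap.zero_apply]
    by_cases h : a ∈ I
    · obtain ⟨u, -, hu⟩ := pdiff_mono_of_mem h
      rw [hu, map_smul, integral_mono, if_neg, smul_zero]
      intro h2
      have : a ∈ I.erase a := by rw [h2]; exact Finset.mem_univ a
      simp at this
    · rw [pdiff_mono_of_notMem h, map_zero]
  exact congrArg (fun f => f x) this

theorem integral_bracket (X g : Po n) : integral n (bracket X g) = 0 := by
  have h : bracket X g = ∑ a, (pdiff (conj a) (pdiff a X) * g -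
      pdiff (conj a) (pdiff a X * g)) := by
    rw [bracket_eq]
    refine Finset.sum_congr rfl fun a _ => ?_
    rw [pdiff_isSuperDer (conj a) (pdiff a X) g, pow_one, parityAut_pdiff]
    noncomm_ring
  rw [h, Finset.sum_sub_distrib, ← Finset.sum_mul, sum_pdiff_conj_pdiff, zero_mul, zero_sub,
    map_neg, map_sum]
  simp only [integral_pdiff, Finset.sum_const_zero, neg_zero]

theorem extPar_sq' : (parityAut (n := n)) ^ 2 = 1 := extPar_sq

theorem bracket_mul (X : Finset (Gen n)) {q : ℕ} {y : Po n} (hy : HasParity parityAut q y)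
    (z : Po n) : bracket (monoBasis n X) (y * z) = bracket (monoBasis n X) y * z +
      (-1 : ℂ) ^ (X.card * q) • (y * bracket (monoBasis n X) z) := by
  have h : IsSuperDer (parityAut (n := n)) X.card
      (∑ a, LinearMap.mulLeft ℂ (pdiff a (parityAut (monoBasis n X))) ∘ₗ pdiff (conj a)) := by
    refine IsSuperDer.sum fun a _ => ?_
    refine ((pdiff_isSuperDer _).mulLeft (r := X.card + 1) ext_isSuperComm ?_).congr extPar_sq' ?_
    · rw [mono_parity X, map_smul]
      exact ((mono_parity X).pdiff a).smul _
    · exact ⟨X.card + 1, by ring⟩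
  have h2 : ∀ w, (∑ a, LinearMap.mulLeft ℂ (pdiff a (parityAut (monoBasis n X))) ∘ₗ
      pdiff (conj a)) w = bracket (monoBasis n X) w := by
    intro w
    rw [bracket_eq, LinearMap.sum_apply]
    rfl
  have h3 := h.apply_mul hy z
  rwa [h2, h2, h2] at h3

/-- The Leibniz rule for the bracket with a product, integrated, has total zero; this is the
ad-invariance of B. -/
theorem integral_bracket_mul (X : Finset (Gen n)) {q : ℕ} {y : Po n}
    (hy : HasParity parityAut q y) (z : Po n) :
    integral n (bracket (monoBasis n X) y * z) =
      -((-1 : ℂ) ^ (X.card * q) * integral n (y * bracket (monoBasis n X) z)) := by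
  have h := integral_bracket (monoBasis n X) (y * z)
  rw [bracket_mul X hy, map_add, map_smul, smul_eq_mul] at h
  exact eq_neg_of_add_eq_zero_left h

theorem integral_mono_mul {I J : Finset (Gen n)} (h : I ≠ J) :
    integral n (monoBasis n Jᶜ * monoBasis n I) = 0 := by
  by_cases hd : Disjoint Jᶜ I
  · obtain ⟨u, -, hu⟩ := mono_mul_of_disjoint hd
    rw [hu, map_smul, integral_mono, if_neg, smul_zero]
    intro h2
    apply h
    ext a
    have h3 : a ∈ Jᶜ ∪ I := by rw [h2]; exact Finset.mem_univ a
    have h4 : a ∈ I → a ∉ Jᶜ := fun h => Finset.disjoint_right.1 hd h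
    simp only [Finset.mem_union, Finset.mem_compl] at h3 h4
    by_cases h5 : a ∈ J
    · exact iff_of_true (h3.resolve_left (not_not.2 h5)) h5
    · exact iff_of_false (fun h6 => h4 h6 h5) h5
  · rw [mono_mul_of_not_disjoint hd, map_zero]

/-- The sign relating a monomial to the dual of the complementary one. -/
def dualSign (J : Finset (Gen n)) : ℂ := integral n (monoBasis n Jᶜ * monoBasis n J)

theorem dualSign_mul_self (J : Finset (Gen n)) : dualSign J * dualSign J = 1 := by
  obtain ⟨u, hu, h⟩ := mono_mul_of_disjoint (s := Jᶜ) (t := J) disjoint_compl_left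
  have hun : Jᶜ ∪ J = Finset.univ := by
    rw [Finset.union_comm]; exact Finset.union_compl J
  rw [dualSign, h, map_smul, hun, integral_mono, if_pos rfl, smul_eq_mul, mul_one, hu]

/-- The basis dual to the monomial basis with respect to the invariant form. -/
def eDual (J : Finset (Gen n)) : Po n := dualSign J • monoBasis n Jᶜ

theorem integral_eDual_mono (I J : Finset (Gen n)) :
    integral n (eDual J * monoBasis n I) = if I = J then 1 else 0 := by
  rw [eDual, smul_mul_assoc, map_smul, smul_eq_mul]
  split_ifs with h
  · rw [h]; exact dualSign_mul_self J
  · rw [integral_mono_mul h, mul_zero]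

theorem integral_eDual_mul (J : Finset (Gen n)) (x : Po n) :
    integral n (eDual J * x) = (monoBasis n).coord J x := by
  have : integral n ∘ₗ LinearMap.mulLeft ℂ (eDual J) = (monoBasis n).coord J := by
    refine (monoBasis n).ext fun I => ?_
    rw [LinearMap.comp_apply, LinearMap.mulLeft_apply, integral_eDual_mono, coord_mono]
  exact congrArg (fun f => f x) this

theorem sum_integral_smul_eDual (x : Po n) :
    ∑ J, integral n (x * monoBasis n J) • eDual J = x := by
  have : (∑ J, (integral n ∘ₗ LinearMap.mulRight ℂ (monoBasis n J)).smulRight (eDual J)) =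
      (LinearMap.id : Po n →ₗ[ℂ] Po n) := by
    refine (monoBasis n).ext fun K => ?_
    simp only [LinearMap.sum_apply, LinearMap.smulRight_apply, LinearMap.comp_apply,
      LinearMap.mulRight_apply, LinearMap.id_apply]
    rw [Finset.sum_eq_single Kᶜ]
    · have h2 : integral n (monoBasis n K * monoBasis n Kᶜ) = dualSign Kᶜ := by
        rw [dualSign, compl_compl]
      rw [h2, eDual, smul_smul, dualSign_mul_self, one_smul, compl_compl]
    · intro J _ hJ
      have h2 := integral_mono_mul (I := J) (J := Kᶜ) hJ
      rw [compl_compl] at h2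
      rw [h2, zero_smul]
    · simp
  have h2 := congrArg (fun f => f x) this
  simpa only [LinearMap.sum_apply, LinearMap.smulRight_apply, LinearMap.comp_apply,
      LinearMap.mulRight_apply, LinearMap.id_apply] using h2

theorem card_compl_add (J : Finset (Gen n)) : Jᶜ.card + J.card = 2 * n := by
  rw [add_comm, Finset.card_add_card_compl, Fintype.card_lex, Fintype.card_prod, Fintype.card_fin,
    Fintype.card_fin, mul_comm]

/-- As 2n is even, a monomial and its complement have the same parity, so B is an even form. -/
theorem eDual_parity (J : Finset (Gen n)) : HasParity parityAut J.card (eDual J) :=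
  ((mono_parity Jᶜ).congr ⟨n, by rw [card_compl_add]; ring⟩).smul _

/-- The coefficients of the coadjoint vector fields. -/
def cadCoef (X J K : Finset (Gen n)) : ℂ := -((-1 : ℂ) ^ (K.card * X.card) * strConst X J K)

theorem cad_mono_eq (X K : Finset (Gen n)) :
    cad (monoBasis n X) K = ∑ J, cadCoef X J K • tc J := by
  rw [cad_mono, ← Finset.sum_neg_distrib]
  simp only [cadCoef, neg_smul]

theorem sDer_cad (X J K : Finset (Gen n)) :
    sDer J (cad (monoBasis n X) K) = cadCoef X J K • (1 : SP n) := by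
  rw [cad_mono_eq, map_sum]
  simp only [map_smul, sDer_tc]
  simp

/-- By invariance of B, the dual basis transforms with the same coefficients as those of the
coadjoint fields. This makes symmetrization equivariant. -/
theorem bracket_eDual (X K : Finset (Gen n)) :
    bracket (monoBasis n X) (eDual K) = ∑ J, cadCoef X J K • eDual J := by
  rw [← sum_integral_smul_eDual (bracket (monoBasis n X) (eDual K))]
  refine Finset.sum_congr rfl fun J _ => ?_
  rw [integral_bracket_mul X (eDual_parity K), integral_eDual_mul, cadCoef, strConst,
    mul_comm X.card]

/-- The derivatives and the coadjoint vector fields. -/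
theorem sDer_vf (X J : Finset (Gen n)) (P : SP n) :
    sDer J (vf (monoBasis n X) P) =
      (-1 : ℂ) ^ (X.card * J.card) • vf (monoBasis n X) (sDer J P) +
        ∑ K, cadCoef X J K • sDer K P := by
  rw [vf_apply, vf_apply, map_sum, Finset.smul_sum, ← Finset.sum_add_distrib]
  refine Finset.sum_congr rfl fun K _ => ?_
  have h1 : sDer J (sDer K P) = (-1 : ℂ) ^ (J.card * K.card) • sDer K (sDer J P) :=
    coordDer_comm _ J K P
  rw [(coordDer_isSuperDer _ J).apply_mul (cad_mono_parity X K), sDer_cad, smul_mul_assoc, one_mul,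
    h1, mul_smul_comm, smul_smul, ← pow_add, add_comm]
  congr 2
  refine neg_one_pow_congr ⟨J.card * K.card + J.card * X.card, by ring⟩

/-! ### Symmetrization -/

theorem evS_tc (I : Finset (Gen n)) : evS 0 (tc I) = 0 := by
  by_cases h : Even I.card
  · rw [tc_of_even h, evS_sTmul]; simp
  · rw [tc_of_not_even h, evS_sTmul, aug_ι, mul_zero]

theorem evS_cad (X J : Finset (Gen n)) : evS 0 (cad (monoBasis n X) J) = 0 := by
  rw [cad_mono_eq, map_sum]
  exact Finset.sum_eq_zero fun I _ => by rw [map_smul, evS_tc, smul_zero]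

theorem evS_vf (X : Finset (Gen n)) (P : SP n) : evS 0 (vf (monoBasis n X) P) = 0 := by
  rw [vf_apply, map_sum]
  exact Finset.sum_eq_zero fun J _ => by rw [map_mul, evS_cad, zero_mul]

theorem evS_sPar (v : EvenIdx n → ℂ) (P : SP n) : evS v (sPar n P) = evS v P := by
  induction P using sTmul_induction with
  | h0 => simp
  | ha x y hx hy => simp only [map_add, hx, hy]
  | h1 p x =>
    rw [polyPar_sTmul, evS_sTmul, evS_sTmul]
    congr 1
    have : (aug (OddIdx n → ℂ)).comp (extPar _) = aug _ := by
      refine ExteriorAlgebra.hom_ext ?_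
      ext v
      simp [ExteriorAlgebra.algebraMapInv]
    exact congrArg (fun f => f x) this

theorem evS_sPar_pow (v : EvenIdx n → ℂ) (k : ℕ) (P : SP n) :
    evS v ((sPar n ^ k) P) = evS v P := by
  induction k with
  | zero => rfl
  | succ k ih => rw [pow_succ', AlgHom.mul_apply, evS_sPar, ih]

/-- The symmetrization of the component of degree `d` of a polynomial. -/
def symm : ℕ → SP n →ₗ[ℂ] TensorAlgebra ℂ (Po n)
  | 0 => Algebra.linearMap ℂ _ ∘ₗ (evS 0).toLinearMap
  | d + 1 => ((d + 1 : ℕ) : ℂ)⁻¹ •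
      ∑ J, LinearMap.mulLeft ℂ (TensorAlgebra.ι ℂ (eDual J)) ∘ₗ symm d ∘ₗ sDer J

theorem symm_zero (P : SP n) : symm 0 P = algebraMap ℂ _ (evS 0 P) := rfl

theorem symm_succ (d : ℕ) (P : SP n) : symm (d + 1) P =
    ((d + 1 : ℕ) : ℂ)⁻¹ • ∑ J, TensorAlgebra.ι ℂ (eDual J) * symm d (sDer J P) := by
  rw [symm, LinearMap.smul_apply, LinearMap.sum_apply]
  rfl

theorem symm_mem (d : ℕ) (P : SP n) :
    symm d P ∈ LinearMap.range (TensorAlgebra.ι ℂ (M := Po n)) ^ d := by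
  induction d generalizing P with
  | zero => rw [pow_zero, symm_zero]; exact Submodule.algebraMap_mem _
  | succ d ih =>
    rw [symm_succ, pow_succ']
    exact Submodule.smul_mem _ _ (sum_mem fun J _ =>
      Submodule.mul_mem_mul (LinearMap.mem_range_self _ _) (ih _))

/-- The identification of `po(0|2n)` with the linear functions on it. -/
def flatS (n : ℕ) : Po n →ₗ[ℂ] SP n := (toSP (n := n)).toLinearMap ∘ₗ flat n

theorem flatS_eDual (J : Finset (Gen n)) : flatS n (eDual J) = tc J := by
  rw [flatS, LinearMap.comp_apply, flat, LinearMap.sum_apply, map_sum]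
  rw [Finset.sum_eq_single J]
  · change toSP (integral n (eDual J * monoBasis n J) • coordFn J) = tc J
    rw [integral_eDual_mono, if_pos rfl, map_smul, one_smul, tc]
  · intro I _ hI
    change toSP (integral n (eDual J * monoBasis n I) • coordFn I) = 0
    rw [integral_eDual_mono, if_neg hI, map_smul, zero_smul]
  · simp

theorem toSP_lift_flat (t : TensorAlgebra ℂ (Po n)) :
    toSP (TensorAlgebra.lift ℂ (flat n) t) = TensorAlgebra.lift ℂ (flatS n) t := by
  have : (toSP (n := n)).toAlgHom.comp (TensorAlgebra.lift ℂ (flat n)) =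
      TensorAlgebra.lift ℂ (flatS n) := by
    refine TensorAlgebra.hom_ext (LinearMap.ext fun x => ?_)
    refine (congrArg toSP (TensorAlgebra.lift_ι_apply (flat n) x)).trans ?_
    exact (TensorAlgebra.lift_ι_apply (flatS n) x).symm
  exact congrArg (fun f => f t) this

/-- After projection to the polynomials, each recursive step of `symm` is Euler's formula divided by
the degree. -/
theorem lift_flatS_symm {d : ℕ} {P : SP n} (h : P ∈ lin n ^ d) :
    TensorAlgebra.lift ℂ (flatS n) (symm d P) = P := by
  induction d generalizing P with
  | zero =>
    obtain ⟨c, rfl⟩ := mem_lin_pow_zero h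
    rw [symm_zero, AlgHom.commutes, AlgHom.commutes]
    rfl
  | succ d ih =>
    have hd : ((d + 1 : ℕ) : ℂ) ≠ 0 := Nat.cast_ne_zero.2 (Nat.succ_ne_zero d)
    rw [symm_succ, map_smul, map_sum]
    simp only [map_mul, TensorAlgebra.lift_ι_apply, flatS_eDual, ih (sDer_mem h _)]
    rw [euler h, smul_smul, inv_mul_cancel₀ hd, one_smul]

/-! ### Central elements of the enveloping superalgebra. -/

theorem neg_one_pow_mod (a b : ℕ) : (-1 : ℂ) ^ ((a : ZMod 2).val * (b : ZMod 2).val) =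
    (-1) ^ (a * b) := by
  refine neg_one_pow_congr ?_
  rw [ZMod.val_natCast, ZMod.val_natCast, Nat.even_add, Nat.even_mul, Nat.even_mul,
    Nat.even_iff, Nat.even_iff, Nat.even_iff, Nat.even_iff, Nat.mod_mod, Nat.mod_mod]

theorem envIncl_apply (x : Po n) : envIncl n x = toEnv n (TensorAlgebra.ι ℂ x) := rfl

theorem envIncl_mono_mul (X J : Finset (Gen n)) :
    envIncl n (monoBasis n X) * envIncl n (monoBasis n J) =
      envIncl n (bracket (monoBasis n X) (monoBasis n J)) +
        (-1 : ℂ) ^ (X.card * J.card) •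
          (envIncl n (monoBasis n J) * envIncl n (monoBasis n X)) := by
  have h := RingQuot.mkAlgHom_rel ℂ (EnvRel.supercomm _ _ _ _ (mono_mem_parityPart X)
    (mono_mem_parityPart J))
  rw [map_sub, map_smul, map_mul, map_mul, neg_one_pow_mod] at h
  exact sub_eq_iff_eq_add.1 h

theorem envIncl_mul_eDual (X J : Finset (Gen n)) :
    envIncl n (monoBasis n X) * envIncl n (eDual J) =
      envIncl n (bracket (monoBasis n X) (eDual J)) +
        (-1 : ℂ) ^ (X.card * J.card) • (envIncl n (eDual J) * envIncl n (monoBasis n X)) := by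
  rw [eDual, map_smul, mul_smul_comm, envIncl_mono_mul, bracket_smul_right, map_smul, smul_add,
    smul_mul_assoc, smul_comm (dualSign J)]
  congr 2
  refine neg_one_pow_congr ⟨X.card * n, ?_⟩
  rw [← mul_add, card_compl_add]; ring

theorem toEnv_symm_succ (d : ℕ) (P : SP n) : toEnv n (symm (d + 1) P) =
    ((d + 1 : ℕ) : ℂ)⁻¹ • ∑ J, envIncl n (eDual J) * toEnv n (symm d (sDer J P)) := by
  rw [symm_succ, map_smul, map_sum]
  simp only [map_mul, envIncl_apply]

theorem sPar_pow_sDer (k : ℕ) (J : Finset (Gen n)) (P : SP n) :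
    (sPar n ^ k) (sDer J P) = (-1 : ℂ) ^ (k * J.card) • sDer J ((sPar n ^ k) P) := by
  induction k with
  | zero => simp
  | succ k ih =>
    rw [pow_succ', AlgHom.mul_apply, AlgHom.mul_apply, ih, map_smul, polyPar_coordDer, smul_smul,
      ← pow_add]
    congr 2
    ring

/-- Symmetrization intertwines the coadjoint action with the adjoint action on the enveloping
superalgebra. -/
theorem envIncl_mul_toEnv_symm (X : Finset (Gen n)) (d : ℕ) (P : SP n) :
    envIncl n (monoBasis n X) * toEnv n (symm d P) =
      toEnv n (symm d (vf (monoBasis n X) P)) +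
        toEnv n (symm d ((sPar n ^ X.card) P)) * envIncl n (monoBasis n X) := by
  induction d generalizing P with
  | zero =>
    rw [symm_zero, symm_zero, symm_zero, evS_vf, evS_sPar_pow, map_zero, map_zero, zero_add,
      AlgHom.commutes, Algebra.commutes]
  | succ d ih =>
    rw [toEnv_symm_succ, toEnv_symm_succ, toEnv_symm_succ, mul_smul_comm, smul_mul_assoc,
      ← smul_add]
    congr 1
    have h1 : ∀ J, envIncl n (monoBasis n X) *
        (envIncl n (eDual J) * toEnv n (symm d (sDer J P))) =
        ∑ K, cadCoef X K J • (envIncl n (eDual K) * toEnv n (symm d (sDer J P))) +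
        ((-1 : ℂ) ^ (X.card * J.card) • (envIncl n (eDual J) *
          toEnv n (symm d (vf (monoBasis n X) (sDer J P)))) +
        envIncl n (eDual J) * toEnv n (symm d (sDer J ((sPar n ^ X.card) P))) *
          envIncl n (monoBasis n X)) := by
      intro J
      rw [← mul_assoc, envIncl_mul_eDual, add_mul, bracket_eDual, map_sum, Finset.sum_mul,
        smul_mul_assoc, mul_assoc (envIncl n (eDual J)), ih, sPar_pow_sDer, mul_add, smul_add]
      congr 2
      · simp only [map_smul, smul_mul_assoc]
      · simp only [map_smul, smul_mul_assoc, mul_smul_comm]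
        rw [smul_smul, ← pow_add, (Even.add_self _).neg_one_pow, one_smul, mul_assoc]
    have h2 : ∀ J, envIncl n (eDual J) * toEnv n (symm d (sDer J (vf (monoBasis n X) P))) =
        (-1 : ℂ) ^ (X.card * J.card) • (envIncl n (eDual J) *
          toEnv n (symm d (vf (monoBasis n X) (sDer J P)))) +
        ∑ K, cadCoef X J K • (envIncl n (eDual J) * toEnv n (symm d (sDer K P))) := by
      intro J
      rw [sDer_vf, map_add, map_add, mul_add, map_smul, map_smul, mul_smul_comm, map_sum, map_sum,
        Finset.mul_sum]
      congr 1
      refine Finset.sum_congr rfl fun K _ => ?_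
      rw [map_smul, map_smul, mul_smul_comm]
    rw [Finset.mul_sum, Finset.sum_mul]
    simp only [h1, h2, Finset.sum_add_distrib]
    -- One `cadCoef` sum comes from bracketing X with the dual basis, the other from commuting the
    -- field past ∂_J. Exchanging J and K makes them identical.
    rw [Finset.sum_comm (f := fun J K => cadCoef X K J •
      (envIncl n (eDual K) * toEnv n (symm d (sDer J P))))]
    abel

/-- For an invariant the intertwining relation loses its middle term, and evenness removes the
parity twist. Commuting with the generators is then enough. -/
theorem toEnv_symm_commute {d : ℕ} {P : SP n} (hP : P ∈ invSub n) (h0 : HasParity (sPar n) 0 P)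
    (u : UEnv n) : toEnv n (symm d P) * u = u * toEnv n (symm d P) := by
  have h1 : ∀ x : Po n, envIncl n x * toEnv n (symm d P) = toEnv n (symm d P) * envIncl n x := by
    intro x
    rw [← sum_coord_smul_mono x, map_sum, Finset.sum_mul, Finset.mul_sum]
    refine Finset.sum_congr rfl fun X _ => ?_
    rw [map_smul, smul_mul_assoc, mul_smul_comm, envIncl_mul_toEnv_symm, hP X, map_zero, map_zero,
      zero_add, h0.pow_apply, mul_zero, pow_zero, one_smul]
  obtain ⟨t, rfl⟩ := RingQuot.mkAlgHom_surjective ℂ (EnvRel n) u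
  change _ * toEnv n t = toEnv n t * _
  induction t using TensorAlgebra.induction with
  | algebraMap r => rw [AlgHom.commutes, Algebra.commutes]
  | ι x => exact (h1 x).symm
  | mul a b ha hb => rw [map_mul, ← mul_assoc, ha, mul_assoc, hb, mul_assoc]
  | add a b ha hb => rw [map_add, mul_add, add_mul, ha, hb]

/-- Elements of the enveloping superalgebra of a given parity. -/
def envPar (n q : ℕ) : Submodule ℂ (UEnv n) :=
  Submodule.span ℂ {u | ∃ l : List (Finset (Gen n)), Even ((l.map Finset.card).sum + q) ∧
    u = (l.map fun I => envIncl n (monoBasis n I)).prod}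

theorem envPar_zero : envPar n 0 = envEven n := rfl

theorem mono_mul_mem_envPar {q : ℕ} {u : UEnv n} (hu : u ∈ envPar n q) (I : Finset (Gen n)) :
    envIncl n (monoBasis n I) * u ∈ envPar n (q + I.card) := by
  rw [envPar] at hu
  induction hu using Submodule.span_induction with
  | mem u hu =>
    obtain ⟨l, hl, rfl⟩ := hu
    refine Submodule.subset_span ⟨I :: l, ?_, by rw [List.map_cons, List.prod_cons]⟩
    rw [List.map_cons, List.sum_cons]
    obtain ⟨k, hk⟩ := hl
    exact ⟨k + I.card, by omega⟩
  | zero => rw [mul_zero]; exact zero_mem _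
  | add x y _ _ hx hy => rw [mul_add]; exact add_mem hx hy
  | smul c x _ hx => rw [mul_smul_comm]; exact Submodule.smul_mem _ _ hx

theorem envPar_congr {p q : ℕ} (h : Even (p + q)) : envPar n p = envPar n q := by
  rw [envPar, envPar]
  congr 1
  ext u
  refine exists_congr fun l => and_congr_left fun _ => ?_
  rw [Nat.even_add, Nat.even_add, (Nat.even_add.1 h)]

theorem toEnv_symm_mem_envPar (d : ℕ) {q : ℕ} {P : SP n} (h : HasParity (sPar n) q P) :
    toEnv n (symm d P) ∈ envPar n q := by
  induction d generalizing P q with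
  | zero =>
    rw [symm_zero, AlgHom.commutes]
    by_cases hq : Even q
    · rw [Algebra.algebraMap_eq_smul_one]
      exact Submodule.smul_mem _ _ (Submodule.subset_span ⟨[], by simpa using hq, rfl⟩)
    -- An odd polynomial has no constant term.
    · have h1 := evS_sPar 0 P
      rw [h, (Nat.not_even_iff_odd.1 hq).neg_one_pow, neg_one_smul, map_neg] at h1
      have h2 : evS 0 P = 0 := by
        have h3 : (2 : ℂ) * evS 0 P = 0 := by linear_combination -h1
        exact (mul_eq_zero.1 h3).resolve_left two_ne_zero
      rw [h2, map_zero]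
      exact zero_mem _
  | succ d ih =>
    rw [toEnv_symm_succ]
    refine Submodule.smul_mem _ _ (sum_mem fun J _ => ?_)
    have hJ : HasParity (sPar n) (q + J.card) (sDer J P) := by
      rw [HasParity, polyPar_coordDer, h, map_smul, smul_smul, ← pow_add, add_comm]
    rw [eDual, map_smul, smul_mul_assoc]
    refine Submodule.smul_mem _ _ ?_
    have h3 := mono_mul_mem_envPar (ih hJ) Jᶜ
    rwa [envPar_congr (q := q)] at h3
    have := card_compl_add J
    exact ⟨q + n, by omega⟩

/-- The symmetrized tensor itself serves as the leading term, so the lower-order correction is zero.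
-/
theorem exists_casimir {d : ℕ} {P : SPoly n} (hP : P ∈ invariants n)
    (hd : P ∈ linearFns n ^ d) (h0 : HasParity (sPar n) 0 (toSP P)) :
    ∃ z : UEnv n, IsEvenCentral z ∧ IsPrincipalSymbol d z P := by
  refine ⟨toEnv n (symm d (toSP P)), ⟨?_, fun u => ?_⟩, symm d (toSP P), symm_mem d _, 0,
    zero_mem _, (add_zero _).symm, ?_⟩
  · rw [← envPar_zero]
    exact toEnv_symm_mem_envPar d h0
  · exact toEnv_symm_commute ((mem_invariants_iff P).1 hP) h0 u
  · refine toSP.injective ?_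
    rw [toSP_lift_flat]
    exact lift_flatS_symm (mem_linearFns_pow.1 hd)

/-! ### The invariant of degree six -/

theorem exists_special_invariant : ∃ P ∈ invariants 2, P ∈ linearFns 2 ^ 6 ∧
    radialPart 2 P = MvPolynomial.X {0} ^ 2 * MvPolynomial.X {1} ^ 2 *
      (MvPolynomial.X {0} ^ 2 + MvPolynomial.X {1} ^ 2) ∧
    P ∉ rAlgebra 2 ∧ ∃ z : UEnv 2, IsEvenCentral z ∧ IsPrincipalSymbol 6 z P := by
  -- The factor −1/2 removes the constant −2 produced by the Hessian.
  set P : SPoly 2 := toSP.symm ((-1 / 2 : ℂ) • specInv 2) with hPdef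
  have hP : toSP P = (-1 / 2 : ℂ) • specInv 2 := AlgEquiv.apply_symm_apply _ _
  have hinv : P ∈ invariants 2 := by
    rw [mem_invariants_iff, hP, ← mem_invSub]
    exact Subalgebra.smul_mem _ specInv_mem _
  have hdeg : P ∈ linearFns 2 ^ 6 := by
    rw [mem_linearFns_pow, hP]
    exact Submodule.smul_mem _ _ specInv_mem_lin_pow
  have hpar : HasParity (sPar 2) 0 (toSP P) := by
    rw [hP]; exact specInv_parity.smul _
  refine ⟨P, hinv, hdeg, ?_, specInv_notMem le_rfl P _ (by norm_num) hP,
    exists_casimir hinv hdeg hpar⟩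
  refine MvPolynomial.funext fun x => ?_
  rw [eval_radialPart, hP, map_smul, evS_specInv, Fin.prod_univ_two, Fin.sum_univ_two, smul_eq_mul]
  simp only [map_mul, map_pow, map_add, MvPolynomial.eval_X]
  ring

/-! ### Radial parts of derivatives -/

/-- The polynomials on the Cartan subalgebra. -/
abbrev CP (n : ℕ) : Type := MvPolynomial (Finset (Fin n)) ℂ

/-- The restriction of the coordinate `t_I` to the Cartan subalgebra. -/
def radCoord (I : Finset (Gen n)) : CP n :=
  ∑ A, MvPolynomial.C ((monoBasis n).coord I (cartanElt A)) * MvPolynomial.X A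

/-- The restriction of polynomials to the Cartan subalgebra. -/
def rad (n : ℕ) : SP n →ₐ[ℂ] CP n := (radialPart n).comp (toSP (n := n)).symm.toAlgHom

theorem rad_toSP (P : SPoly n) : rad n (toSP P) = radialPart n P := rfl

theorem rad_sTmul (p x) : rad n (sTmul p x) =
    MvPolynomial.aeval (fun I : EvenIdx n => radCoord I.1) p *
      MvPolynomial.C (aug (OddIdx n → ℂ) x) :=
  Algebra.TensorProduct.productMap_apply_tmul _ _ _ _

theorem eval_rad (x : Finset (Fin n) → ℂ) (P : SP n) :
    MvPolynomial.eval x (rad n P) = evS (cartanPt x) P := eval_radialPart x (toSP.symm P)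

theorem coord_cartanElt_of_not_even {I : Finset (Gen n)} (h : ¬Even I.card)
    (A : Finset (Fin n)) : (monoBasis n).coord I (cartanElt A) = 0 :=
  coord_eq_zero_of_parity (cartanElt_parity A) (by simpa using h)

theorem rad_tc (I : Finset (Gen n)) : rad n (tc I) = radCoord I := by
  by_cases h : Even I.card
  · rw [tc_of_even h, rad_sTmul]; simp
  · rw [tc_of_not_even h, rad_sTmul, aug_ι, map_zero, mul_zero, radCoord]
    refine (Finset.sum_eq_zero fun A _ => ?_).symm
    rw [coord_cartanElt_of_not_even h, map_zero, zero_mul]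

/-- The restriction to the Cartan subalgebra of the derivative of `Q` along a vector. -/
def radD (Q : SP n) : Po n →ₗ[ℂ] CP n :=
  ∑ J, ((monoBasis n).coord J).smulRight (rad n (sDer J Q))

theorem radD_apply (Q : SP n) (v : Po n) :
    radD Q v = ∑ J, (monoBasis n).coord J v • rad n (sDer J Q) := by
  rw [radD, LinearMap.sum_apply]; rfl

theorem radD_mono (Q : SP n) (J : Finset (Gen n)) :
    radD Q (monoBasis n J) = rad n (sDer J Q) := by
  rw [radD_apply]
  simp only [coord_mono, ite_smul, one_smul, zero_smul]
  simp

theorem pderiv_aeval_sum {σ τ : Type*} [Fintype σ] (f : σ → MvPolynomial τ ℂ) (i : τ)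
    (p : MvPolynomial σ ℂ) : MvPolynomial.pderiv i (MvPolynomial.aeval f p) =
      ∑ s, MvPolynomial.pderiv i (f s) * MvPolynomial.aeval f (MvPolynomial.pderiv s p) := by
  classical
  induction p using MvPolynomial.induction_on with
  | C a => simp [MvPolynomial.algebraMap_eq]
  | add p q hp hq => simp only [map_add, hp, hq, mul_add, Finset.sum_add_distrib]
  | mul_X p s hp =>
    simp only [map_mul, Derivation.leibniz, MvPolynomial.aeval_X, hp, map_add, smul_eq_mul,
      mul_add, Finset.sum_add_distrib, Finset.mul_sum, MvPolynomial.pderiv_X]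
    congr 1
    · rw [Finset.sum_eq_single s]
      · simp; ring
      · intro t _ ht
        rw [Pi.single_eq_of_ne ht.symm]; simp
      · simp
    · exact Finset.sum_congr rfl fun t _ => by ring

theorem pderiv_radCoord (A : Finset (Fin n)) (I : Finset (Gen n)) :
    MvPolynomial.pderiv A (radCoord I) =
      MvPolynomial.C ((monoBasis n).coord I (cartanElt A)) := by
  rw [radCoord, map_sum, Finset.sum_eq_single A]
  · simp
  · intro B _ hB
    simp [MvPolynomial.pderiv_X_of_ne hB]
  · simp

theorem sDer_sTmul_of_even (I : EvenIdx n) (p x) :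
    sDer I.1 (sTmul p x) = sTmul (MvPolynomial.pderiv I p) x := by
  have : sDer I.1 = evenDer I := dif_pos I.2
  rw [this, evenDer_sTmul]

/-- Along directions tangent to the Cartan subalgebra, differentiation commutes with restriction; by
the chain rule only even coordinates enter, as Cartan elements are even. -/
theorem radD_cartanElt (A : Finset (Fin n)) (Q : SP n) :
    radD Q (cartanElt A) = MvPolynomial.pderiv A (rad n Q) := by
  rw [radD_apply]
  induction Q using sTmul_induction with
  | h0 => simp
  | ha x y hx hy => simp only [map_add, smul_add, Finset.sum_add_distrib, hx, hy]
  | h1 p x =>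
    rw [rad_sTmul, Derivation.leibniz, MvPolynomial.pderiv_C, smul_zero, zero_add, smul_eq_mul,
      pderiv_aeval_sum, Finset.mul_sum]
    rw [← Finset.sum_subset (Finset.subset_univ {I : Finset (Gen n) | Even I.card})]
    · rw [Finset.sum_subtype (p := fun I : Finset (Gen n) => Even I.card) _ (by simp)]
      refine Finset.sum_congr rfl fun I _ => ?_
      rw [sDer_sTmul_of_even, rad_sTmul, pderiv_radCoord, MvPolynomial.smul_eq_C_mul]
      ring
    · intro I _ hI
      rw [coord_cartanElt_of_not_even (by simpa using hI), zero_smul]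

theorem rad_cad (X J : Finset (Gen n)) : rad n (cad (monoBasis n X) J) =
    -((-1 : ℂ) ^ (J.card * X.card) • ∑ A, (monoBasis n).coord J
      (bracket (monoBasis n X) (cartanElt A)) • (MvPolynomial.X A : CP n)) := by
  rw [cad_mono, map_neg, map_sum]
  congr 1
  simp only [map_smul, rad_tc, radCoord, Finset.smul_sum, mul_smul]
  rw [Finset.sum_comm]
  refine Finset.sum_congr rfl fun A _ => ?_
  have h : bracket (monoBasis n X) (cartanElt A) = ∑ I, (monoBasis n).coord I (cartanElt A) •
      bracket (monoBasis n X) (monoBasis n I) := by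
    conv_lhs => rw [← sum_coord_smul_mono (cartanElt A)]
    rw [bracket_sum_right]
    simp only [bracket_smul_right]
  rw [h, map_sum, Finset.sum_smul, Finset.smul_sum]
  refine Finset.sum_congr rfl fun I _ => ?_
  rw [map_smul, strConst, ← MvPolynomial.smul_eq_C_mul, smul_smul, smul_smul, smul_smul,
    smul_eq_mul]
  congr 1
  ring

theorem bracket_cartanElt_coord (X J : Finset (Gen n)) (A : Finset (Fin n))
    (h : ¬Even (X.card + J.card)) :
    (monoBasis n).coord J (bracket (monoBasis n X) (cartanElt A)) = 0 :=
  coord_eq_zero_of_parity ((mono_parity X).bracket (cartanElt_parity A)) (by simpa using h)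

theorem rad_vf (X : Finset (Gen n)) (Q : SP n) : rad n (vf (monoBasis n X) Q) =
    -((-1 : ℂ) ^ X.card • ∑ A, MvPolynomial.X A *
      radD Q (bracket (monoBasis n X) (cartanElt A))) := by
  rw [vf_apply, map_sum]
  simp only [map_mul, rad_cad, radD_apply, neg_mul, Finset.sum_neg_distrib, Finset.mul_sum]
  rw [Finset.sum_comm, Finset.smul_sum]
  congr 1
  refine Finset.sum_congr rfl fun J _ => ?_
  by_cases h : Even (X.card + J.card)
  · have h2 : (-1 : ℂ) ^ (J.card * X.card) = (-1) ^ X.card := by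
      refine neg_one_pow_congr ?_
      rw [Nat.even_add] at h
      rw [Nat.even_add, Nat.even_mul]
      tauto
    rw [h2, smul_mul_assoc, Finset.sum_mul]
    congr 1
    refine Finset.sum_congr rfl fun A _ => ?_
    rw [smul_mul_assoc, mul_smul_comm]
  · simp only [bracket_cartanElt_coord X J _ h, zero_smul, Finset.sum_const_zero, smul_zero,
      zero_mul, mul_zero]

/-- The relation between the restrictions of the derivatives of an invariant, first order. -/
theorem sum_X_mul_radD {Q : SP n} (h : ∀ X, rad n (vf (monoBasis n X) Q) = 0) (v : Po n) :
    ∑ A, MvPolynomial.X A * radD Q (bracket v (cartanElt A)) = 0 := by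
  have key : (∑ A, LinearMap.mulLeft ℂ (MvPolynomial.X A) ∘ₗ radD Q ∘ₗ
      bracketL.flip (cartanElt A)) = 0 := by
    refine (monoBasis n).ext fun X => ?_
    have h1 := rad_vf X Q
    rw [h X, eq_comm, neg_eq_zero] at h1
    simpa [bracketL_apply] using h1
  simpa [bracketL_apply] using congrArg (fun f => f v) key

/-- The restriction to the Cartan subalgebra of the second derivative of `P`. -/
def radD2 (P : SP n) (v w : Po n) : CP n :=
  ∑ K, (monoBasis n).coord K w • radD (sDer K P) v

/-- Differentiating the invariance equation along t_K shows that the field sends ∂_K P to a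
combination of first derivatives of P. -/
theorem rad_vf_sDer {P : SP n} (hP : P ∈ invSub n) (X K : Finset (Gen n)) :
    rad n (vf (monoBasis n X) (sDer K P)) = (-1 : ℂ) ^ X.card •
      radD P (bracket (monoBasis n X) (monoBasis n K)) := by
  have h := sDer_vf X K P
  rw [hP X, map_zero, eq_comm, add_comm] at h
  have h1 := eq_neg_of_add_eq_zero_right h
  have h2 : vf (monoBasis n X) (sDer K P) =
      (-1 : ℂ) ^ (X.card * K.card) • -∑ L, cadCoef X K L • sDer L P := by
    rw [← h1, smul_smul, ← pow_add, (Even.add_self _).neg_one_pow, one_smul]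
  rw [h2, radD_apply, map_smul, map_neg, map_sum, ← Finset.sum_neg_distrib, Finset.smul_sum,
    Finset.smul_sum]
  refine Finset.sum_congr rfl fun L _ => ?_
  change _ = (-1 : ℂ) ^ X.card • strConst X K L • rad n (sDer L P)
  by_cases h3 : Even (X.card + K.card + L.card)
  · rw [map_smul, cadCoef, neg_smul, neg_neg, smul_smul, smul_smul, ← mul_assoc, ← pow_add]
    congr 2
    refine neg_one_pow_congr ?_
    rw [Nat.even_add, Nat.even_add] at h3
    rw [Nat.even_add, Nat.even_add, Nat.even_mul, Nat.even_mul]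
    tauto
  · rw [cadCoef, strConst_eq_zero h3]; simp

/-- The relation between the restrictions of the derivatives of an invariant, second order. -/
theorem sum_X_mul_radD2 {P : SP n} (hP : P ∈ invSub n) (v w : Po n) :
    ∑ A, MvPolynomial.X A * radD2 P (bracket v (cartanElt A)) w = -radD P (bracket v w) := by
  have key : ∀ K, (∑ A, LinearMap.mulLeft ℂ (MvPolynomial.X A) ∘ₗ radD (sDer K P) ∘ₗ
      bracketL.flip (cartanElt A)) = -(radD P ∘ₗ bracketL.flip (monoBasis n K)) := by
    intro K
    refine (monoBasis n).ext fun X => ?_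
    have h1 := rad_vf X (sDer K P)
    rw [rad_vf_sDer hP, ← smul_neg] at h1
    have h2 := smul_right_injective _ (pow_ne_zero X.card (neg_ne_zero.2 (one_ne_zero (α := ℂ)))) h1
    simp only [LinearMap.sum_apply, LinearMap.comp_apply, LinearMap.mulLeft_apply,
      LinearMap.flip_apply, bracketL_apply, LinearMap.neg_apply]
    rw [h2, neg_neg]
  have key2 : ∀ K, ∑ A, MvPolynomial.X A * radD (sDer K P) (bracket v (cartanElt A)) =
      -radD P (bracket v (monoBasis n K)) := fun K => by
    simpa [bracketL_apply] using congrArg (fun f => f v) (key K)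
  simp only [radD2, Finset.mul_sum]
  rw [Finset.sum_comm]
  conv_rhs => rw [← sum_coord_smul_mono w, bracket_sum_right, map_sum, ← Finset.sum_neg_distrib]
  refine Finset.sum_congr rfl fun K _ => ?_
  rw [bracket_smul_right, map_smul, ← smul_neg, ← key2, Finset.smul_sum]
  simp only [mul_smul_comm]

/-! ### Polynomials are determined by their iterated derivatives at the origin -/

theorem exists_mem_iSup_lin (P : SP n) : P ∈ ⨆ d, lin n ^ d := by
  have hmul : ∀ I, ∀ Q ∈ ⨆ d, lin n ^ d, tc I * Q ∈ ⨆ d, lin n ^ d := by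
    intro I Q hQ
    induction hQ using Submodule.iSup_induction' with
    | mem d x hx =>
      refine Submodule.mem_iSup_of_mem (d + 1) ?_
      rw [pow_succ']
      exact Submodule.mul_mem_mul (tc_mem_lin I) hx
    | zero => rw [mul_zero]; exact zero_mem _
    | add x y _ _ hx hy => rw [mul_add]; exact add_mem hx hy
  induction P using superPoly_induction with
  | h1 p =>
    induction p using MvPolynomial.induction_on with
    | C a =>
      have : (sTmul (MvPolynomial.C a) 1 : SP n) = a • 1 := by
        rw [← sTmul_one_one, ← smul_sTmul, MvPolynomial.smul_eq_C_mul, mul_one]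
      rw [this]
      refine Submodule.smul_mem _ _ (Submodule.mem_iSup_of_mem 0 ?_)
      rw [pow_zero]; exact Submodule.one_le.1 le_rfl
    | add p q hp hq => rw [add_sTmul]; exact add_mem hp hq
    | mul_X p I hp =>
      have : (sTmul (p * MvPolynomial.X I) 1 : SP n) = tc I.1 * sTmul p 1 := by
        rw [tc_of_even I.2, sTmul_mul_sTmul, mul_comm, one_mul]
      rw [this]
      exact hmul _ _ hp
  | ha x y hx hy => exact add_mem hx hy
  | hm v x hx =>
    have : sTmul 1 (ExteriorAlgebra.ι ℂ v) = ∑ I : OddIdx n, v I • (tc I.1 : SP n) := by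
      have hv : v = ∑ I, v I • (Pi.single I 1 : OddIdx n → ℂ) := by
        ext J; simp [Finset.sum_apply, Pi.single_apply]
      have hL : ∀ w : OddIdx n → ℂ, (sTmul 1 (ExteriorAlgebra.ι ℂ w) : SP n) =
          (TensorProduct.mk ℂ (MvPolynomial (EvenIdx n) ℂ) _ 1 ∘ₗ ExteriorAlgebra.ι ℂ) w :=
        fun _ => rfl
      have hI : ∀ I : OddIdx n, (tc I.1 : SP n) =
          (TensorProduct.mk ℂ (MvPolynomial (EvenIdx n) ℂ) _ 1 ∘ₗ ExteriorAlgebra.ι ℂ)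
            (Pi.single I 1) := fun I => tc_of_not_even (Nat.not_even_iff_odd.2 I.2)
      rw [hL]
      conv_lhs => rw [hv]
      rw [map_sum]
      refine Finset.sum_congr rfl fun I _ => ?_
      rw [map_smul, hI]
      rfl
    rw [this, Finset.sum_mul]
    refine sum_mem fun I _ => ?_
    rw [smul_mul_assoc]
    exact Submodule.smul_mem _ _ (hmul _ _ hx)

theorem evS_zero_of_mem {d : ℕ} {P : SP n} (h : P ∈ lin n ^ (d + 1)) : evS 0 P = 0 := by
  refine lin_pow_induction (p := fun P => evS 0 P = 0) (map_zero _) ?_ ?_ ?_ h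
  · intro x y hx hy; rw [map_add, hx, hy, add_zero]
  · intro c x hx; rw [map_smul, hx, smul_zero]
  · intro I Q _; rw [map_mul, evS_tc, zero_mul]

/-- Each step of the recursion lowers the degree by one: a form of another degree either vanishes on
the way or ends with positive degree, and then vanishes at the origin. -/
theorem symm_of_ne {d e : ℕ} {P : SP n} (h : P ∈ lin n ^ e) (hde : e ≠ d) : symm d P = 0 := by
  induction d generalizing e P with
  | zero =>
    obtain ⟨e, rfl⟩ := Nat.exists_eq_succ_of_ne_zero hde
    rw [symm_zero, evS_zero_of_mem h, map_zero]
  | succ d ih =>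
    have : ∀ J, symm d (sDer J P) = 0 := fun J => by
      rcases e with _ | e
      · obtain ⟨c, rfl⟩ := mem_lin_pow_zero h
        rw [sDer_algebraMap, map_zero]
      · exact ih (sDer_mem h J) (by omega)
    rw [symm_succ]
    simp [this]

theorem eq_zero_of_symm {P : SP n} (h : ∀ d, symm d P = 0) : P = 0 := by
  -- Asking for all larger `M` lets two summands be treated with a common bound.
  have key : ∃ N, ∀ M, N ≤ M →
      ∑ d ∈ Finset.range M, TensorAlgebra.lift ℂ (flatS n) (symm d P) = P := by
    clear h
    have hP := exists_mem_iSup_lin P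
    induction hP using Submodule.iSup_induction' with
    | mem e x hx =>
      refine ⟨e + 1, fun M hM => ?_⟩
      rw [Finset.sum_eq_single e, lift_flatS_symm hx]
      · intro d _ hd
        rw [symm_of_ne hx hd.symm, map_zero]
      · intro h
        exact absurd (Finset.mem_range.2 hM) h
    | zero => exact ⟨0, fun M _ => by simp⟩
    | add x y _ _ hx hy =>
      obtain ⟨N, hN⟩ := hx
      obtain ⟨N', hN'⟩ := hy
      refine ⟨max N N', fun M hM => ?_⟩
      simp only [map_add, Finset.sum_add_distrib]
      rw [hN M (le_trans (le_max_left _ _) hM), hN' M (le_trans (le_max_right _ _) hM)]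
  obtain ⟨N, hN⟩ := key
  rw [← hN N le_rfl]
  exact Finset.sum_eq_zero fun d _ => by rw [h, map_zero]

/-- The span of the iterated derivatives of order `m`. -/
def derSpan (P : SP n) : ℕ → Submodule ℂ (SP n)
  | 0 => Submodule.span ℂ {P}
  | m + 1 => ⨆ J, (derSpan P m).map (sDer J)

theorem sDer_mem_derSpan {P Q : SP n} {m : ℕ} (h : Q ∈ derSpan P m) (J : Finset (Gen n)) :
    sDer J Q ∈ derSpan P (m + 1) :=
  Submodule.mem_iSup_of_mem J ⟨Q, h, rfl⟩

/-- The commutator of the field with ∂_J is a combination of the ∂_K, because the field has linear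
coefficients. Hence the order of differentiation is preserved. -/
theorem vf_mem_derSpan {P : SP n} (hP : P ∈ invSub n) (X : Finset (Gen n)) {m : ℕ} {Q : SP n}
    (h : Q ∈ derSpan P m) : vf (monoBasis n X) Q ∈ derSpan P m := by
  induction m generalizing Q with
  | zero =>
    obtain ⟨c, rfl⟩ := Submodule.mem_span_singleton.1 h
    rw [map_smul, hP X, smul_zero]
    exact zero_mem _
  | succ m ih =>
    rw [derSpan] at h
    induction h using Submodule.iSup_induction' with
    | mem J x hx =>
      obtain ⟨Q, hQ, rfl⟩ := hx
      have h1 := sDer_vf X J Q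
      have h2 : vf (monoBasis n X) (sDer J Q) = (-1 : ℂ) ^ (X.card * J.card) •
          (sDer J (vf (monoBasis n X) Q) - ∑ K, cadCoef X J K • sDer K Q) := by
        rw [h1, add_sub_cancel_right, smul_smul, ← pow_add, (Even.add_self _).neg_one_pow, one_smul]
      rw [h2]
      exact Submodule.smul_mem _ _ (sub_mem (sDer_mem_derSpan (ih hQ) J)
        (sum_mem fun K _ => Submodule.smul_mem _ _ (sDer_mem_derSpan hQ K)))
    | zero => rw [map_zero]; exact zero_mem _
    | add x y _ _ hx hy => rw [map_add]; exact add_mem hx hy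

/-- The recursion ends by evaluating iterated derivatives at the origin, which is a point of the
Cartan subalgebra. -/
theorem symm_of_derSpan {P : SP n} (h : ∀ m, ∀ Q ∈ derSpan P m, rad n Q = 0) (d : ℕ) {m : ℕ}
    {Q : SP n} (hQ : Q ∈ derSpan P m) : symm d Q = 0 := by
  induction d generalizing m Q with
  | zero =>
    have h1 := eval_rad 0 Q
    have h2 : cartanPt (n := n) 0 = 0 := by ext I; simp [cartanPt]
    rw [h m Q hQ, map_zero, h2] at h1
    rw [symm_zero, ← h1, map_zero]
  | succ d ih =>
    rw [symm_succ]
    simp [ih (sDer_mem_derSpan hQ _)]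

theorem eq_zero_of_derSpan {P : SP n} (h : ∀ m, ∀ Q ∈ derSpan P m, rad n Q = 0) : P = 0 :=
  eq_zero_of_symm fun d => symm_of_derSpan h d (m := 0) (Submodule.mem_span_singleton_self P)

/-! ### Four odd generators: the action on the Cartan subalgebra -/

theorem bracket_mul_right_of_even (v : Po n) {h : Po n} (hh : HasParity parityAut 0 h) (z : Po n) :
    bracket v (h * z) = bracket v h * z + h * bracket v z := by
  have key : bracketL.flip (h * z) = LinearMap.mulRight ℂ z ∘ₗ bracketL.flip h +
      LinearMap.mulLeft ℂ h ∘ₗ bracketL.flip z := by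
    refine (monoBasis n).ext fun X => ?_
    have := bracket_mul X hh z
    simpa [bracketL_apply] using this
  simpa [bracketL_apply] using congrArg (fun f => f v) key

theorem bracket_one (v : Po n) : bracket v 1 = 0 := by
  rw [bracket_eq]; simp [pdiff_one]

theorem cartanElt_empty : (cartanElt ∅ : Po n) = 1 := by simp [cartanElt]

theorem cartanElt_singleton (i : Fin n) : (cartanElt {i} : Po n) = uu i := by
  rw [cartanElt_eq]; simp

theorem cartanElt_univ_two : (cartanElt Finset.univ : Po 2) = uu 0 * uu 1 := by
  rw [cartanElt_eq]
  have : (Finset.univ : Finset (Fin 2)).sort (· ≤ ·) = [0, 1] := by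
    refine List.Perm.eq_of_pairwise' (r := (· ≤ ·)) (Finset.pairwise_sort _ _) (by decide) ?_
    refine (List.perm_ext_iff_of_nodup (Finset.sort_nodup _ _) (by decide)).2 fun i => ?_
    fin_cases i <;> simp
  rw [this]; simp

theorem sum_finset_fin_two {M : Type*} [AddCommMonoid M] (f : Finset (Fin 2) → M) :
    ∑ A, f A = f ∅ + f {0} + f {1} + f Finset.univ := by
  have : (Finset.univ : Finset (Finset (Fin 2))) = {∅, {0}, {1}, Finset.univ} := by decide
  rw [this, Finset.sum_insert (by decide), Finset.sum_insert (by decide),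
    Finset.sum_insert (by decide), Finset.sum_singleton]
  abel

/-- The action of a weight vector on the Cartan subalgebra. -/
theorem sum_X_mul_of_weight {D : Po 2 →ₗ[ℂ] CP 2} {v : Po 2} {w₀ w₁ : ℂ}
    (h0 : bracket v (uu 0) = w₀ • v) (h1 : bracket v (uu 1) = w₁ • v) :
    ∑ A, MvPolynomial.X A * D (bracket v (cartanElt A)) =
      (w₀ • MvPolynomial.X {0} + w₁ • MvPolynomial.X {1}) * D v +
        MvPolynomial.X Finset.univ * D (w₀ • (v * uu 1) + w₁ • (v * uu 0)) := by
  rw [sum_finset_fin_two, cartanElt_empty, cartanElt_singleton, cartanElt_singleton,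
    cartanElt_univ_two, bracket_one, bracket_mul_right_of_even _ (uu_parity 0), h0, h1]
  rw [mul_smul_comm, even_comm (uu_parity 0) v, smul_mul_assoc, map_smul, map_smul, map_zero,
    mul_zero, zero_add, add_mul, smul_mul_assoc, smul_mul_assoc, mul_smul_comm, mul_smul_comm]

/-- The weight of a generator. -/
def wt (a : Gen n) : ℂ := if (ofLex a).2 = 0 then 1 else -1

theorem bracket_gen (a : Gen n) (g : Po n) : bracket (gen a) g = -pdiff (conj a) g := by
  rw [bracket_eq, Finset.sum_eq_single a]
  · rw [parityAut_gen, map_neg, pdiff_gen, if_pos rfl, neg_one_mul]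
  · intro b _ hb
    rw [parityAut_gen, map_neg, pdiff_gen, if_neg hb, neg_zero, zero_mul]
  · simp

theorem bracket_gen_uu (i j : Fin n) (b : Fin 2) :
    bracket (gen (toLex (i, b))) (uu j) =
      (if i = j then wt (toLex (i, b)) else 0) • gen (toLex (i, b)) := by
  rw [bracket_gen]
  fin_cases b
  · change -pdiff (conj (toLex (i, 0))) _ = (if i = j then (1 : ℂ) else 0) • gen (toLex (i, 0))
    rw [conj_xi, pdiff_eta_uu]
    split_ifs <;> simp
  · change -pdiff (conj (toLex (i, 1))) _ = (if i = j then (-1 : ℂ) else 0) • gen (toLex (i, 1))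
    rw [conj_eta, pdiff_xi_uu]
    split_ifs <;> simp

/-- The bracket with an even element on the right is an even derivation. -/
theorem bracket_mul_left_of_even {h : Po n} (hh : HasParity parityAut 0 h) (v z : Po n) :
    bracket (v * z) h = bracket v h * z + v * bracket z h := by
  rw [bracket_eq, bracket_eq, bracket_eq, Finset.sum_mul, Finset.mul_sum,
    ← Finset.sum_add_distrib]
  refine Finset.sum_congr rfl fun a _ => ?_
  have h1 := ext_isSuperComm 1 _ z ((hh.pdiff (conj a)).congr ⟨1, rfl⟩)
  rw [pow_one] at h1
  rw [map_mul, pdiff_isSuperDer a, pow_one, add_mul, mul_assoc, mul_assoc, mul_assoc, h1]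
  congr 2
  exact CliffordAlgebra.involute_involute v

theorem bracket_one_left (g : Po n) : bracket 1 g = 0 := by
  rw [bracket_eq]; simp [pdiff_one]

/-- The basis of the Grassmann algebra on `ξ_i, η_i`. -/
def block (i : Fin n) : Fin 4 → Po n :=
  ![1, gen (toLex (i, 0)), gen (toLex (i, 1)), uu i]

/-- The weights of the basis of the Grassmann algebra on `ξ_i, η_i`. -/
def blockWt : Fin 4 → ℂ := ![0, 1, -1, 0]

theorem bracket_block_uu (i j : Fin n) (s : Fin 4) :
    bracket (block i s) (uu j) = (if i = j then blockWt s else 0) • block i s := by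
  have h0 := bracket_gen_uu i j 0
  have h1 := bracket_gen_uu i j 1
  fin_cases s
  · change bracket 1 _ = (if i = j then (0 : ℂ) else 0) • (1 : Po n)
    rw [bracket_one_left]; simp
  · exact h0
  · exact h1
  · change bracket (uu i) _ = (if i = j then (0 : ℂ) else 0) • uu i
    rw [uu, bracket_mul_left_of_even (uu_parity j), h0, h1, smul_mul_assoc, mul_smul_comm,
      ← add_smul]
    congr 1
    split_ifs <;> simp [wt]

/-- The sixteen products of blocks are weight vectors for ξ_0η_0 and ξ_1η_1. -/
theorem bracket_block_mul_block (s t : Fin 4) :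
    bracket (block 0 s * block 1 t : Po 2) (uu 0) = blockWt s • (block 0 s * block 1 t) ∧
    bracket (block 0 s * block 1 t : Po 2) (uu 1) = blockWt t • (block 0 s * block 1 t) := by
  constructor <;>
  · rw [bracket_mul_left_of_even (uu_parity _), bracket_block_uu, bracket_block_uu]
    simp

theorem block_mul_uu (i : Fin n) {s : Fin 4} (hs : s ≠ 0) : block i s * uu i = 0 := by
  fin_cases s
  · exact absurd rfl hs
  · change gen (toLex (i, 0)) * uu i = 0
    rw [uu, ← mul_assoc, gen_mul_self, zero_mul]
  · change gen (toLex (i, 1)) * uu i = 0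
    rw [uu, gen_mul_gen, mul_neg, ← mul_assoc, gen_mul_self, zero_mul, neg_zero]
  · change uu i * uu i = 0
    rw [uu, mul_assoc, ← mul_assoc (gen (toLex (i, 1))), gen_mul_gen (toLex (i, 1)),
      neg_mul, mul_neg, mul_assoc, gen_mul_self, mul_zero, mul_zero, neg_zero]

theorem weight_ne_zero {w₀ w₁ : ℂ} (h : w₀ ≠ 0 ∨ w₁ ≠ 0) :
    w₀ • MvPolynomial.X {0} + w₁ • MvPolynomial.X {1} ≠ (0 : CP 2) := by
  intro h2
  have h3 := congrArg (MvPolynomial.eval (singles ![1, 0])) h2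
  have h4 := congrArg (MvPolynomial.eval (singles ![0, 1])) h2
  simp only [MvPolynomial.smul_eval, map_add, MvPolynomial.eval_X, singles_singleton, map_zero] at h3 h4
  rcases h with h | h
  · exact h (by simpa using h3)
  · exact h (by simpa using h4)

/-- A linear map subject to the first order relations vanishes on the non-Cartan monomials. -/
theorem apply_block_of_weight {D : Po 2 →ₗ[ℂ] CP 2}
    (hD : ∀ v, ∑ A, MvPolynomial.X A * D (bracket v (cartanElt A)) = 0) {s t : Fin 4}
    (h : blockWt s ≠ 0 ∨ blockWt t ≠ 0) : D (block 0 s * block 1 t) = 0 := by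
  -- The relation reads (nonzero linear form) · D(v) + y · D(correction) = 0, so a vanishing
  -- correction forces D(v) = 0 in the integral domain `CP 2`.
  have step : ∀ s t, (blockWt s ≠ 0 ∨ blockWt t ≠ 0) →
      D (blockWt s • (block 0 s * block 1 t * uu 1) + blockWt t • (block 0 s * block 1 t * uu 0)) =
        0 → D (block 0 s * block 1 t) = 0 := by
    intro s t hw h0
    have h1 := sum_X_mul_of_weight (D := D) (bracket_block_mul_block s t).1
      (bracket_block_mul_block s t).2
    rw [hD, h0, mul_zero, add_zero, eq_comm] at h1
    exact (mul_eq_zero.1 h1).resolve_left (weight_ne_zero hw)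
  have hr : ∀ s t, t ≠ 0 → (block 0 s * block 1 t * uu 1 : Po 2) = 0 := fun s t ht => by
    rw [mul_assoc, block_mul_uu 1 ht, mul_zero]
  have hl : ∀ s t, s ≠ 0 → (block 0 s * block 1 t * uu 0 : Po 2) = 0 := fun s t hs => by
    rw [mul_assoc, ← even_comm (uu_parity 0), ← mul_assoc, block_mul_uu 0 hs, zero_mul]
  have hw0 : ∀ s, blockWt s ≠ 0 → s ≠ 0 := by rintro s hs rfl; exact hs rfl
  have h3 : blockWt 3 = 0 := rfl
  by_cases hs : s = 0
  · subst hs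
    have ht : blockWt t ≠ 0 := h.resolve_left (fun h => h rfl)
    have hb : blockWt 0 = 0 := rfl
    refine step 0 t h ?_
    rw [hb, zero_smul, zero_add, map_smul]
    have : (block 0 0 * block 1 t * uu 0 : Po 2) = block 0 3 * block 1 t := by
      rw [mul_assoc, ← even_comm (uu_parity 0)]
      exact one_mul _
    -- The correction is D at ξ_0η_0 times the vector. Its own correction vanishes because (ξ_0η_0)²
    -- = 0, so two rounds suffice.
    rw [this, step 3 t (Or.inr ht), smul_zero]
    rw [h3, zero_smul, zero_add, hl 3 t (by decide), smul_zero, map_zero]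
  · by_cases ht : t = 0
    · subst ht
      have hs' : blockWt s ≠ 0 := h.resolve_right (fun h => h rfl)
      have hb : blockWt 0 = 0 := rfl
      refine step s 0 h ?_
      rw [hb, zero_smul, add_zero, map_smul]
      have : (block 0 s * block 1 0 * uu 1 : Po 2) = block 0 s * block 1 3 := by
        rw [mul_assoc]
        exact congrArg _ (one_mul _)
      rw [this, step s 3 (Or.inl hs'), smul_zero]
      rw [h3, zero_smul, add_zero, hr s 3 (by decide), smul_zero, map_zero]
    · refine step s t h ?_
      rw [hr s t ht, hl s t hs, smul_zero, smul_zero, add_zero, map_zero]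

theorem gen_mul_block (i : Fin n) (b : Fin 2) (s : Fin 4) :
    ∃ (c : ℂ) (s' : Fin 4), gen (toLex (i, b)) * block i s = c • block i s' := by
  fin_cases b <;> fin_cases s
  · exact ⟨1, 1, (mul_one _).trans (one_smul _ _).symm⟩
  · exact ⟨0, 0, (gen_mul_self _).trans (zero_smul _ _).symm⟩
  · exact ⟨1, 3, (one_smul _ _).symm⟩
  · exact ⟨0, 0, (block_mul_uu i (s := 1) (by decide)).trans (zero_smul _ _).symm⟩
  · exact ⟨1, 2, (mul_one _).trans (one_smul _ _).symm⟩
  · exact ⟨-1, 3, (gen_mul_gen _ _).trans (neg_one_smul _ _).symm⟩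
  · exact ⟨0, 0, (gen_mul_self _).trans (zero_smul _ _).symm⟩
  · exact ⟨0, 0, (block_mul_uu i (s := 2) (by decide)).trans (zero_smul _ _).symm⟩

theorem block_parity (i : Fin n) (s : Fin 4) : ∃ q, HasParity parityAut q (block i s) := by
  fin_cases s
  · exact ⟨0, HasParity.one⟩
  · exact ⟨1, gen_parity _⟩
  · exact ⟨1, gen_parity _⟩
  · exact ⟨0, uu_parity _⟩

theorem mem_span_block (v : Po 2) : v ∈ Submodule.span ℂ
    (Set.range fun p : Fin 4 × Fin 4 => (block 0 p.1 * block 1 p.2 : Po 2)) := by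
  induction v using po_induction with
  | h1 => exact Submodule.subset_span ⟨(0, 0), one_mul _⟩
  | hs c x hx => exact Submodule.smul_mem _ _ hx
  | ha x y hx hy => exact add_mem hx hy
  | hm a x hx =>
    induction hx using Submodule.span_induction with
    | mem x hx =>
      obtain ⟨⟨s, t⟩, rfl⟩ := hx
      obtain ⟨i, b⟩ := a
      fin_cases i
      · obtain ⟨c, s', h⟩ := gen_mul_block (0 : Fin 2) b s
        have h2 : gen (toLex (0, b)) * (block 0 s * block 1 t : Po 2) =
            c • (block 0 s' * block 1 t) := by rw [← mul_assoc, h, smul_mul_assoc]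
        exact (congrArg (· ∈ _) h2).mpr (Submodule.smul_mem _ _ (Submodule.subset_span
          ⟨(s', t), rfl⟩))
      · obtain ⟨c, t', h⟩ := gen_mul_block (1 : Fin 2) b t
        obtain ⟨q, hq⟩ := block_parity (0 : Fin 2) s
        have h2 : gen (toLex (1, b)) * (block 0 s * block 1 t : Po 2) =
            ((-1 : ℂ) ^ (1 * q) * c) • (block 0 s * block 1 t') := by
          rw [← mul_assoc, ext_isSuperComm.mul_comm (gen_parity _) hq, smul_mul_assoc, mul_assoc,
            h, mul_smul_comm, smul_smul]
        exact (congrArg (· ∈ _) h2).mpr (Submodule.smul_mem _ _ (Submodule.subset_span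
          ⟨(s, t'), rfl⟩))
    | zero => rw [mul_zero]; exact zero_mem _
    | add x y _ _ hx hy => rw [mul_add]; exact add_mem hx hy
    | smul c x _ hx => rw [mul_smul_comm]; exact Submodule.smul_mem _ _ hx

/-- The block products of weight zero are exactly the four Cartan elements, where D vanishes by
hypothesis; the relations take care of the others. -/
theorem eq_zero_of_relations {D : Po 2 →ₗ[ℂ] CP 2}
    (hD : ∀ v, ∑ A, MvPolynomial.X A * D (bracket v (cartanElt A)) = 0)
    (hC : ∀ A, D (cartanElt A) = 0) : D = 0 := by
  refine LinearMap.ext fun v => ?_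
  have hv := mem_span_block v
  induction hv using Submodule.span_induction with
  | mem x hx =>
    obtain ⟨⟨s, t⟩, rfl⟩ := hx
    change D (block 0 s * block 1 t) = 0
    by_cases h : blockWt s ≠ 0 ∨ blockWt t ≠ 0
    · exact apply_block_of_weight hD h
    · rw [not_or, not_not, not_not] at h
      have hz : ∀ s, blockWt s = 0 → s = 0 ∨ s = 3 := by
        intro s hs
        fin_cases s <;> simp_all [blockWt]
      have e0 := hC ∅
      have e1 := hC {0}
      have e2 := hC {1}
      have e3 := hC Finset.univ
      rw [cartanElt_empty] at e0
      rw [cartanElt_singleton] at e1 e2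
      rw [cartanElt_univ_two] at e3
      rcases hz s h.1 with rfl | rfl <;> rcases hz t h.2 with rfl | rfl
      · exact (congrArg D (one_mul _)).trans e0
      · exact (congrArg D (one_mul _)).trans e2
      · exact (congrArg D (mul_one _)).trans e1
      · exact e3
  | zero => rw [map_zero, LinearMap.zero_apply]
  | add x y _ _ hx hy => rw [map_add, hx, hy, map_add]
  | smul c x _ hx => rw [map_smul, hx, map_smul]

/-- An invariant polynomial is determined by its radial part. -/
theorem eq_zero_of_rad_eq_zero {P : SP 2} (hP : P ∈ invSub 2) (h : rad 2 P = 0) : P = 0 := by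
  refine eq_zero_of_derSpan fun m => ?_
  induction m with
  | zero =>
    intro Q hQ
    obtain ⟨c, rfl⟩ := Submodule.mem_span_singleton.1 hQ
    rw [map_smul, h, smul_zero]
  | succ m ih =>
    intro Q hQ
    rw [derSpan] at hQ
    induction hQ using Submodule.iSup_induction' with
    | mem J x hx =>
      obtain ⟨Q, hQ, rfl⟩ := hx
      -- The fields keep `Q` among the derivatives of order m, whose restrictions vanish by
      -- induction; this gives the relations. Along Cartan directions the derivative of the zero
      -- restriction is zero.
      have : radD Q = 0 := by
        refine eq_zero_of_relations (sum_X_mul_radD fun X => ih _ (vf_mem_derSpan hP X hQ))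
          fun A => ?_
        rw [radD_cartanElt, ih Q hQ, map_zero]
      rw [← radD_mono, this, LinearMap.zero_apply]
    | zero => rw [map_zero]
    | add x y _ _ hx hy => rw [map_add, hx, hy, add_zero]

/-! ### The conditions on radial parts of invariants -/

-- The map `L` is independent of the weight vector, so relations for different vectors with the same
-- `w` can be combined.
open MvPolynomial in
theorem radD2_weight {P : SP 2} (hP : P ∈ invSub 2) (s t : Fin 4) (w : Po 2) :
    ∃ L : Po 2 →ₗ[ℂ] CP 2, (∀ v, L v = radD2 P v w) ∧
      (blockWt s • X {0} + blockWt t • X {1}) * L (block 0 s * block 1 t) +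
        X Finset.univ * L (blockWt s • (block 0 s * block 1 t * uu 1) +
          blockWt t • (block 0 s * block 1 t * uu 0)) =
      -radD P (bracket (block 0 s * block 1 t) w) := by
  refine ⟨∑ K, (monoBasis 2).coord K w • radD (sDer K P), fun v => ?_, ?_⟩
  · simp [radD2]
  · rw [← sum_X_mul_of_weight (bracket_block_mul_block s t).1 (bracket_block_mul_block s t).2,
      ← sum_X_mul_radD2 hP]
    simp [radD2]

theorem bracket_gen_right (v : Po n) (a : Gen n) :
    bracket v (gen a) = pdiff (conj a) (parityAut v) := by
  rw [bracket_eq, Finset.sum_eq_single (conj a)]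
  · rw [conj_conj, pdiff_gen, if_pos rfl, mul_one]
  · intro b _ hb
    rw [pdiff_gen, if_neg, mul_zero]
    intro h
    exact hb (by rw [← h, conj_conj])
  · simp

theorem pdiff_uu_of_ne (a : Gen n) {j : Fin n} (h : (ofLex a).1 ≠ j) : pdiff a (uu j) = 0 := by
  have := pdiff_uprod_of_notMem (n := n) a (L := [j]) (by simpa using h)
  simpa using this

/-- The pairs have opposite weights, so their brackets fall into the Cartan subalgebra, where `radD`
is an honest partial derivative of the radial part. -/
theorem bracket_blocks :
    bracket (block 0 1 * block 1 3 : Po 2) (gen (toLex (0, 1))) = -uu 1 ∧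
    bracket (block 0 1 * block 1 0 : Po 2) (gen (toLex (0, 1))) = -1 ∧
    bracket (block 0 3 * block 1 1 : Po 2) (gen (toLex (1, 1))) = -uu 0 ∧
    bracket (block 0 0 * block 1 1 : Po 2) (gen (toLex (1, 1))) = -1 ∧
    bracket (block 0 1 * block 1 2 : Po 2) (block 0 2 * block 1 1) = uu 0 - uu 1 ∧
    bracket (block 0 1 * block 1 1 : Po 2) (block 0 2 * block 1 2) = uu 0 + uu 1 := by
  have par : ∀ i : Fin 2, parityAut (uu i : Po 2) = uu i := fun i => by
    have := uu_parity i (n := 2)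
    rwa [HasParity, pow_zero, one_smul] at this
  have b0 : ∀ i : Fin 2, (block i 0 : Po 2) = 1 := fun _ => rfl
  have b1 : ∀ i : Fin 2, (block i 1 : Po 2) = gen (toLex (i, 0)) := fun _ => rfl
  have b2 : ∀ i : Fin 2, (block i 2 : Po 2) = gen (toLex (i, 1)) := fun _ => rfl
  have b3 : ∀ i : Fin 2, (block i 3 : Po 2) = uu i := fun _ => rfl
  simp only [b0, b1, b2, b3]
  refine ⟨?_, ?_, ?_, ?_, ?_, ?_⟩
  · rw [bracket_gen_right, map_mul parityAut, parityAut_gen, par, conj_eta, neg_mul, map_neg,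
      pdiff_gen_mul, if_pos rfl, pdiff_uu_of_ne _ (by decide), mul_zero, sub_zero]
  · rw [bracket_gen_right, mul_one, parityAut_gen, conj_eta, map_neg, pdiff_gen, if_pos rfl]
  · rw [bracket_gen_right, map_mul parityAut, parityAut_gen, par, conj_eta, mul_neg, map_neg,
      pdiff_uu_mul, pdiff_uu_of_ne _ (by decide), zero_mul, zero_add, pdiff_gen, if_pos rfl, mul_one]
  · rw [bracket_gen_right, one_mul, parityAut_gen, conj_eta, map_neg, pdiff_gen, if_pos rfl]
  · rw [bracket_eq, sum_gen, Fin.sum_univ_two]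
    simp only [conj_xi, conj_eta, map_mul, parityAut_gen, neg_mul_neg, pdiff_gen_mul, pdiff_gen]
    simp [uu, gen_mul_gen (toLex ((1 : Fin 2), (1 : Fin 2)))]
    abel
  · rw [bracket_eq, sum_gen, Fin.sum_univ_two]
    simp only [conj_xi, conj_eta, map_mul, parityAut_gen, neg_mul_neg, pdiff_gen_mul, pdiff_gen]
    simp [uu]
    abel

-- Each condition is the second-order relation for a pair of opposite weights. For ξ_0 · ξ_1η_1 the
-- correction term vanishes; for ξ_0 the correction is the value at the former vector. The weights
-- (1, ∓1) give divisibility by x_0 ∓ x_1.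
open MvPolynomial in
theorem pderiv_rad_conditions {P : SP 2} (hP : P ∈ invSub 2) :
    (∃ a b, pderiv {1} (rad 2 P) = X {0} * a ∧
      pderiv ∅ (rad 2 P) = X {0} * b + X Finset.univ * a) ∧
    (∃ a b, pderiv {0} (rad 2 P) = X {1} * a ∧
      pderiv ∅ (rad 2 P) = X {1} * b + X Finset.univ * a) ∧
    (∃ d, pderiv {1} (rad 2 P) - pderiv {0} (rad 2 P) = X {0} * d - X {1} * d) ∧
    (∃ d, pderiv {1} (rad 2 P) + pderiv {0} (rad 2 P) = X {0} * d + X {1} * d) := by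
  obtain ⟨B1, B2, B3, B4, B5, B6⟩ := bracket_blocks
  have w0 : blockWt 0 = 0 := rfl
  have w1 : blockWt 1 = 1 := rfl
  have w2 : blockWt 2 = -1 := rfl
  have w3 : blockWt 3 = 0 := rfl
  have r0 := radD_cartanElt ∅ P
  have r1 := radD_cartanElt {0} P
  have r2 := radD_cartanElt {1} P
  rw [cartanElt_empty] at r0
  rw [cartanElt_singleton] at r1 r2
  have hr : ∀ s t, t ≠ 0 → (block 0 s * block 1 t * uu 1 : Po 2) = 0 := fun s t ht => by
    rw [mul_assoc, block_mul_uu 1 ht, mul_zero]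
  have hl : ∀ s t, s ≠ 0 → (block 0 s * block 1 t * uu 0 : Po 2) = 0 := fun s t hs => by
    rw [mul_assoc, ← even_comm (uu_parity 0), ← mul_assoc, block_mul_uu 0 hs, zero_mul]
  have e1 : (block 0 1 * block 1 0 * uu 1 : Po 2) = block 0 1 * block 1 3 := by
    rw [mul_assoc]
    exact congrArg _ (one_mul _)
  have e2 : (block 0 0 * block 1 1 * uu 0 : Po 2) = block 0 3 * block 1 1 := by
    rw [mul_assoc, ← even_comm (uu_parity 0)]
    exact one_mul _
  refine ⟨?_, ?_, ?_, ?_⟩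
  · obtain ⟨L, hL, h1⟩ := radD2_weight hP 1 3 (gen (toLex (0, 1)))
    obtain ⟨L', hL', h2⟩ := radD2_weight hP 1 0 (gen (toLex (0, 1)))
    -- Both relations use the same second argument, hence the same map; this is why the same `a`
    -- occurs in both equations.
    have : L' = L := LinearMap.ext fun v => by rw [hL, hL']
    subst this
    refine ⟨L' (block 0 1 * block 1 3), L' (block 0 1 * block 1 0), ?_, ?_⟩
    · rw [B1, map_neg, neg_neg, r2, hr 1 3 (by decide), w1, w3] at h1
      rw [← h1]; simp
    · rw [B2, map_neg, neg_neg, r0, w1, w0, e1] at h2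
      rw [← h2]; simp
  · obtain ⟨L, hL, h1⟩ := radD2_weight hP 3 1 (gen (toLex (1, 1)))
    obtain ⟨L', hL', h2⟩ := radD2_weight hP 0 1 (gen (toLex (1, 1)))
    have : L' = L := LinearMap.ext fun v => by rw [hL, hL']
    subst this
    refine ⟨L' (block 0 3 * block 1 1), L' (block 0 0 * block 1 1), ?_, ?_⟩
    · rw [B3, map_neg, neg_neg, r1, hl 3 1 (by decide), w1, w3] at h1
      rw [← h1]; simp
    · rw [B4, map_neg, neg_neg, r0, w1, w0, e2] at h2
      rw [← h2]; simp
  · obtain ⟨L, -, h1⟩ := radD2_weight hP 1 2 (block 0 2 * block 1 1)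
    refine ⟨L (block 0 1 * block 1 2), ?_⟩
    rw [B5, map_sub, r1, r2, w1, w2, hr 1 2 (by decide), hl 1 2 (by decide), neg_sub] at h1
    rw [← h1, smul_zero, smul_zero, add_zero, map_zero, mul_zero, add_zero, one_smul,
      neg_one_smul, add_mul, neg_mul, sub_eq_add_neg]
  · obtain ⟨L, -, h1⟩ := radD2_weight hP 1 1 (block 0 2 * block 1 2)
    refine ⟨-L (block 0 1 * block 1 1), ?_⟩
    rw [B6, map_add (radD P), r1, r2, w1, hr 1 1 (by decide), hl 1 1 (by decide), smul_zero,
      add_zero, map_zero, mul_zero, add_zero, one_smul, one_smul] at h1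
    linear_combination h1

/-! ### Coefficients -/

/-- The exponent with given entries. -/
def expo (i k l j : ℕ) : Finset (Fin 2) →₀ ℕ :=
  Finsupp.single ∅ i + Finsupp.single {0} k + Finsupp.single {1} l + Finsupp.single Finset.univ j

theorem expo_empty (i k l j : ℕ) : expo i k l j ∅ = i := by
  have h1 : (∅ : Finset (Fin 2)) ≠ Finset.univ := by decide
  simp [expo, h1.symm]

theorem expo_zero (i k l j : ℕ) : expo i k l j {0} = k := by
  simp [expo]

theorem expo_one (i k l j : ℕ) : expo i k l j {1} = l := by
  simp [expo]

theorem expo_univ (i k l j : ℕ) : expo i k l j Finset.univ = j := by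
  have h1 : (∅ : Finset (Fin 2)) ≠ Finset.univ := by decide
  have h2 : ({0} : Finset (Fin 2)) ≠ Finset.univ := by decide
  have h3 : ({1} : Finset (Fin 2)) ≠ Finset.univ := by decide
  simp [expo, h1, h2, h3]

theorem eq_expo (m : Finset (Fin 2) →₀ ℕ) : m = expo (m ∅) (m {0}) (m {1}) (m Finset.univ) := by
  ext A
  have : A = ∅ ∨ A = {0} ∨ A = {1} ∨ A = Finset.univ := by
    revert A; decide
  rcases this with rfl | rfl | rfl | rfl
  · rw [expo_empty]
  · rw [expo_zero]
  · rw [expo_one]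
  · rw [expo_univ]

theorem expo_add_empty (i k l j : ℕ) :
    expo i k l j + Finsupp.single ∅ 1 = expo (i + 1) k l j := by
  simp only [expo, Finsupp.single_add]; abel

theorem expo_add_zero (i k l j : ℕ) :
    expo i k l j + Finsupp.single {0} 1 = expo i (k + 1) l j := by
  simp only [expo, Finsupp.single_add]; abel

theorem expo_add_one (i k l j : ℕ) :
    expo i k l j + Finsupp.single {1} 1 = expo i k (l + 1) j := by
  simp only [expo, Finsupp.single_add]; abel

theorem expo_add_univ (i k l j : ℕ) :
    expo i k l j + Finsupp.single Finset.univ 1 = expo i k l (j + 1) := by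
  simp only [expo, Finsupp.single_add]; abel

/-- The coefficients of a polynomial on the Cartan subalgebra. -/
def co (φ : CP 2) (i k l j : ℕ) : ℂ := MvPolynomial.coeff (expo i k l j) φ

section
open MvPolynomial

theorem co_pderiv_empty (φ : CP 2) (i k l j : ℕ) :
    co (pderiv ∅ φ) i k l j = co φ (i + 1) k l j * (i + 1) := by
  rw [co, coeff_pderiv, expo_add_empty, expo_empty, co]

theorem co_pderiv_zero (φ : CP 2) (i k l j : ℕ) :
    co (pderiv {0} φ) i k l j = co φ i (k + 1) l j * (k + 1) := by
  rw [co, coeff_pderiv, expo_add_zero, expo_zero, co]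

theorem co_pderiv_one (φ : CP 2) (i k l j : ℕ) :
    co (pderiv {1} φ) i k l j = co φ i k (l + 1) j * (l + 1) := by
  rw [co, coeff_pderiv, expo_add_one, expo_one, co]

theorem co_X_mul_of_zero (φ : CP 2) {A : Finset (Fin 2)} {i k l j : ℕ}
    (h : expo i k l j A = 0) : co (X A * φ) i k l j = 0 := by
  rw [co, coeff_X_mul', if_neg]
  simpa using h

theorem co_X_zero_mul (φ : CP 2) (i k l j : ℕ) :
    co (X {0} * φ) i (k + 1) l j = co φ i k l j := by
  rw [co, ← expo_add_zero, add_comm, coeff_X_mul, co]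

theorem co_X_one_mul (φ : CP 2) (i k l j : ℕ) :
    co (X {1} * φ) i k (l + 1) j = co φ i k l j := by
  rw [co, ← expo_add_one, add_comm, coeff_X_mul, co]

theorem co_X_univ_mul (φ : CP 2) (i k l j : ℕ) :
    co (X Finset.univ * φ) i k l (j + 1) = co φ i k l j := by
  rw [co, ← expo_add_univ, add_comm, coeff_X_mul, co]

theorem co_add (φ ψ : CP 2) (i k l j : ℕ) : co (φ + ψ) i k l j = co φ i k l j + co ψ i k l j :=
  coeff_add _ _ _

theorem co_sub (φ ψ : CP 2) (i k l j : ℕ) : co (φ - ψ) i k l j = co φ i k l j - co ψ i k l j :=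
  coeff_sub _ _ _ _

end

section Conditions

open MvPolynomial

variable {φ : CP 2}

/-- Compare the coefficients free of x_0: those of ∂φ/∂c come from y·a alone, and a is ∂φ/∂x_1 with
one factor x_0 removed. -/
theorem co_of_conditions
    (h0 : ∃ a b, pderiv {1} φ = X {0} * a ∧ pderiv ∅ φ = X {0} * b + X Finset.univ * a)
    (i l j : ℕ) : co φ i 0 (l + 1) j = 0 ∧ co φ (i + 1) 0 l 0 = 0 ∧
      co φ (i + 1) 0 l (j + 1) * (i + 1) = co φ i 1 (l + 1) j * (l + 1) := by
  obtain ⟨a, b, h1, h2⟩ := h0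
  have hi : ((i : ℂ) + 1) ≠ 0 := Nat.cast_add_one_ne_zero i
  have hl : ((l : ℂ) + 1) ≠ 0 := Nat.cast_add_one_ne_zero l
  refine ⟨?_, ?_, ?_⟩
  · have := co_pderiv_one φ i 0 l j
    rw [h1, co_X_mul_of_zero _ (expo_zero _ _ _ _)] at this
    exact (mul_eq_zero.1 this.symm).resolve_right hl
  · have := co_pderiv_empty φ i 0 l 0
    rw [h2, co_add, co_X_mul_of_zero _ (expo_zero _ _ _ _),
      co_X_mul_of_zero _ (expo_univ _ _ _ _), add_zero] at this
    exact (mul_eq_zero.1 this.symm).resolve_right hi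
  · rw [← co_pderiv_empty, ← co_pderiv_one, h2, h1, co_add,
      co_X_mul_of_zero _ (expo_zero _ _ _ _), co_X_univ_mul, zero_add]
    exact (co_X_zero_mul a i 0 l j).symm

theorem co_of_conditions'
    (h0 : ∃ a b, pderiv {0} φ = X {1} * a ∧ pderiv ∅ φ = X {1} * b + X Finset.univ * a)
    (i k j : ℕ) : co φ i (k + 1) 0 j = 0 ∧
      co φ (i + 1) k 0 (j + 1) * (i + 1) = co φ i (k + 1) 1 j * (k + 1) := by
  obtain ⟨a, b, h1, h2⟩ := h0
  have hk : ((k : ℂ) + 1) ≠ 0 := Nat.cast_add_one_ne_zero k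
  refine ⟨?_, ?_⟩
  · have := co_pderiv_zero φ i k 0 j
    rw [h1, co_X_mul_of_zero _ (expo_one _ _ _ _)] at this
    exact (mul_eq_zero.1 this.symm).resolve_right hk
  · rw [← co_pderiv_empty, ← co_pderiv_zero, h2, h1, co_add,
      co_X_mul_of_zero _ (expo_one _ _ _ _), co_X_univ_mul, zero_add]
    exact (co_X_one_mul a i k 0 j).symm

/-- A multiple of x_0 + s x_1 vanishes at (x_0, x_1) = (−s, 1). This is that equation, up to sign,
for the part of bidegree 4 in x_0, x_1 free of c and y. -/
theorem co_of_antidiagonal {s : ℂ} {d ψ : CP 2} (h : ψ = X {0} * d + s • (X {1} * d))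
    (hs : s * s = 1) : s * co ψ 0 3 1 0 - co ψ 0 2 2 0 + s * co ψ 0 1 3 0
      - co ψ 0 0 4 0 - co ψ 0 4 0 0 = 0 := by
  have hsm : ∀ k l, co (s • (X {1} * d)) 0 k l 0 = s * co (X {1} * d) 0 k l 0 :=
    fun k l => coeff_smul _ _ _
  have z0 := co_X_mul_of_zero d (expo_zero 0 0 4 0)
  have z1 := co_X_mul_of_zero d (expo_one 0 4 0 0)
  have a := co_X_zero_mul d 0 0 3 0
  have a1 := co_X_zero_mul d 0 1 2 0
  have a2 := co_X_zero_mul d 0 2 1 0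
  have a3 := co_X_zero_mul d 0 3 0 0
  have b := co_X_one_mul d 0 0 3 0
  have b1 := co_X_one_mul d 0 1 2 0
  have b2 := co_X_one_mul d 0 2 1 0
  have b3 := co_X_one_mul d 0 3 0 0
  simp only [zero_add, Nat.reduceAdd] at a a1 a2 a3 b b1 b2 b3
  rw [h]
  simp only [co_add, hsm, z0, z1, a, a1, a2, a3, b, b1, b2, b3]
  linear_combination (co d 0 3 0 0 + co d 0 1 2 0) * hs

end Conditions

/-! ### Radial parts of invariants of low degree -/

section NormalForm

open MvPolynomial

theorem monomial_expo (i k l j : ℕ) (a : ℂ) : monomial (expo i k l j) a =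
    a • ((X ∅ ^ i * X Finset.univ ^ j) * (X {0} ^ k * X {1} ^ l) : CP 2) := by
  have h : expo i k l j = Finsupp.single ∅ i + Finsupp.single Finset.univ j +
      (Finsupp.single {0} k + Finsupp.single {1} l) := by
    simp only [expo]; abel
  simp only [X_pow_eq_monomial, monomial_mul, smul_monomial, smul_eq_mul, mul_one, h]

theorem eq_sum_co {φ : CP 2} {N : ℕ} (hφ : ∀ i k l j, N ≤ i + k + l + j → co φ i k l j = 0) :
    φ = ∑ p ∈ Finset.range N ×ˢ Finset.range N,
      (∑ q ∈ Finset.range N ×ˢ Finset.range N,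
        co φ q.1 p.1 p.2 q.2 • (X ∅ ^ q.1 * X Finset.univ ^ q.2)) * (X {0} ^ p.1 * X {1} ^ p.2) := by
  simp only [Finset.sum_mul, smul_mul_assoc, ← monomial_expo]
  rw [← Finset.sum_product']
  ext m
  rw [coeff_sum, Finset.sum_eq_single ((m {0}, m {1}), (m ∅, m Finset.univ))]
  · rw [← eq_expo, coeff_monomial, if_pos rfl, co, ← eq_expo]
  · rintro ⟨⟨k, l⟩, ⟨i, j⟩⟩ _ h
    rw [coeff_monomial, if_neg]
    rintro rfl
    apply h
    rw [expo_empty, expo_zero, expo_one, expo_univ]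
  · intro h
    rw [hφ _ _ _ _, monomial_zero, coeff_zero]
    simp only [Finset.mem_product, Finset.mem_range] at h
    dsimp only at h ⊢
    omega

/-- The normalized radial parts of the invariants `r_k`. -/
def sigma (i : ℕ) : CP 2 :=
  X ∅ ^ (i + 1) * X Finset.univ + ((i : ℂ) + 1) • (X ∅ ^ i * (X {0} * X {1}))

variable {φ : CP 2}

/-- The first two conditions remove every x_0^k x_1^l with k ≠ l and min(k, l) ≤ 1. Below degree six
the bad monomials left are x_0²x_1³ and x_0³x_1², which divisibility by x_0 ± x_1 excludes. -/
theorem co_eq_zero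
    (h1 : ∃ a b, pderiv {1} φ = X {0} * a ∧ pderiv ∅ φ = X {0} * b + X Finset.univ * a)
    (h2 : ∃ a b, pderiv {0} φ = X {1} * a ∧ pderiv ∅ φ = X {1} * b + X Finset.univ * a)
    (h3 : ∃ d, pderiv {1} φ - pderiv {0} φ = X {0} * d - X {1} * d)
    (h4 : ∃ d, pderiv {1} φ + pderiv {0} φ = X {0} * d + X {1} * d)
    (hφ : ∀ i k l j, 6 ≤ i + k + l + j → co φ i k l j = 0) (i k l j : ℕ)
    (h : ¬(k = l ∧ k ≤ 2)) : co φ i k l j = 0 := by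
  have hl : ∀ i l j, co φ i 0 (l + 1) j = 0 := fun i l j => (co_of_conditions h1 i l j).1
  have hk : ∀ i k j, co φ i (k + 1) 0 j = 0 := fun i k j => (co_of_conditions' h2 i k j).1
  have hl' : ∀ i l j, co φ i 1 (l + 2) j = 0 := fun i l j => by
    have := (co_of_conditions h1 i (l + 1) j).2.2
    rw [hl, zero_mul] at this
    exact (mul_eq_zero.1 this.symm).resolve_right (Nat.cast_add_one_ne_zero _)
  have hk' : ∀ i k j, co φ i (k + 2) 1 j = 0 := fun i k j => by
    have := (co_of_conditions' h2 i (k + 1) j).2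
    rw [hk, zero_mul] at this
    exact (mul_eq_zero.1 this.symm).resolve_right (Nat.cast_add_one_ne_zero _)
  obtain ⟨d, hd⟩ := h3
  obtain ⟨e, he⟩ := h4
  -- Once simplified, `a1` says that the coefficients of x_0²x_1³ and x_0³x_1² are equal, and `a2`
  -- that they are opposite.
  have a1 := co_of_antidiagonal (s := -1) (d := d) (ψ := pderiv {1} φ - pderiv {0} φ) (by rw [hd, neg_one_smul, sub_eq_add_neg])
    (by norm_num)
  have a2 := co_of_antidiagonal (s := 1) (d := e) (ψ := pderiv {1} φ + pderiv {0} φ) (by rw [he, one_smul]) (by norm_num)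
  simp only [co_add, co_sub, co_pderiv_zero, co_pderiv_one, Nat.reduceAdd, zero_add, hk 0 4 0,
    hl 0 4 0, hl' 0 2 0, hk' 0 2 0] at a1 a2
  push_cast at a1 a2
  rcases k with _ | _ | k
  · rcases l with _ | l
    · simp at h
    · exact hl _ _ _
  · rcases l with _ | _ | l
    · exact hk _ _ _
    · simp at h
    · exact hl' _ _ _
  · rcases l with _ | _ | l
    · exact hk _ _ _
    · exact hk' _ _ _
    · by_cases h5 : 6 ≤ i + (k + 2) + (l + 2) + j
      · exact hφ _ _ _ _ h5
      · have : i = 0 ∧ j = 0 ∧ (k = 0 ∧ l = 1 ∨ k = 1 ∧ l = 0) := by omega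
        rcases this with ⟨rfl, rfl, ⟨rfl, rfl⟩ | ⟨rfl, rfl⟩⟩
        · change co φ 0 2 3 0 = 0
          linear_combination (-1 / 2 : ℂ) * (a1 + a2)
        · change co φ 0 3 2 0 = 0
          linear_combination (1 / 2 : ℂ) * (a1 - a2)

theorem sum_square_of_first_row {M : Type*} [AddCommGroup M] [Module ℂ M] {a : ℕ → ℕ → ℂ}
    (ha : ∀ i, a (i + 1) 0 = 0) (N : ℕ) (m : ℕ → ℕ → M) :
    ∑ q ∈ Finset.range (N + 1) ×ˢ Finset.range (N + 1), a q.1 q.2 • m q.1 q.2 =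
      ∑ j ∈ Finset.range (N + 1), a 0 j • m 0 j +
        ∑ i ∈ Finset.range N, ∑ j ∈ Finset.range N,
          a (i + 1) (j + 1) • m (i + 1) (j + 1) := by
  rw [Finset.sum_product, Finset.sum_range_succ', add_comm]
  congr 1
  refine Finset.sum_congr rfl fun i _ => ?_
  rw [Finset.sum_range_succ', ha, zero_smul, add_zero]

theorem sum_square_succ {M : Type*} [AddCommGroup M] [Module ℂ M] {a : ℕ → ℕ → ℂ} {N : ℕ}
    (ha : ∀ j, a N j = 0) (ha' : ∀ i, a i N = 0) (m : ℕ → ℕ → M) :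
    ∑ q ∈ Finset.range (N + 1) ×ˢ Finset.range (N + 1), a q.1 q.2 • m q.1 q.2 =
      ∑ i ∈ Finset.range N, ∑ j ∈ Finset.range N, a i j • m i j := by
  rw [Finset.sum_product, Finset.sum_range_succ, Finset.sum_eq_zero (s := Finset.range (N + 1)),
    add_zero]
  · refine Finset.sum_congr rfl fun i _ => ?_
    rw [Finset.sum_range_succ, ha', zero_smul, add_zero]
  · intro j _
    rw [ha, zero_smul]

theorem sum_square_of_corner {M : Type*} [AddCommGroup M] [Module ℂ M] {a : ℕ → ℕ → ℂ}
    (ha : ∀ i j, 2 ≤ i + j → a i j = 0) (N : ℕ) (m : ℕ → ℕ → M) :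
    ∑ q ∈ Finset.range (N + 2) ×ˢ Finset.range (N + 2), a q.1 q.2 • m q.1 q.2 =
      a 0 0 • m 0 0 + (a 1 0 • m 1 0 + a 0 1 • m 0 1) := by
  have hs : ({(0, 0), (1, 0), (0, 1)} : Finset (ℕ × ℕ)) ⊆
      Finset.range (N + 2) ×ˢ Finset.range (N + 2) := by
    intro p hp
    simp only [Finset.mem_insert, Finset.mem_singleton] at hp
    rcases hp with rfl | rfl | rfl <;> simp
  rw [← Finset.sum_subset hs]
  · rw [Finset.sum_insert (by decide), Finset.sum_insert (by decide), Finset.sum_singleton]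
  · rintro ⟨i, j⟩ _ hij
    rw [ha, zero_smul]
    simp only [Finset.mem_insert, Finset.mem_singleton, Prod.mk.injEq, not_or] at hij
    change 2 ≤ i + j
    omega

/-- With p = x_0x_1, the coefficient of c^i y^j p is i+1 times that of c^{i+1} y^{j+1}, so these two
monomials combine into y^j σ_i. Positive powers of c alone do not occur, and p² can have at most one
further factor. -/
theorem eq_normal_form
    (h1 : ∃ a b, pderiv {1} φ = X {0} * a ∧ pderiv ∅ φ = X {0} * b + X Finset.univ * a)
    (h2 : ∃ a b, pderiv {0} φ = X {1} * a ∧ pderiv ∅ φ = X {1} * b + X Finset.univ * a)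
    (h3 : ∃ d, pderiv {1} φ - pderiv {0} φ = X {0} * d - X {1} * d)
    (h4 : ∃ d, pderiv {1} φ + pderiv {0} φ = X {0} * d + X {1} * d)
    (hφ : ∀ i k l j, 6 ≤ i + k + l + j → co φ i k l j = 0) :
    φ = ∑ j ∈ Finset.range 6, co φ 0 0 0 j • X Finset.univ ^ j +
      ∑ i ∈ Finset.range 5, ∑ j ∈ Finset.range 5,
        co φ (i + 1) 0 0 (j + 1) • (X Finset.univ ^ j * sigma i) +
      (co φ 0 2 2 0 • (X {0} * X {1}) ^ 2 + co φ 1 2 2 0 • (X ∅ * (X {0} * X {1}) ^ 2) +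
        co φ 0 2 2 1 • (X Finset.univ * (X {0} * X {1}) ^ 2)) := by
  have hV := co_eq_zero h1 h2 h3 h4 hφ
  have hc : ∀ i, co φ (i + 1) 0 0 0 = 0 := fun i => (co_of_conditions h1 i 0 0).2.1
  have hp : ∀ i j, co φ i 1 1 j = co φ (i + 1) 0 0 (j + 1) * (i + 1) := fun i j => by
    have := (co_of_conditions h1 i 0 j).2.2
    simpa using this.symm
  conv_lhs => rw [eq_sum_co hφ]
  have hsub : ({(0, 0), (1, 1), (2, 2)} : Finset (ℕ × ℕ)) ⊆
      Finset.range 6 ×ˢ Finset.range 6 := by decide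
  rw [← Finset.sum_subset hsub]
  · rw [Finset.sum_insert (by decide), Finset.sum_insert (by decide), Finset.sum_singleton]
    have e0 := sum_square_of_first_row (a := fun i j => co φ i 0 0 j) hc 5
      (fun i j => (X ∅ ^ i * X Finset.univ ^ j : CP 2))
    have e1 := sum_square_succ (N := 5) (a := fun i j => co φ i 1 1 j)
      (fun j => hφ 5 1 1 j (by omega)) (fun i => hφ i 1 1 5 (by omega))
      (fun i j => (X ∅ ^ i * X Finset.univ ^ j : CP 2))
    have e2 := sum_square_of_corner (a := fun i j => co φ i 2 2 j)
      (fun i j h => hφ i 2 2 j (by omega)) 4 (fun i j => (X ∅ ^ i * X Finset.univ ^ j : CP 2))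
    simp only [Nat.reduceAdd] at e0 e1 e2
    have e3 : ∀ i j, co φ (i + 1) 0 0 (j + 1) • (X Finset.univ ^ j * sigma i) =
        co φ (i + 1) 0 0 (j + 1) • (X ∅ ^ (i + 1) * X Finset.univ ^ (j + 1) : CP 2) +
        co φ i 1 1 j • (X ∅ ^ i * X Finset.univ ^ j) * (X {0} * X {1}) := by
      intro i j
      rw [sigma, hp]
      simp only [smul_eq_C_mul, map_mul]
      ring
    simp only [e0, e1, e2, e3, Finset.sum_add_distrib, ← Finset.sum_mul]
    simp only [pow_zero, pow_one, one_mul, mul_one, add_mul, smul_mul_assoc, mul_pow]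
    abel
  · rintro ⟨k, l⟩ _ hkl
    rw [Finset.sum_eq_zero, zero_mul]
    intro q _
    rw [hV, zero_smul]
    simp only [Finset.mem_insert, Finset.mem_singleton, Prod.mk.injEq, not_or] at hkl
    omega

/-- With p = x_0x_1, eliminating c from the first few σ_i gives p² = σ_0² − yσ_1 and c p² = (σ_0σ_1
− yσ_2)/2. -/
theorem mem_of_normal_form {S : Subalgebra ℂ (CP 2)} (hy : X Finset.univ ∈ S)
    (hs : ∀ i, sigma i ∈ S) {a : ℕ → ℂ} {b : ℕ → ℕ → ℂ} {e₀ e₁ e₂ : ℂ}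
    (h : φ = ∑ j ∈ Finset.range 6, a j • X Finset.univ ^ j +
      ∑ i ∈ Finset.range 5, ∑ j ∈ Finset.range 5, b i j • (X Finset.univ ^ j * sigma i) +
      (e₀ • (X {0} * X {1}) ^ 2 + e₁ • (X ∅ * (X {0} * X {1}) ^ 2) +
        e₂ • (X Finset.univ * (X {0} * X {1}) ^ 2))) : φ ∈ S := by
  have p2 : (X {0} * X {1}) ^ 2 = sigma 0 ^ 2 - X Finset.univ * sigma 1 := by
    simp only [sigma, smul_eq_C_mul, map_add, map_one, Nat.cast_zero, Nat.cast_one, C_0]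
    ring
  have cp2 : (X ∅ * (X {0} * X {1}) ^ 2 : CP 2) =
      (1 / 2 : ℂ) • (sigma 0 * sigma 1 - X Finset.univ * sigma 2) := by
    have h2 : (C (1 / 2 : ℂ) * 2 : CP 2) = 1 := by
      rw [← map_ofNat C 2, ← C_mul]; norm_num
    simp only [sigma, smul_eq_C_mul, map_add, map_one, Nat.cast_zero, Nat.cast_one, C_0,
      Nat.cast_ofNat, map_ofNat]
    linear_combination (-(X ∅ * (X {0} * X {1}) ^ 2) : CP 2) * h2
  have hp2 : ((X {0} * X {1}) ^ 2 : CP 2) ∈ S := by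
    rw [p2]
    exact sub_mem (pow_mem (hs 0) 2) (mul_mem hy (hs 1))
  have hcp2 : (X ∅ * (X {0} * X {1}) ^ 2 : CP 2) ∈ S := by
    rw [cp2]
    exact S.smul_mem (sub_mem (mul_mem (hs 0) (hs 1)) (mul_mem hy (hs 2))) _
  rw [h]
  refine add_mem (add_mem (sum_mem fun j _ => S.smul_mem (pow_mem hy j) _)
    (sum_mem fun i _ => sum_mem fun j _ => S.smul_mem (mul_mem (pow_mem hy j) (hs i)) _)) ?_
  exact add_mem (add_mem (S.smul_mem hp2 _) (S.smul_mem hcp2 _)) (S.smul_mem (mul_mem hy hp2) _)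

end NormalForm

/-! ### Invariants of degree less than six -/

theorem uu_mul_self (j : Fin n) : (uu j * uu j : Po n) = 0 := block_mul_uu j (s := 3) (by decide)

theorem uu_comm (i j : Fin n) : (uu i * uu j : Po n) = uu j * uu i := even_comm (uu_parity i) _

theorem cartanVec_two (x : Finset (Fin 2) → ℂ) : cartanVec x =
    x ∅ • 1 + x {0} • uu 0 + x {1} • uu 1 + x Finset.univ • (uu 0 * uu 1) := by
  rw [cartanVec, sum_finset_fin_two, cartanElt_empty, cartanElt_singleton, cartanElt_singleton,
    cartanElt_univ_two]

theorem cartanVec_mul (a b c d a' b' c' d' : ℂ) :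
    (a • 1 + b • uu 0 + c • uu 1 + d • (uu 0 * uu 1) : Po 2) *
      (a' • 1 + b' • uu 0 + c' • uu 1 + d' • (uu 0 * uu 1)) =
    (a * a') • 1 + (a * b' + b * a') • uu 0 + (a * c' + c * a') • uu 1 +
      (a * d' + d * a' + b * c' + c * b') • (uu 0 * uu 1) := by
  have h1 : (uu 1 * uu 0 : Po 2) = uu 0 * uu 1 := uu_comm 1 0
  have h2 : (uu 0 * (uu 0 * uu 1) : Po 2) = 0 := by rw [← mul_assoc, uu_mul_self, zero_mul]
  have h3 : (uu 1 * (uu 0 * uu 1) : Po 2) = 0 := by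
    rw [← mul_assoc, h1, mul_assoc, uu_mul_self, mul_zero]
  have h4 : (uu 0 * uu 1 * uu 0 : Po 2) = 0 := by
    rw [mul_assoc, h1, h2]
  have h5 : (uu 0 * uu 1 * uu 1 : Po 2) = 0 := by
    rw [mul_assoc, uu_mul_self, mul_zero]
  have h6 : (uu 0 * uu 1 * (uu 0 * uu 1) : Po 2) = 0 := by
    rw [← mul_assoc, h4, zero_mul]
  simp only [mul_add, add_mul, smul_mul_smul_comm, uu_mul_self, h1, h2, h3, h4, h5, h6, one_mul,
    mul_one, smul_zero, add_zero, add_smul]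
  abel

/-- Binomial expansion with (ξ_iη_i)² = 0. The exponent is shifted by two because the term with both
x_0 and x_1 uses up two factors. -/
theorem cartanVec_pow (x : Finset (Fin 2) → ℂ) (k : ℕ) : cartanVec x ^ (k + 2) =
    x ∅ ^ (k + 2) • 1 + ((k + 2) * x ∅ ^ (k + 1) * x {0}) • uu 0 +
      ((k + 2) * x ∅ ^ (k + 1) * x {1}) • uu 1 +
      ((k + 2) * (x ∅ ^ (k + 1) * x Finset.univ + (k + 1) * (x ∅ ^ k * (x {0} * x {1})))) •
        (uu 0 * uu 1) := by
  have key : ∀ {a b c d a' b' c' d' : ℂ}, a = a' → b = b' → c = c' → d = d' →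
      (a • 1 + b • uu 0 + c • uu 1 + d • (uu 0 * uu 1) : Po 2) =
        a' • 1 + b' • uu 0 + c' • uu 1 + d' • (uu 0 * uu 1) := by
    rintro _ _ _ _ _ _ _ _ rfl rfl rfl rfl; rfl
  induction k with
  | zero =>
    rw [zero_add, pow_two, cartanVec_two, cartanVec_mul]
    refine key ?_ ?_ ?_ ?_ <;> push_cast <;> ring
  | succ k ih =>
    rw [add_right_comm, pow_succ, ih, cartanVec_two, cartanVec_mul]
    refine key ?_ ?_ ?_ ?_ <;> push_cast <;> ring

theorem finRange_two : List.finRange 2 = [0, 1] := rfl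

theorem berP_uu_mul_uu : berP (uu 0 * uu 1 : Po 2) = 1 := by
  have : (uu 0 * uu 1 : Po 2) = vol 2 := by
    rw [vol, finRange_two, List.map_cons, List.map_cons, List.map_nil, List.prod_cons,
      List.prod_cons, List.prod_nil, mul_one]
  rw [this, berP_vol]

theorem berP_of_pdiff_xi {x : Po 2} (h : pdiff (toLex (0, 0)) x = 0) : berP x = 0 := by
  rw [berP_apply, finRange_two, topDerP, LinearMap.comp_apply, LinearMap.comp_apply, h,
    map_zero, map_zero, map_zero]

theorem berP_uu_zero : berP (uu 0 : Po 2) = 0 := by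
  rw [berP_apply, finRange_two, topDerP, LinearMap.comp_apply, LinearMap.comp_apply,
    pdiff_xi_uu, if_pos rfl, pdiff_gen, if_pos rfl, topDerP, LinearMap.comp_apply,
    LinearMap.comp_apply, pdiff_one, map_zero, map_zero, map_zero]

theorem berP_cartan (a b c d : ℂ) :
    berP (a • 1 + b • uu 0 + c • uu 1 + d • (uu 0 * uu 1) : Po 2) = d := by
  have h1 : berP (1 : Po 2) = 0 := berP_of_pdiff_xi (pdiff_one _)
  have h3 : berP (uu 1 : Po 2) = 0 := berP_of_pdiff_xi (pdiff_uu_of_ne _ (by decide))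
  rw [map_add, map_add, map_add, map_smul, map_smul, map_smul, map_smul, h1, berP_uu_zero, h3,
    berP_uu_mul_uu, smul_zero, smul_zero, smul_zero, add_zero, add_zero, zero_add, smul_eq_mul,
    mul_one]

section

open MvPolynomial

theorem radialPart_rInv_one : radialPart 2 (rInv 2 1) = X Finset.univ := by
  refine MvPolynomial.funext fun x => ?_
  rw [eval_radialPart, toSP_rInv, pow_one, evS_ber, evP_gf, cartanVec_two, berP_cartan, eval_X]

theorem radialPart_rInv (k : ℕ) : radialPart 2 (rInv 2 (k + 2)) = ((k : ℂ) + 2) • sigma k := by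
  refine MvPolynomial.funext fun x => ?_
  rw [eval_radialPart, toSP_rInv, evS_ber, map_pow (evP _), evP_gf, cartanVec_pow, berP_cartan]
  simp [sigma, smul_eval, mul_add]

theorem rad_isHomogeneous {n d : ℕ} {P : SP n} (h : P ∈ lin n ^ d) :
    (rad n P).IsHomogeneous d := by
  induction d generalizing P with
  | zero =>
    obtain ⟨c, rfl⟩ := mem_lin_pow_zero h
    rw [AlgHom.commutes]
    exact isHomogeneous_C _ c
  | succ d ih =>
    refine lin_pow_induction (p := fun P => (rad n P).IsHomogeneous (d + 1)) ?_ ?_ ?_ ?_ h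
    · rw [map_zero]; exact isHomogeneous_zero _ _ _
    · intro x y hx hy; rw [map_add]; exact hx.add hy
    · intro c x hx
      rw [map_smul, smul_eq_C_mul]
      simpa using (isHomogeneous_C _ c).mul hx
    · intro I Q hQ
      rw [map_mul, rad_tc, add_comm]
      refine IsHomogeneous.mul (IsHomogeneous.sum _ _ _ fun A _ => ?_) (ih hQ)
      simpa using (isHomogeneous_C _ _).mul (isHomogeneous_X ℂ A)

theorem co_radialPart_eq_zero {N : ℕ} {P : SPoly 2}
    (h : P ∈ ⨆ d : Fin N, linearFns 2 ^ (d : ℕ)) {i k l j : ℕ} (hN : N ≤ i + k + l + j) :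
    co (radialPart 2 P) i k l j = 0 := by
  induction h using Submodule.iSup_induction' with
  | mem d x hx =>
    have h1 := rad_isHomogeneous (mem_linearFns_pow.1 hx)
    rw [rad_toSP] at h1
    refine h1.coeff_eq_zero ?_
    have h2 : Finsupp.degree (expo i k l j) = i + k + l + j := by
      simp [expo, map_add]
    have := d.2
    omega
  | zero => rw [map_zero]; exact coeff_zero _
  | add x y _ _ hx hy => rw [map_add, co_add, hx, hy, add_zero]

/-- Invariants of degree less than six are polynomials in the `r_k`. -/
theorem mem_rAlgebra_of_degree_lt_six {P : SPoly 2} (hP : P ∈ invariants 2)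
    (hd : P ∈ ⨆ d : Fin 6, linearFns 2 ^ (d : ℕ)) : P ∈ rAlgebra 2 := by
  have hP' : toSP P ∈ invSub 2 := (mem_invariants_iff P).1 hP
  obtain ⟨h1, h2, h3, h4⟩ := pderiv_rad_conditions hP'
  rw [rad_toSP] at h1 h2 h3 h4
  have hnf := eq_normal_form h1 h2 h3 h4 fun i k l j h => co_radialPart_eq_zero hd h
  have hr : ∀ k, 1 ≤ k → radialPart 2 (rInv 2 k) ∈ (rAlgebra 2).map (radialPart 2) :=
    fun k hk => ⟨rInv 2 k, Algebra.subset_adjoin ⟨k, hk, rfl⟩, rfl⟩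
  have hφ : radialPart 2 P ∈ (rAlgebra 2).map (radialPart 2) := by
    refine mem_of_normal_form (radialPart_rInv_one ▸ hr 1 le_rfl) (fun i => ?_)
      (a := fun j => co (radialPart 2 P) 0 0 0 j)
      (b := fun i j => co (radialPart 2 P) (i + 1) 0 0 (j + 1)) hnf
    have h5 := hr (i + 2) (by omega)
    rw [radialPart_rInv] at h5
    have h6 : ((i : ℂ) + 2) ≠ 0 := by exact_mod_cast (Nat.succ_ne_zero (i + 1))
    have h7 := Subalgebra.smul_mem _ h5 ((i : ℂ) + 2)⁻¹
    rwa [smul_smul, inv_mul_cancel₀ h6, one_smul] at h7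
  -- `R` lies in the algebra of the r_k and has the radial part of `P`. Both being invariant,
  -- injectivity of restriction gives `P = R`.
  obtain ⟨R, hR, hRP⟩ := hφ
  have hRi : toSP R ∈ invSub 2 := (mem_invariants_iff R).1 (rAlgebra_le 2 hR)
  have h0 : toSP (P - R) = 0 := by
    refine eq_zero_of_rad_eq_zero ?_ ?_
    · rw [map_sub]; exact sub_mem hP' hRi
    · rw [rad_toSP, map_sub, sub_eq_zero]
      exact hRP.symm
  have h8 : P - R = 0 := toSP.injective (h0.trans (map_zero _).symm)
  rw [sub_eq_zero.1 h8]
  exact hR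

end

end PoissonSuper

end

theorem mainTheorem4 :
    (∀ n : ℕ, 2 ≤ n →
      Subalgebra.toSubmodule (PoissonSuper.rAlgebra n) < PoissonSuper.invariants n) ∧
    (∀ P ∈ PoissonSuper.invariants 2,
      P ∈ ⨆ d : Fin 6, PoissonSuper.linearFns 2 ^ (d : ℕ) → P ∈ PoissonSuper.rAlgebra 2) ∧
    (∃ P ∈ PoissonSuper.invariants 2,
      P ∈ PoissonSuper.linearFns 2 ^ 6 ∧
      PoissonSuper.radialPart 2 P =
        MvPolynomial.X {0} ^ 2 * MvPolynomial.X {1} ^ 2 *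
          (MvPolynomial.X {0} ^ 2 + MvPolynomial.X {1} ^ 2) ∧
      P ∉ PoissonSuper.rAlgebra 2 ∧
      ∃ z : PoissonSuper.UEnv 2,
        PoissonSuper.IsEvenCentral z ∧ PoissonSuper.IsPrincipalSymbol 6 z P) :=
  ⟨fun _ hn => PoissonSuper.rAlgebra_lt hn,
    fun _ hP hd => PoissonSuper.mem_rAlgebra_of_degree_lt_six hP hd,
    PoissonSuper.exists_special_invariant⟩
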